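/- Let $k$ be an algebraically closed field of characteristic $\neq 2$, let $n\ge 2$, and let $X=V(q_1,q_2)\subset\mathbb P^{2n}_k$ be a smooth complete intersection of two quadrics, where $q_1,q_2\in P=k[x_0,\dots,x_{2n}]$ are quadratic forms, with homogeneous coordinate ring $P_X=P/(q_1,q_2)$. Then $X$ carries an Ulrich bundle of rank $2^{n-2}$: there is a vector bundle $\mathcal E$ of rank $2^{n-2}$ on $X$ whose graded module of twisted global sections $H^0_*(\mathcal E)=\bigoplus_{m\in\mathbb Z}H^0(X,\mathcal E(m))$ is a maximal Cohen–Macaulay $P_X$-module that is generated in degree $0$ and has a linear free resolution $\cdots\to P(-2)^{b_2}\to P(-1)^{b_1}\to P^{b_0}\to H^0_*(\mathcal E)\to 0$ over $P$. -/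

import Mathlib

open CategoryTheory AlgebraicGeometry

universe u

noncomputable section

/-! ## Quotients of graded algebras by homogeneous ideals -/

section QuotientGrading

variable {k A : Type u} [Field k] [CommRing A] [Algebra k A]
  {𝒜 : ℕ → Submodule k A} [GradedAlgebra 𝒜]

/-- The degree `d` part of `A / I`: the image of the degree `d` part of `A`. -/
def quotientGrading (I : HomogeneousIdeal 𝒜) (d : ℕ) : Submodule k (A ⧸ I.toIdeal) :=
  (𝒜 d).map (Ideal.Quotient.mkₐ k I.toIdeal).toLinearMap

instance quotientGrading.gradedMonoid (I : HomogeneousIdeal 𝒜) :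
    SetLike.GradedMonoid (quotientGrading I) where
  one_mem := ⟨1, SetLike.GradedOne.one_mem, map_one (Ideal.Quotient.mkₐ k I.toIdeal)⟩
  mul_mem := by
    rintro i j _ _ ⟨a, ha, rfl⟩ ⟨b, hb, rfl⟩
    exact ⟨a * b, SetLike.GradedMul.mul_mem ha hb, map_mul (Ideal.Quotient.mkₐ k I.toIdeal) _ _⟩

/-- The projection `A_d → (A / I)_d`. -/
def quotientGrading.proj (I : HomogeneousIdeal 𝒜) (d : ℕ) : 𝒜 d →+ quotientGrading I d where
  toFun a := ⟨Ideal.Quotient.mk I.toIdeal a, a, a.2, rfl⟩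
  map_zero' := Subtype.ext (map_zero (Ideal.Quotient.mk I.toIdeal))
  map_add' a b := Subtype.ext (map_add (Ideal.Quotient.mk I.toIdeal) (a : A) (b : A))

/-- The map `A / I → ⨁ d, (A / I)_d` taking homogeneous components. -/
def quotientGrading.decomposeMap (I : HomogeneousIdeal 𝒜) :
    (A ⧸ I.toIdeal) →+ DirectSum ℕ fun d => quotientGrading I d :=
  QuotientAddGroup.lift I.toIdeal.toAddSubgroup
    ((DirectSum.map (quotientGrading.proj I)).comp
      (DirectSum.decomposeAddEquiv 𝒜).toAddMonoidHom) (by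
    intro a ha
    refine DFinsupp.ext fun d => Subtype.ext ?_
    exact Ideal.Quotient.eq_zero_iff_mem.mpr (I.isHomogeneous d (show a ∈ I.toIdeal from ha)))

theorem quotientGrading.decomposeMap_mk (I : HomogeneousIdeal 𝒜) {d : ℕ} (a : 𝒜 d) :
    quotientGrading.decomposeMap I (Ideal.Quotient.mk I.toIdeal a) =
      DirectSum.of (fun d => quotientGrading I d) d (quotientGrading.proj I d a) := by
  change DirectSum.map (quotientGrading.proj I) (DirectSum.decompose 𝒜 (a : A)) = _
  rw [DirectSum.decompose_coe]
  exact DirectSum.map_of _ _ _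

instance quotientGrading.gradedAlgebra (I : HomogeneousIdeal 𝒜) :
    GradedAlgebra (quotientGrading I) where
  toDecomposition := DirectSum.Decomposition.ofAddHom _ (quotientGrading.decomposeMap I) (by
      refine AddMonoidHom.ext fun x => ?_
      obtain ⟨a, rfl⟩ := Ideal.Quotient.mk_surjective x
      induction a using DirectSum.Decomposition.inductionOn 𝒜 with
      | zero => simp
      | add a b ha hb => rw [map_add, map_add, ha, hb, map_add]
      | homogeneous a =>
        rw [AddMonoidHom.comp_apply, quotientGrading.decomposeMap_mk]
        exact DirectSum.coeAddMonoidHom_of _ _ _) (by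
      refine DirectSum.addHom_ext' fun d => AddMonoidHom.ext ?_
      rintro ⟨_, a, ha, rfl⟩
      rw [AddMonoidHom.comp_apply, AddMonoidHom.comp_apply, DirectSum.coeAddMonoidHom_of]
      exact quotientGrading.decomposeMap_mk I ⟨a, ha⟩)

end QuotientGrading

/-! ## Twisted global sections of a sheaf of modules on `Proj` -/

section TwistedSections

variable {k A : Type u} [Field k] [CommRing A] [Algebra k A]
  {𝒜 : ℕ → Submodule k A} [GradedAlgebra 𝒜] {ι : Type} (x : ι → 𝒜 1)

/-- The section `f / x_i ^ d` of the structure sheaf of `Proj 𝒜` over `D₊(x_i)`,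
for `f` homogeneous of degree `d` and `x_i` homogeneous of degree one. -/
def projFrac (i : ι) (d : ℕ) (f : 𝒜 d) : Γ(Proj 𝒜, Proj.basicOpen 𝒜 (x i : A)) :=
  Proj.awayToSection 𝒜 (x i : A)
    (HomogeneousLocalization.Away.mk 𝒜 (x i).2 d (f : A) (by simp))

/-- The value of a section of the structure sheaf at a point, as a fraction. -/
def projEval {U : (Proj 𝒜).Opens} (p : ProjectiveSpectrum 𝒜) (hp : (p : Proj 𝒜) ∈ U) :
    Γ(Proj 𝒜, U) →+* Localization p.asHomogeneousIdeal.toIdeal.primeCompl where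
  toFun s := (s.val ⟨p, hp⟩).val
  map_one' := HomogeneousLocalization.val_one
  map_mul' _ _ := HomogeneousLocalization.val_mul _ _
  map_zero' := HomogeneousLocalization.val_zero
  map_add' _ _ := HomogeneousLocalization.val_add _ _

theorem projEval_ext {U : (Proj 𝒜).Opens} {s t : Γ(Proj 𝒜, U)}
    (h : ∀ (p : ProjectiveSpectrum 𝒜) (hp : (p : Proj 𝒜) ∈ U), projEval p hp s = projEval p hp t) :
    s = t :=
  Subtype.ext (funext fun p => HomogeneousLocalization.val_injective _ (h p.1 p.2))

theorem projEval_map {U V : (Proj 𝒜).Opens} (i : U ⟶ V) (p : ProjectiveSpectrum 𝒜)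
    (hp : (p : Proj 𝒜) ∈ U) (s : Γ(Proj 𝒜, V)) :
    projEval p hp ((Proj 𝒜).presheaf.map i.op s) = projEval p (i.le hp) s :=
  rfl

theorem projEval_projFrac (i : ι) (d : ℕ) (f : 𝒜 d) (p : ProjectiveSpectrum 𝒜)
    (hp : (p : Proj 𝒜) ∈ Proj.basicOpen 𝒜 (x i : A)) :
    projEval p hp (projFrac x i d f) =
      Localization.mk (f : A) ((⟨(x i : A), hp⟩ : p.asHomogeneousIdeal.toIdeal.primeCompl) ^ d) :=
  rfl

theorem projFrac_zero (i : ι) (d : ℕ) : projFrac x i d 0 = 0 := by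
  refine projEval_ext fun p hp => ?_
  rw [projEval_projFrac, map_zero]
  exact Localization.mk_zero _

theorem projFrac_add (i : ι) (d : ℕ) (f g : 𝒜 d) :
    projFrac x i d (f + g) = projFrac x i d f + projFrac x i d g := by
  refine projEval_ext fun p hp => ?_
  rw [map_add, projEval_projFrac, projEval_projFrac, projEval_projFrac, Localization.add_mk_self]
  rfl

theorem projFrac_one (i : ι) : projFrac x i 0 ⟨1, SetLike.GradedOne.one_mem⟩ = 1 := by
  refine projEval_ext fun p hp => ?_
  rw [map_one, projEval_projFrac, pow_zero, Localization.mk_one]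

theorem projFrac_mul (i : ι) (d e : ℕ) (f : 𝒜 d) (g : 𝒜 e) :
    projFrac x i (d + e) ⟨(f : A) * g, SetLike.GradedMul.mul_mem f.2 g.2⟩ =
      projFrac x i d f * projFrac x i e g := by
  refine projEval_ext fun p hp => ?_
  rw [map_mul, projEval_projFrac, projEval_projFrac, projEval_projFrac, Localization.mk_mul,
    pow_add]

/-- The overlap `D₊(x_i) ∩ D₊(x_j)`. -/
abbrev projOverlap (i j : ι) : (Proj 𝒜).Opens :=
  Proj.basicOpen 𝒜 (x i : A) ⊓ Proj.basicOpen 𝒜 (x j : A)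

/-- The inclusion `D₊(x_i) ∩ D₊(x_j) ⟶ D₊(x_i)`. -/
abbrev projOverlap.fst (i j : ι) : projOverlap x i j ⟶ Proj.basicOpen 𝒜 (x i : A) :=
  homOfLE inf_le_left

/-- The inclusion `D₊(x_i) ∩ D₊(x_j) ⟶ D₊(x_j)`. -/
abbrev projOverlap.snd (i j : ι) : projOverlap x i j ⟶ Proj.basicOpen 𝒜 (x j : A) :=
  homOfLE inf_le_right

theorem projTransition_aux {i j : ι} (p : ProjectiveSpectrum 𝒜)
    (hi : (p : Proj 𝒜) ∈ Proj.basicOpen 𝒜 (x i : A))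
    (hj : (p : Proj 𝒜) ∈ Proj.basicOpen 𝒜 (x j : A)) :
    projEval p hi (projFrac x i 1 (x j)) * projEval p hj (projFrac x j 1 (x i)) = 1 := by
  rw [projEval_projFrac, projEval_projFrac, Localization.mk_mul, ← Localization.mk_one,
    Localization.mk_eq_mk_iff, Localization.r_iff_exists]
  exact ⟨1, by simp [mul_comm]⟩

/-- The unit `x_j / x_i` on the overlap `D₊(x_i) ∩ D₊(x_j)`. -/
def projTransition (i j : ι) : Γ(Proj 𝒜, projOverlap x i j)ˣ where
  val := (Proj 𝒜).presheaf.map (projOverlap.fst x i j).op (projFrac x i 1 (x j))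
  inv := (Proj 𝒜).presheaf.map (projOverlap.snd x i j).op (projFrac x j 1 (x i))
  val_inv := by
    refine projEval_ext fun p hp => ?_
    rw [map_mul, map_one, projEval_map, projEval_map]
    exact projTransition_aux x p hp.1 hp.2
  inv_val := by
    refine projEval_ext fun p hp => ?_
    rw [map_mul, map_one, projEval_map, projEval_map]
    exact projTransition_aux x p hp.2 hp.1

/-- `f / x_i ^ d = (x_j / x_i) ^ d * (f / x_j ^ d)` on the overlap. -/
theorem projFrac_overlap (i j : ι) (d : ℕ) (f : 𝒜 d) :
    (Proj 𝒜).presheaf.map (projOverlap.fst x i j).op (projFrac x i d f) =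
      ((projTransition x i j ^ d : Γ(Proj 𝒜, projOverlap x i j)ˣ) :
        Γ(Proj 𝒜, projOverlap x i j)) *
      (Proj 𝒜).presheaf.map (projOverlap.snd x i j).op (projFrac x j d f) := by
  refine projEval_ext fun p hp => ?_
  rw [Units.val_pow_eq_pow_val, map_mul, map_pow]
  change projEval p hp.1 (projFrac x i d f) =
    projEval p hp.1 (projFrac x i 1 (x j)) ^ d * projEval p hp.2 (projFrac x j d f)
  rw [projEval_projFrac, projEval_projFrac, projEval_projFrac, Localization.mk_pow,
    Localization.mk_mul, Localization.mk_eq_mk_iff, Localization.r_iff_exists]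
  exact ⟨1, by simp; ring⟩

variable (E : (Proj 𝒜).Modules)

/-- The group `H⁰(E(m))`, `m : ℤ`. The line bundle `𝒪(m)` has the frame `x_i ^ m` over `D₊(x_i)`,
so, when the `D₊(x_i)` cover `Proj 𝒜`, a global section of `E ⊗ 𝒪(m)` is a family of sections
`s_i` of `E` over `D₊(x_i)` such that `s_i ⊗ x_i ^ m = s_j ⊗ x_j ^ m`, that is,
`s_i = (x_j / x_i) ^ m • s_j`, on each overlap. -/
def twistedSections (m : ℤ) : AddSubgroup (∀ i, Γ(E, Proj.basicOpen 𝒜 (x i : A))) where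
  carrier := {s | ∀ i j, E.presheaf.map (projOverlap.fst x i j).op (s i) =
    ((projTransition x i j ^ m : Γ(Proj 𝒜, projOverlap x i j)ˣ) :
        Γ(Proj 𝒜, projOverlap x i j)) •
      E.presheaf.map (projOverlap.snd x i j).op (s j)}
  zero_mem' i j := by simp
  add_mem' {s t} hs ht i j := by
    rw [Pi.add_apply, Pi.add_apply, map_add, map_add, hs i j, ht i j, smul_add]
  neg_mem' {s} hs i j := by
    rw [Pi.neg_apply, Pi.neg_apply, map_neg, map_neg, hs i j, smul_neg]

/-- The product `A_d × H⁰(E(m)) → H⁰(E(m + d))`: in the frames `x_i ^ m`, multiplication by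
`f ∈ A_d` is multiplication by `f / x_i ^ d`. -/
def twistedSections.smul {d : ℕ} {m : ℤ} (f : 𝒜 d) (s : twistedSections x E m) :
    twistedSections x E (d + m) :=
  ⟨fun i => projFrac x i d f • s.1 i, fun i j => by
    rw [Scheme.Modules.map_smul, Scheme.Modules.map_smul, s.2 i j, projFrac_overlap, smul_smul,
      smul_smul, zpow_add, zpow_natCast, Units.val_mul]
    congr 1
    ring⟩

theorem twistedSections.sigma_ext {a b : GradedMonoid fun m => twistedSections x E m}
    (h : a.1 = b.1) (h' : a.2.1 = b.2.1) : a = b :=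
  Sigma.subtype_ext h h'

/-- The natural numbers act on the integers by translation. -/
@[reducible] def natTranslation : AddAction ℕ ℤ where
  vadd d m := d + m
  zero_vadd m := by change ((0 : ℕ) : ℤ) + m = m; simp
  add_vadd d e m := by change ((d + e : ℕ) : ℤ) + m = d + (e + m); push_cast; ring

attribute [local instance] natTranslation

instance twistedSections.gmodule :
    DirectSum.Gmodule (fun d => 𝒜 d) (fun m => twistedSections x E m) where
  smul f s := twistedSections.smul x E f s
  one_smul s := twistedSections.sigma_ext x E (zero_vadd ℕ s.1) (funext fun i => by
    change projFrac x i 0 ⟨1, _⟩ • s.2.1 i = _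
    rw [projFrac_one, one_smul])
  mul_smul f g s := twistedSections.sigma_ext x E (add_vadd f.1 g.1 s.1) (funext fun i => by
    change projFrac x i (f.1 + g.1) ⟨f.2 * g.2, _⟩ • s.2.1 i =
      projFrac x i f.1 f.2 • projFrac x i g.1 g.2 • s.2.1 i
    rw [projFrac_mul, mul_smul])
  smul_add f s t := Subtype.ext (funext fun i => smul_add (projFrac x i _ f) (s.1 i) (t.1 i))
  smul_zero f := Subtype.ext (funext fun i => smul_zero (projFrac x i _ f))
  add_smul f g s := Subtype.ext (funext fun i => by
    change projFrac x i _ (f + g) • s.1 i = projFrac x i _ f • s.1 i + projFrac x i _ g • s.1 i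
    rw [projFrac_add, add_smul])
  zero_smul s := Subtype.ext (funext fun i => by
    change projFrac x i _ 0 • s.1 i = 0
    rw [projFrac_zero, zero_smul])

/-- The graded module of twisted global sections `H⁰_*(E) = ⨁ m : ℤ, H⁰(E(m))`. -/
def TwistedGlobalSections : Type u := DirectSum ℤ fun m => twistedSections x E m

namespace TwistedGlobalSections

instance : AddCommGroup (TwistedGlobalSections x E) :=
  inferInstanceAs (AddCommGroup (DirectSum ℤ fun m => twistedSections x E m))

/-- The module structure of `H⁰_*(E)` over the graded ring `A`. -/
instance : Module A (TwistedGlobalSections x E) :=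
  letI : Module (DirectSum ℕ fun d => 𝒜 d) (TwistedGlobalSections x E) :=
    DirectSum.Gmodule.module (fun d => 𝒜 d) fun m => twistedSections x E m
  Module.compHom _ (DirectSum.decomposeRingEquiv 𝒜).toRingHom

/-- The inclusion of the homogeneous component `H⁰(E(m))` in `H⁰_*(E)`. -/
def ofDegree (m : ℤ) : twistedSections x E m →+ TwistedGlobalSections x E :=
  DirectSum.of (fun m => twistedSections x E m) m

theorem smul_ofDegree {d : ℕ} {m : ℤ} (f : 𝒜 d) (s : twistedSections x E m) :
    (f : A) • ofDegree x E m s = ofDegree x E (d + m) (twistedSections.smul x E f s) := by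
  change DirectSum.Gmodule.smulAddMonoidHom (fun d => 𝒜 d) (fun m => twistedSections x E m)
    (DirectSum.decompose 𝒜 (f : A)) (DirectSum.of (fun m => twistedSections x E m) m s) = _
  rw [DirectSum.decompose_coe, DirectSum.Gmodule.smulAddMonoidHom_apply_of_of]
  rfl

end TwistedGlobalSections

end TwistedSections

/-! ## Vector bundles -/

/-- A sheaf of modules `E` on a scheme `X` is a vector bundle of rank `r` if every point has an
open neighbourhood `U` with `E|_U ≅ 𝒪_U ^ r`: there are `r` sections of `E` over `U` whose
restrictions to each open `V ⊆ U` form a basis of `E(V)` over `𝒪(V)`. -/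
def IsVectorBundleOfRank {X : Scheme.{u}} (E : X.Modules) (r : ℕ) : Prop :=
  ∀ p : X, ∃ U : X.Opens, p ∈ U ∧ ∃ e : Fin r → Γ(E, U),
    ∀ (V : X.Opens) (h : V ≤ U) (t : Γ(E, V)),
      ∃! c : Fin r → Γ(X, V), t = ∑ j, c j • E.presheaf.map (homOfLE h).op (e j)

/-! ## Maximal Cohen-Macaulay modules and linear resolutions -/

/-- A finitely generated module `M` over a graded ring `A`, with irrelevant ideal `A₊`, is
maximal Cohen-Macaulay if `depth (A₊, M) = dim A`: there is an `M`-regular sequence in `A₊` of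
length `dim A`. -/
def IsMaximalCohenMacaulay {k A : Type u} [Field k] [CommRing A] [Algebra k A]
    (𝒜 : ℕ → Submodule k A) [GradedAlgebra 𝒜] (M : Type u) [AddCommGroup M] [Module A M] : Prop :=
  Module.Finite A M ∧ ∃ rs : List A, (∀ a ∈ rs, a ∈ HomogeneousIdeal.irrelevant 𝒜) ∧
    RingTheory.Sequence.IsRegular M rs ∧ (rs.length : WithBot ℕ∞) = ringKrullDim A

/-- A graded module `M` over the polynomial ring `P = k[σ]`, with degree zero component `M₀`, is
generated in degree zero and has a linear free resolution
`⋯ ⟶ P(-2) ^ b₂ ⟶ P(-1) ^ b₁ ⟶ P ^ b₀ ⟶ M ⟶ 0`. The differentials are given by matrices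
of linear forms. -/
def HasLinearFreeResolution {k : Type u} [Field k] {σ : Type} (M : Type u) [AddCommGroup M]
    [Module (MvPolynomial σ k) M] (M₀ : AddSubgroup M) : Prop :=
  ∃ (b : ℕ → ℕ) (e : Fin (b 0) → M)
    (φ : ∀ i, Matrix (Fin (b i)) (Fin (b (i + 1))) (MvPolynomial σ k)),
    (∀ j, e j ∈ M₀) ∧ (∀ i r c, (φ i r c).IsHomogeneous 1) ∧
    Function.Surjective (Fintype.linearCombination (MvPolynomial σ k) e) ∧
    Function.Exact (φ 0).mulVecLin (Fintype.linearCombination (MvPolynomial σ k) e) ∧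
    ∀ i, Function.Exact (φ (i + 1)).mulVecLin (φ i).mulVecLin

/-! ## Closed subschemes of projective space and Ulrich sheaves -/

section ProjectiveScheme

attribute [local instance] MvPolynomial.gradedAlgebra

variable {k : Type u} [Field k] {N : ℕ}
  (I : HomogeneousIdeal (MvPolynomial.homogeneousSubmodule (Fin (N + 1)) k))

/-- The closed subscheme of `ℙ^N` over `k` defined by a homogeneous ideal `I` of
`k[x_0, …, x_N]`, as `Proj` of the homogeneous coordinate ring `k[x_0, …, x_N] / I`. -/
abbrev ProjectiveSubscheme : Scheme.{u} := Proj (quotientGrading I)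

/-- The structure morphism to `Spec k`. -/
def ProjectiveSubscheme.toSpec : ProjectiveSubscheme I ⟶ Spec (CommRingCat.of k) :=
  Proj.toSpecZero (quotientGrading I) ≫
    Spec.map (CommRingCat.ofHom (algebraMap k (quotientGrading I 0)))

/-- The homogeneous coordinates. -/
def ProjectiveSubscheme.coord (i : Fin (N + 1)) : quotientGrading I 1 :=
  ⟨Ideal.Quotient.mk I.toIdeal (MvPolynomial.X i), MvPolynomial.X i,
    MvPolynomial.isHomogeneous_X k i, rfl⟩

variable {I}

/-- The module `H⁰_*(E)` over the homogeneous coordinate ring. -/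
abbrev ProjectiveSubscheme.HStar (E : (ProjectiveSubscheme I).Modules) : Type u :=
  TwistedGlobalSections (ProjectiveSubscheme.coord I) E

/-- `H⁰_*(E)` as a module over the coordinate ring of the projective space. -/
instance (E : (ProjectiveSubscheme I).Modules) :
    Module (MvPolynomial (Fin (N + 1)) k) (ProjectiveSubscheme.HStar E) :=
  Module.compHom _ (Ideal.Quotient.mk I.toIdeal)

/-- A sheaf `E` on `X ⊆ ℙ^N` is an Ulrich sheaf if `H⁰_*(E)` is a maximal Cohen-Macaulay module
over the homogeneous coordinate ring of `X`, is generated in degree zero, and has a linear free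
resolution over the homogeneous coordinate ring of `ℙ^N`. -/
structure IsUlrich (E : (ProjectiveSubscheme I).Modules) : Prop where
  isMaximalCohenMacaulay :
    IsMaximalCohenMacaulay (quotientGrading I) (ProjectiveSubscheme.HStar E)
  hasLinearFreeResolution :
    HasLinearFreeResolution (σ := Fin (N + 1)) (k := k) (ProjectiveSubscheme.HStar E)
      (TwistedGlobalSections.ofDegree (ProjectiveSubscheme.coord I) E 0).range

end ProjectiveScheme

/-! ## Complete intersections of two quadrics -/

section TwoQuadrics

attribute [local instance] MvPolynomial.gradedAlgebra

variable {k : Type u} [Field k] {N : ℕ}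

/-- The homogeneous ideal generated by two quadratic forms. -/
def twoQuadricsIdeal (q₁ q₂ : MvPolynomial (Fin (N + 1)) k) (h₁ : q₁.IsHomogeneous 2)
    (h₂ : q₂.IsHomogeneous 2) :
    HomogeneousIdeal (MvPolynomial.homogeneousSubmodule (Fin (N + 1)) k) where
  toSubmodule := Ideal.span {q₁, q₂}
  is_homogeneous' := Ideal.homogeneous_span _ _ (by
    rintro q (rfl | rfl)
    exacts [⟨2, h₁⟩, ⟨2, h₂⟩])

/-- The quadratic forms `q₁, q₂` define a smooth complete intersection `X` in `ℙ^N`: they form a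
regular sequence, and `X` is smooth over `k`. As a complete intersection of two hypersurfaces has
pure dimension `N - 2`, this is the relative dimension. -/
structure IsSmoothCompleteIntersection (q₁ q₂ : MvPolynomial (Fin (N + 1)) k)
    (h₁ : q₁.IsHomogeneous 2) (h₂ : q₂.IsHomogeneous 2) : Prop where
  isRegular : RingTheory.Sequence.IsRegular (MvPolynomial (Fin (N + 1)) k) [q₁, q₂]
  smooth : SmoothOfRelativeDimension (N - 2)
    (ProjectiveSubscheme.toSpec (twoQuadricsIdeal q₁ q₂ h₁ h₂))

end TwoQuadrics

end

/-!
The bundle is a bundle of spinors. By the Jacobian criterion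
(`IsSmoothCompleteIntersection.pencilIsSmooth`) the pencil of quadrics through a smooth `X` has a
nondegenerate member, and diagonalizing the pencil brings the equations into the form
`f = ∑ z_i²`, `g = ∑ a_i z_i²`, for linear coordinates `z_i` and distinct scalars `a_i`
(`IsSmoothCompleteIntersection.exists_diagonalForm`).

Let `V` be the standard quadratic space of dimension `2n + 2`. There are two vectors `Φ, Ψ` of
linear forms, with values in `V`, such that `Φ ⬝ Φ = f`, `Ψ ⬝ Ψ = g`, `Φ ⬝ Ψ = 0`. To find them,
split the `2n + 1` coordinates as `(x, y)` with `n + 1` and `n` entries, and put `Φ = (x, (0, y))`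
and `Ψ = (L (0, y), -Lᵀ x)`. These are orthogonal, and `Ψ ⬝ Ψ = g` requires that `L Lᵀ` is the
diagonal matrix of the first `n + 1` scalars and that `Lᵀ L`, without its first row and column, is
the diagonal matrix of the other `n`. Such an `L` comes from a Cauchy matrix, as for the interlacing
eigenvalues of a matrix and a principal minor (`exists_orthogonal_compression`,
`exists_gram_eq_diagonal`).

The half spinors of `V` have dimension `2 ^ n`, and the Clifford multiplications by `Φ` and `Ψ`
between the two kinds of half spinors are matrices `A, B` and `C, D` of linear forms with
`A C = f`, `B D = g`, `A D + B C = 0`. As `f` and `g` are coprime, the complex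
`P(-2)^(2^n) ⟶ P(-1)^(2^(n+1)) ⟶ P^(2^n)` given by `(D, C)` and `(A, B)` is exact
(`IsAnticommutingFactorization.exact`), so that it is a linear resolution of its cokernel. It
remains exact modulo all but two of the coordinates `z_i`, where `f` and `g` are still coprime, so
these coordinates form a regular sequence on the cokernel, which is therefore maximal Cohen-Macaulay
(`IsAnticommutingFactorization.isRegular`). Over `P / (f, g)` the matrix `B C` identifies the
cokernel with the kernel of `(C, D)` (`IsAnticommutingFactorization.exists_cokernel_map`).

The sheaf is the kernel of `(C, D)` on `𝒪_X(2) ^ (2 ^ n)`, and, since the coordinate ring has depth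
at least two, its twisted global sections are the kernel of `(C, D)` on the free module over the
coordinate ring (`KernelSectionsHypothesis.linearEquiv`). At each point of `X` the vectors `Φ` and
`Ψ` span an isotropic plane, because the `a_i` are distinct (`eq_zero_of_spinorVector_minors`), and
the spinors killed by an isotropic plane form a quarter of the half spinors
(`rank_pureSpinorProjector`). Locally there is a projection onto them, a product of Clifford
matrices, so that the sheaf is a vector bundle of rank `2 ^ (n - 2)`
(`kernelSheaf.isVectorBundleOfRank`).
-/

noncomputable section

/-! ### Sections of twists of the structure sheaf on `Proj` -/

section TwistedFractions

variable {k A : Type u} [Field k] [CommRing A] [Algebra k A]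
  {𝒜 : ℕ → Submodule k A} [GradedAlgebra 𝒜]

/-- The homogeneous prime ideal of `A` that is the point `p` of `Proj 𝒜`. -/
def projPrime (p : Proj 𝒜) : Ideal A :=
  ProjectiveSpectrum.asHomogeneousIdeal (𝒜 := 𝒜) p |>.toIdeal

instance (p : Proj 𝒜) : (projPrime p).IsPrime := ProjectiveSpectrum.isPrime (𝒜 := 𝒜) p

/-- The localization of `A` at the homogeneous prime `p`, with fractions of all degrees. -/
abbrev ProjLocalization (p : Proj 𝒜) : Type u := Localization (projPrime p).primeCompl

/-- The value of a section of the structure sheaf at a point. -/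
def projValue {U : (Proj 𝒜).Opens} (p : U) : Γ(Proj 𝒜, U) →+* ProjLocalization p.1 :=
  projEval (𝒜 := 𝒜) p.1 p.2

theorem mem_projBasicOpen {p : Proj 𝒜} {s : A} : p ∈ Proj.basicOpen 𝒜 s ↔ s ∉ projPrime p := Iff.rfl

/-- The function `f` on `U` with values in the localizations of `A` is locally a fraction `a / s`
of homogeneous elements with `deg a = deg s + m`. These functions are the sections of the sheaf
`𝒪(m)` over `U`. -/
def IsTwistedFraction (m : ℤ) {U : (Proj 𝒜).Opens} (f : ∀ p : U, ProjLocalization p.1) : Prop :=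
  ∀ p : U, ∃ (V : (Proj 𝒜).Opens) (_ : p.1 ∈ V) (i : V ≤ U) (a s : A) (d e : ℕ),
    a ∈ 𝒜 d ∧ s ∈ 𝒜 e ∧ (d : ℤ) = e + m ∧
      ∀ (q : Proj 𝒜) (hq : q ∈ V), s ∉ projPrime q ∧
        f ⟨q, i hq⟩ * algebraMap A (ProjLocalization q) s = algebraMap A (ProjLocalization q) a

theorem isUnit_algebraMap_projLocalization {p : Proj 𝒜} {s : A}
    (hs : s ∉ projPrime p) :
    IsUnit (algebraMap A (ProjLocalization p) s) :=
  IsLocalization.map_units (M := (projPrime p).primeCompl)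
    _ ⟨s, hs⟩

theorem notMem_mul {p : Proj 𝒜} {s t : A}
    (hs : s ∉ projPrime p)
    (ht : t ∉ projPrime p) :
    s * t ∉ projPrime p :=
  (projPrime p).primeCompl.mul_mem hs ht

namespace IsTwistedFraction

variable {m m' : ℤ} {U V : (Proj 𝒜).Opens}

theorem res (i : V ≤ U) {f : ∀ p : U, ProjLocalization p.1} (hf : IsTwistedFraction m f) :
    IsTwistedFraction m fun p : V => f ⟨p.1, i p.2⟩ := by
  intro p
  obtain ⟨W, hp, j, a, s, d, e, ha, hs, hde, h⟩ := hf ⟨p.1, i p.2⟩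
  exact ⟨V ⊓ W, ⟨p.2, hp⟩, inf_le_left, a, s, d, e, ha, hs, hde, fun q hq => h q hq.2⟩

theorem locality {f : ∀ p : U, ProjLocalization p.1}
    (hf : ∀ p : U, ∃ (V : (Proj 𝒜).Opens) (_ : p.1 ∈ V) (i : V ≤ U),
      IsTwistedFraction m fun q : V => f ⟨q.1, i q.2⟩) : IsTwistedFraction m f := by
  intro p
  obtain ⟨V, hp, i, h⟩ := hf p
  obtain ⟨W, hp, j, h⟩ := h ⟨p.1, hp⟩
  exact ⟨W, hp, j.trans i, h⟩

theorem of_fraction {f : ∀ p : U, ProjLocalization p.1} {a s : A} {d e : ℕ} (ha : a ∈ 𝒜 d)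
    (hs : s ∈ 𝒜 e) (hde : (d : ℤ) = e + m)
    (hf : ∀ q : U, s ∉ projPrime q.1 ∧
        f q * algebraMap A _ s = algebraMap A _ a) : IsTwistedFraction m f :=
  fun p => ⟨U, p.2, le_rfl, a, s, d, e, ha, hs, hde, fun q hq => hf ⟨q, hq⟩⟩

theorem of_mem {a : A} {d : ℕ} (ha : a ∈ 𝒜 d) :
    IsTwistedFraction (U := U) d fun _ => algebraMap A _ a :=
  of_fraction ha (SetLike.GradedOne.one_mem (A := 𝒜)) (by simp) fun q =>
    ⟨fun h => Ideal.IsPrime.one_notMem inferInstance h, by simp⟩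

theorem zero (m : ℤ) : IsTwistedFraction (U := U) (𝒜 := 𝒜) m fun _ => 0 := by
  intro p
  obtain ⟨s, e, hs, hp⟩ : ∃ (s : A) (e : ℕ), s ∈ 𝒜 e ∧ (0 : ℤ) ≤ e + m ∧
      s ∉ projPrime p.1 := by
    have hp : ¬ (HomogeneousIdeal.irrelevant 𝒜).toIdeal ≤ projPrime p.1 :=
      ProjectiveSpectrum.not_irrelevant_le (𝒜 := 𝒜) p.1
    obtain ⟨x, d, hd, hx, hxp⟩ : ∃ (x : A) (d : ℕ), 0 < d ∧ x ∈ 𝒜 d ∧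
        x ∉ projPrime p.1 := by
      by_contra! h
      classical
      refine hp fun x hx => ?_
      replace hx : x ∈ HomogeneousIdeal.irrelevant 𝒜 := hx
      rw [HomogeneousIdeal.mem_irrelevant_iff, GradedRing.proj_apply] at hx
      rw [← DirectSum.sum_support_decompose 𝒜 x]
      refine Submodule.sum_mem _ fun i _ => ?_
      rcases Nat.eq_zero_or_pos i with rfl | hi
      · rw [hx]; exact Submodule.zero_mem _
      · exact h _ i hi (SetLike.coe_mem _)
    refine ⟨x ^ m.natAbs, m.natAbs • d, SetLike.pow_mem_graded _ hx, ?_, fun h => hxp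
      (Ideal.IsPrime.mem_of_pow_mem inferInstance _ h)⟩
    have : m.natAbs ≤ m.natAbs • d := by
      rw [smul_eq_mul]; exact Nat.le_mul_of_pos_right _ hd
    omega
  refine ⟨U ⊓ Proj.basicOpen 𝒜 s, ⟨p.2, hp.2⟩, inf_le_left, 0, s, (e + m).toNat, e,
    Submodule.zero_mem _, hs, by omega, fun q hq => ⟨hq.2, by simp⟩⟩

theorem mul {f g : ∀ p : U, ProjLocalization p.1} (hf : IsTwistedFraction m f)
    (hg : IsTwistedFraction m' g) : IsTwistedFraction (m + m') fun p => f p * g p := by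
  intro p
  obtain ⟨V, hV, i, a, s, d, e, ha, hs, hde, h⟩ := hf p
  obtain ⟨V', hV', i', a', s', d', e', ha', hs', hde', h'⟩ := hg p
  refine ⟨V ⊓ V', ⟨hV, hV'⟩, inf_le_left.trans i, a * a', s * s', d + d', e + e',
    SetLike.mul_mem_graded ha ha', SetLike.mul_mem_graded hs hs',
    by push_cast; omega, fun q hq => ?_⟩
  obtain ⟨h1, h2⟩ := h q hq.1
  obtain ⟨h3, h4⟩ := h' q hq.2
  refine ⟨notMem_mul h1 h3, ?_⟩
  rw [map_mul, map_mul, ← h2, ← h4]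
  exact mul_mul_mul_comm _ _ _ _

theorem add {f g : ∀ p : U, ProjLocalization p.1} (hf : IsTwistedFraction m f)
    (hg : IsTwistedFraction m g) : IsTwistedFraction m fun p => f p + g p := by
  intro p
  obtain ⟨V, hV, i, a, s, d, e, ha, hs, hde, h⟩ := hf p
  obtain ⟨V', hV', i', a', s', d', e', ha', hs', hde', h'⟩ := hg p
  refine ⟨V ⊓ V', ⟨hV, hV'⟩, inf_le_left.trans i, a * s' + s * a', s * s', d + e', e + e',
    add_mem (SetLike.mul_mem_graded ha hs') ?_, SetLike.mul_mem_graded hs hs',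
    by push_cast; omega, fun q hq => ?_⟩
  · rw [show d + e' = e + d' by omega]
    exact SetLike.mul_mem_graded hs ha'
  obtain ⟨h1, h2⟩ := h q hq.1
  obtain ⟨h3, h4⟩ := h' q hq.2
  refine ⟨notMem_mul h1 h3, ?_⟩
  rw [map_mul, map_add, map_mul, map_mul, ← h2, ← h4]
  ring

theorem neg {f : ∀ p : U, ProjLocalization p.1} (hf : IsTwistedFraction m f) :
    IsTwistedFraction m fun p => - f p := by
  intro p
  obtain ⟨V, hV, i, a, s, d, e, ha, hs, hde, h⟩ := hf p
  refine ⟨V, hV, i, -a, s, d, e, neg_mem ha, hs, hde, fun q hq => ⟨(h q hq).1, ?_⟩⟩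
  rw [map_neg, ← (h q hq).2, neg_mul]

theorem sum {ι : Type*} (s : Finset ι) {f : ι → ∀ p : U, ProjLocalization p.1}
    (hf : ∀ j ∈ s, IsTwistedFraction m (f j)) : IsTwistedFraction m fun p => ∑ j ∈ s, f j p := by
  classical
  induction s using Finset.induction_on with
  | empty => simpa using zero m
  | insert j s hj ih =>
    simp_rw [Finset.sum_insert hj]
    exact (hf j (by simp)).add (ih fun l hl => hf l (by simp [hl]))

/-- Sections of the structure sheaf are locally fractions of degree zero. -/
theorem of_section (c : Γ(Proj 𝒜, U)) :
    IsTwistedFraction (U := U) 0 fun p => projValue p c := by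
  intro p
  obtain ⟨V, hV, i, d, a, s, h, hc⟩ := c.2 p
  refine ⟨V, hV, i.le, a, s, d, d, a.2, s.2, by simp, fun q hq => ⟨h ⟨q, hq⟩, ?_⟩⟩
  have hv : projValue ⟨q, i.le hq⟩ c =
      Localization.mk (a : A) (⟨s, h ⟨q, hq⟩⟩ : (projPrime q).primeCompl) :=
    (congrArg HomogeneousLocalization.val (hc ⟨q, hq⟩)).trans (HomogeneousLocalization.val_mk _)
  change projValue ⟨q, i.le hq⟩ c * _ = _
  rw [hv, Localization.mk_eq_mk']
  exact IsLocalization.mk'_spec _ _ _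

/-- Functions that are locally fractions of degree zero are sections of the structure sheaf. -/
theorem exists_section {f : ∀ p : U, ProjLocalization p.1} (hf : IsTwistedFraction 0 f) :
    ∃ c : Γ(Proj 𝒜, U), ∀ p : U, projValue p c = f p := by
  have key : ∀ p : U, ∃ c : HomogeneousLocalization.AtPrime 𝒜 (projPrime p.1), c.val = f p := by
    intro p
    obtain ⟨V, hV, i, a, s, d, e, ha, hs, hde, h⟩ := hf p
    obtain rfl : d = e := by omega
    refine ⟨.mk ⟨d, ⟨a, ha⟩, ⟨s, hs⟩, (h p.1 hV).1⟩, ?_⟩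
    rw [HomogeneousLocalization.val_mk, Localization.mk_eq_mk', IsLocalization.mk'_eq_iff_eq_mul]
    exact (h p.1 hV).2.symm
  choose c hc using key
  refine ⟨⟨c, fun p => ?_⟩, hc⟩
  obtain ⟨V, hV, i, a, s, d, e, ha, hs, hde, h⟩ := hf p
  obtain rfl : d = e := by omega
  have hv : ∀ (q : Proj 𝒜) (hq : q ∈ V),
      f ⟨q, i hq⟩ = Localization.mk a (⟨s, (h q hq).1⟩ : (projPrime q).primeCompl) := by
    intro q hq
    rw [Localization.mk_eq_mk', eq_comm, IsLocalization.mk'_eq_iff_eq_mul]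
    exact (h q hq).2.symm
  have hc' : ∀ (q : Proj 𝒜) (hq : q ∈ V), c ⟨q, i hq⟩ =
      .mk ⟨d, ⟨a, ha⟩, ⟨s, hs⟩, (h q hq).1⟩ := fun q hq =>
    HomogeneousLocalization.val_injective _ <| (hc ⟨q, i hq⟩).trans <| (hv q hq).trans
      (by rw [HomogeneousLocalization.val_mk])
  exact ⟨V, hV, homOfLE i, d, ⟨a, ha⟩, ⟨s, hs⟩, fun q => (h q.1 q.2).1, fun q => hc' q.1 q.2⟩

end IsTwistedFraction

end TwistedFractions

/-! ### The kernel of a matrix of linear forms -/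

section KernelSheaf

open TopologicalSpace Opposite Matrix

variable {k A : Type u} [Field k] [CommRing A] [Algebra k A]
  {𝒜 : ℕ → Submodule k A} [GradedAlgebra 𝒜] {ι κ : Type} [Fintype ι]

/-- The local predicate that cuts out the sections of the kernel of the matrix `Θ` acting on
`𝒪(m) ^ ι`. -/
def kernelPredicate (𝒜 : ℕ → Submodule k A) [GradedAlgebra 𝒜] (Θ : Matrix κ ι A) (m : ℤ) :
    TopCat.LocalPredicate fun p : Proj 𝒜 => ι → ProjLocalization p where
  pred {U} f := (∀ j, IsTwistedFraction m fun p : U => f p j) ∧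
    ∀ p : U, Θ.map (algebraMap A (ProjLocalization p.1)) *ᵥ f p = 0
  res i f hf := ⟨fun j => (hf.1 j).res i.le, fun p => hf.2 (i p)⟩
  locality {U} f hf := by
    refine ⟨fun j => IsTwistedFraction.locality fun p => ?_, fun p => ?_⟩
    · obtain ⟨V, hV, i, h⟩ := hf p
      exact ⟨V, hV, i.le, h.1 j⟩
    · obtain ⟨V, hV, i, h⟩ := hf p
      exact h.2 ⟨p.1, hV⟩

/-- The sections over `U` of the kernel of the matrix `Θ` acting on `𝒪(m) ^ ι`. -/
def kernelSections (𝒜 : ℕ → Submodule k A) [GradedAlgebra 𝒜] (Θ : Matrix κ ι A) (m : ℤ)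
    (U : (Proj 𝒜).Opens) : AddSubgroup (∀ p : U, ι → ProjLocalization p.1) where
  carrier := {f | (kernelPredicate 𝒜 Θ m).pred f}
  zero_mem' := ⟨fun _ => IsTwistedFraction.zero m, fun _ => Matrix.mulVec_zero _⟩
  add_mem' {f g} hf hg := ⟨fun j => (hf.1 j).add (hg.1 j), fun p => by
    rw [Pi.add_apply, Matrix.mulVec_add, hf.2, hg.2, add_zero]⟩
  neg_mem' {f} hf := ⟨fun j => (hf.1 j).neg, fun p => by
    rw [Pi.neg_apply, Matrix.mulVec_neg, hf.2, neg_zero]⟩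

instance kernelSections.module (Θ : Matrix κ ι A) (m : ℤ) (U : (Proj 𝒜).Opens) :
    Module Γ(Proj 𝒜, U) (kernelSections 𝒜 Θ m U) where
  smul c f := ⟨fun p j => projValue p c * f.1 p j, fun j => by
      simpa using (IsTwistedFraction.of_section c).mul (f.2.1 j), fun p => by
      change _ *ᵥ (projValue p c • f.1 p) = 0
      rw [Matrix.mulVec_smul, f.2.2, smul_zero]⟩
  one_smul f := Subtype.ext <| funext fun p => funext fun j => by
    change projValue p 1 * f.1 p j = _
    rw [map_one, one_mul]
  mul_smul c c' f := Subtype.ext <| funext fun p => funext fun j => by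
    change projValue p (c * c') * f.1 p j = _ * (_ * _)
    rw [map_mul, mul_assoc]
  smul_zero c := Subtype.ext <| funext fun p => funext fun j => mul_zero _
  smul_add c f g := Subtype.ext <| funext fun p => funext fun j => mul_add _ _ _
  add_smul c c' f := Subtype.ext <| funext fun p => funext fun j => by
    change projValue p (c + c') * f.1 p j = _ * _ + _ * _
    rw [map_add, add_mul]
  zero_smul f := Subtype.ext <| funext fun p => funext fun j => by
    change projValue p 0 * f.1 p j = 0
    rw [map_zero, zero_mul]

/-- The presheaf of abelian groups of sections of the kernel of `Θ`. -/
def kernelPresheaf (𝒜 : ℕ → Submodule k A) [GradedAlgebra 𝒜] (Θ : Matrix κ ι A) (m : ℤ) :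
    (Opens (Proj 𝒜))ᵒᵖ ⥤ Ab.{u} where
  obj U := AddCommGrpCat.of (kernelSections 𝒜 Θ m U.unop)
  map i := AddCommGrpCat.ofHom
    { toFun := fun f => ⟨fun p => f.1 (i.unop p), (kernelPredicate 𝒜 Θ m).res i.unop f.1 f.2⟩
      map_zero' := rfl
      map_add' := fun _ _ => rfl }

/-- The kernel of the matrix `Θ` acting on `𝒪(m) ^ ι`, as a presheaf of modules. -/
def kernelPresheafOfModules (𝒜 : ℕ → Submodule k A) [GradedAlgebra 𝒜] (Θ : Matrix κ ι A) (m : ℤ) :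
    (Proj 𝒜).PresheafOfModules :=
  letI (U : (Opens (Proj 𝒜))ᵒᵖ) :
      Module ((Proj 𝒜).ringCatSheaf.obj.obj U) ((kernelPresheaf 𝒜 Θ m).obj U) :=
    kernelSections.module Θ m U.unop
  .ofPresheaf (kernelPresheaf 𝒜 Θ m) fun _ _ _ _ _ => rfl

/-- The kernel of the matrix `Θ` acting on `𝒪(m) ^ ι`, as a sheaf of modules on `Proj 𝒜`. -/
def kernelSheaf (𝒜 : ℕ → Submodule k A) [GradedAlgebra 𝒜] (Θ : Matrix κ ι A) (m : ℤ) :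
    (Proj 𝒜).Modules where
  val := kernelPresheafOfModules 𝒜 Θ m
  isSheaf := (TopCat.Presheaf.isSheaf_iff_isSheaf_comp (forget AddCommGrpCat) _).2
    (TopCat.subsheafToTypes (kernelPredicate 𝒜 Θ m)).2

/-- A section of the kernel sheaf, as a function. -/
def kernelSheaf.eval {Θ : Matrix κ ι A} {m : ℤ} {U : (Proj 𝒜).Opens} :
    Γ(kernelSheaf 𝒜 Θ m, U) →+ ∀ p : U, ι → ProjLocalization p.1 :=
  (kernelSections 𝒜 Θ m U).subtype

namespace kernelSheaf

variable {Θ : Matrix κ ι A} {m : ℤ} {U : (Proj 𝒜).Opens}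

theorem eval_injective : Function.Injective (eval (𝒜 := 𝒜) (Θ := Θ) (m := m) (U := U)) :=
  Subtype.val_injective

theorem isTwistedFraction_eval (s : Γ(kernelSheaf 𝒜 Θ m, U)) (j : ι) :
    IsTwistedFraction m fun p => eval s p j := s.2.1 j

theorem mulVec_eval (s : Γ(kernelSheaf 𝒜 Θ m, U)) (p : U) :
    Θ.map (algebraMap A (ProjLocalization p.1)) *ᵥ eval s p = 0 := s.2.2 p

theorem exists_eval_eq {f : ∀ p : U, ι → ProjLocalization p.1}
    (h : ∀ j, IsTwistedFraction m fun p => f p j)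
    (h' : ∀ p : U, Θ.map (algebraMap A (ProjLocalization p.1)) *ᵥ f p = 0) :
    ∃ s : Γ(kernelSheaf 𝒜 Θ m, U), eval s = f := ⟨⟨f, h, h'⟩, rfl⟩

theorem eval_smul (c : Γ(Proj 𝒜, U)) (s : Γ(kernelSheaf 𝒜 Θ m, U)) (p : U) :
    eval (c • s) p = projValue p c • eval s p := rfl

end kernelSheaf

end KernelSheaf

/-! ### Global sections of twists -/

section GlobalSections

variable {k A : Type u} [Field k] [CommRing A] [Algebra k A]
  {𝒜 : ℕ → Submodule k A} [GradedAlgebra 𝒜]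

/-- A homogeneous element that vanishes in all localizations at points of `D₊(θ)` is killed by a
power of `θ`: the radical of its annihilator is an intersection of homogeneous primes. -/
theorem exists_pow_mul_eq_zero {θ w : A} {d : ℕ} (hθ : θ ∈ HomogeneousIdeal.irrelevant 𝒜)
    (hw : w ∈ 𝒜 d)
    (h : ∀ p : Proj 𝒜, θ ∉ projPrime p → algebraMap A (ProjLocalization p) w = 0) :
    ∃ n : ℕ, θ ^ n * w = 0 := by
  let I : Ideal A := LinearMap.ker (LinearMap.toSpanSingleton A A w)
  have hI : ∀ {x}, x ∈ I ↔ x * w = 0 := Iff.rfl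
  have hhom : I.IsHomogeneous 𝒜 := by
    intro i x hx
    rw [hI] at hx ⊢
    rw [← DirectSum.coe_decompose_mul_add_of_right_mem 𝒜 hw, hx]
    simp
  have : θ ∈ I.radical := by
    rw [hhom.radical_eq]
    refine Submodule.mem_sInf.mpr ?_
    rintro J ⟨hJ, hIJ, hJp⟩
    by_contra hθJ
    let p : Proj 𝒜 := (⟨⟨J, hJ⟩, hJp, fun hle => hθJ (hle hθ)⟩ : ProjectiveSpectrum 𝒜)
    have := h p hθJ
    rw [IsLocalization.map_eq_zero_iff (projPrime p).primeCompl] at this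
    obtain ⟨s, hs⟩ := this
    exact s.2 (hIJ (hI.mpr hs))
  exact this

/-- An element outside of the prime `p`, as a unit of the localization at `p`. -/
def projUnit {p : Proj 𝒜} {s : A} (hs : p ∈ Proj.basicOpen 𝒜 s) : (ProjLocalization p)ˣ :=
  (isUnit_algebraMap_projLocalization (mem_projBasicOpen.mp hs)).unit

@[simp]
theorem coe_projUnit {p : Proj 𝒜} {s : A} (hs : p ∈ Proj.basicOpen 𝒜 s) :
    (projUnit hs : ProjLocalization p) = algebraMap A _ s := rfl

/-- A homogeneous element of degree one to the power `m`, for an integer `m`, as a function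
on `D₊(θ)`. -/
theorem IsTwistedFraction.zpow {θ : A} (hθ : θ ∈ 𝒜 1) {U : (Proj 𝒜).Opens}
    (hU : ∀ p : U, p.1 ∈ Proj.basicOpen 𝒜 θ) (m : ℤ) :
    IsTwistedFraction (U := U) m fun p =>
      ((projUnit (hU p) ^ m : (ProjLocalization p.1)ˣ) :
        ProjLocalization p.1) := by
  have hn : ∀ n : ℕ, θ ^ n ∈ 𝒜 n := fun n => by
    simpa using SetLike.pow_mem_graded n hθ
  obtain ⟨n, rfl | rfl⟩ := m.eq_nat_or_neg
  · simp only [zpow_natCast, Units.val_pow_eq_pow_val, coe_projUnit, ← map_pow]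
    exact IsTwistedFraction.of_mem (hn n)
  · refine IsTwistedFraction.of_fraction (SetLike.GradedOne.one_mem (A := 𝒜)) (hn n) (by simp)
      fun q => ⟨fun h => mem_projBasicOpen.mp (hU q)
        (Ideal.IsPrime.mem_of_pow_mem inferInstance _ h), ?_⟩
    rw [map_one, map_pow, ← coe_projUnit (hU q),
      ← Units.val_pow_eq_pow_val, ← Units.val_mul]
    simp

/-- Sections of `𝒪(m)` over `D₊(θ)` are fractions `a / θ ^ n`. -/
theorem IsTwistedFraction.exists_mul_pow_eq {θ : A} (hθ : θ ∈ 𝒜 1) {m : ℤ}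
    {f : ∀ p : Proj.basicOpen 𝒜 θ, ProjLocalization p.1} (hf : IsTwistedFraction m f) :
    ∃ (n d : ℕ) (a : A), a ∈ 𝒜 d ∧ (d : ℤ) = n + m ∧
      ∀ p, f p * algebraMap A _ (θ ^ n) = algebraMap A _ a := by
  have hU : ∀ p : Proj.basicOpen 𝒜 θ, p.1 ∈ Proj.basicOpen 𝒜 θ := fun p => p.2
  have hf0 := hf.mul (IsTwistedFraction.zpow hθ hU (-m))
  rw [add_neg_cancel] at hf0
  obtain ⟨c, hc⟩ := hf0.exists_section
  have hbij : Function.Bijective (Proj.awayToSection 𝒜 θ) :=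
    ConcreteCategory.bijective_of_isIso (Proj.basicOpenIsoAway 𝒜 θ hθ one_pos).hom
  obtain ⟨x, rfl⟩ := hbij.2 c
  obtain ⟨n, a, ha, rfl⟩ := HomogeneousLocalization.Away.mk_surjective 𝒜 hθ x
  have hval : ∀ p : Proj.basicOpen 𝒜 θ,
      projValue p (Proj.awayToSection 𝒜 θ (HomogeneousLocalization.Away.mk 𝒜 hθ n a ha)) *
        algebraMap A _ (θ ^ n) = algebraMap A _ a := by
    intro p
    have h1 : projValue p (Proj.awayToSection 𝒜 θ (HomogeneousLocalization.Away.mk 𝒜 hθ n a ha)) =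
      Localization.mk a ((⟨θ, p.2⟩ : (projPrime p.1).primeCompl) ^ n) := rfl
    rw [h1, Localization.mk_eq_mk']
    exact IsLocalization.mk'_spec _ _ _
  have hn : θ ^ (m + m.natAbs).toNat ∈ 𝒜 (m + m.natAbs).toNat := by
    simpa using SetLike.pow_mem_graded (m + m.natAbs).toNat hθ
  rw [smul_eq_mul, mul_one] at ha
  refine ⟨n + m.natAbs, n + (m + m.natAbs).toNat, a * θ ^ (m + m.natAbs).toNat,
    SetLike.mul_mem_graded ha hn,
    by rw [Nat.cast_add, Nat.cast_add, Int.toNat_of_nonneg (by omega)]; ring, fun p => ?_⟩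
  have hu := coe_projUnit (hU p)
  have h2 : f p = projValue p (Proj.awayToSection 𝒜 θ
      (HomogeneousLocalization.Away.mk 𝒜 hθ n a (by simpa using ha))) *
      ((projUnit (hU p) ^ m : (ProjLocalization p.1)ˣ) :
        ProjLocalization p.1) := by
    rw [hc p, mul_assoc, ← Units.val_mul, ← zpow_add, neg_add_cancel, zpow_zero, Units.val_one,
      mul_one]
  have h3 : ((projUnit (hU p) ^ m : (ProjLocalization p.1)ˣ) :
        ProjLocalization p.1) * algebraMap A _ (θ ^ m.natAbs) =
        algebraMap A _ (θ ^ (m + m.natAbs).toNat) := by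
    rw [map_pow, map_pow, ← hu, ← Units.val_pow_eq_pow_val, ← Units.val_pow_eq_pow_val,
      ← Units.val_mul, ← zpow_natCast, ← zpow_natCast, ← zpow_add, Int.toNat_of_nonneg (by omega)]
  rw [h2, pow_add, map_mul, mul_mul_mul_comm, h3, hval, ← map_mul]

/-- Powers of the elements of a regular sequence `θ, η` form a regular sequence. -/
theorem exists_eq_pow_mul_of_regular {R : Type*} [CommRing R] {θ η : R}
    (hθ : ∀ x, θ * x = 0 → x = 0)
    (hη : ∀ x y, η * x = θ * y → ∃ z, x = θ * z) (i j : ℕ) :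
    ∀ x y, η ^ i * x = θ ^ j * y → ∃ z, x = θ ^ j * z := by
  have h1 : ∀ (i : ℕ) x y, η ^ i * x = θ * y → ∃ z, x = θ * z := by
    intro i
    induction i with
    | zero => intro x y h; exact ⟨y, by simpa using h⟩
    | succ i ih =>
      intro x y h
      obtain ⟨z, hz⟩ := ih (η * x) y (by rw [← h]; ring)
      exact hη x z hz
  induction j with
  | zero => intro x y _; exact ⟨x, by simp⟩
  | succ j ih =>
    intro x y h
    obtain ⟨z, rfl⟩ := h1 i x (θ ^ j * y) (by rw [h]; ring)
    obtain ⟨t, rfl⟩ := ih z y (by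
      have := hθ (η ^ i * z - θ ^ j * y) (by linear_combination h)
      linear_combination this)
    exact ⟨t, by ring⟩

theorem pow_mul_eq_zero_of_regular {R : Type*} [CommRing R] {θ : R}
    (hθ : ∀ x, θ * x = 0 → x = 0) (n : ℕ) : ∀ x, θ ^ n * x = 0 → x = 0 := by
  induction n with
  | zero => intro x h; simpa using h
  | succ n ih => intro x h; exact hθ x (ih _ (by rw [← h]; ring))

theorem mem_irrelevant_of_mem {θ : A} {d : ℕ} (hθ : θ ∈ 𝒜 d) (hd : 0 < d) :
    θ ∈ HomogeneousIdeal.irrelevant 𝒜 := by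
  rw [HomogeneousIdeal.mem_irrelevant_iff, GradedRing.proj_apply,
    DirectSum.decompose_of_mem_ne 𝒜 hθ hd.ne']

theorem eq_zero_of_forall_projLocalization {θ w : A} {d : ℕ} (hθ1 : θ ∈ 𝒜 1)
    (hθ : ∀ x, θ * x = 0 → x = 0) (hw : w ∈ 𝒜 d)
    (h : ∀ p : Proj 𝒜, algebraMap A (ProjLocalization p) w = 0) : w = 0 := by
  obtain ⟨n, hn⟩ := exists_pow_mul_eq_zero (mem_irrelevant_of_mem hθ1 one_pos) hw fun p _ => h p
  exact pow_mul_eq_zero_of_regular hθ n w hn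

/-- If two elements of degree one form a regular sequence of `A`, in either order, then the global
sections of `𝒪(m)` are the elements of `A` of degree `m`. -/
theorem exists_eq_of_isTwistedFraction_top {θ η : A} (hθ1 : θ ∈ 𝒜 1) (hη1 : η ∈ 𝒜 1)
    (hθ : ∀ x, θ * x = 0 → x = 0) (hη : ∀ x, η * x = 0 → x = 0)
    (hηθ : ∀ x y, η * x = θ * y → ∃ z, x = θ * z) {m : ℤ}
    {f : ∀ p : Proj 𝒜, ProjLocalization p}
    (hf : IsTwistedFraction (U := ⊤) m fun p => f p.1) :
    ∃ w : A, (∀ p, f p = algebraMap A _ w) ∧ (∀ d : ℕ, (d : ℤ) = m → w ∈ 𝒜 d) ∧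
      (m < 0 → w = 0) := by
  obtain ⟨n, d, a, ha, hd, hfa⟩ :=
    (hf.res (V := Proj.basicOpen 𝒜 θ) le_top).exists_mul_pow_eq hθ1
  obtain ⟨n', d', a', ha', hd', hfa'⟩ :=
    (hf.res (V := Proj.basicOpen 𝒜 η) le_top).exists_mul_pow_eq hη1
  have hpow : ∀ {t : A} (ht : t ∈ 𝒜 1) (n : ℕ), t ^ n ∈ 𝒜 n := fun ht n => by
    simpa using SetLike.pow_mem_graded n ht
  -- on `D₊(θ) ∩ D₊(η)` the fractions `a / θ ^ n` and `a' / η ^ n'` agree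
  have hcross : η ^ n' * a = θ ^ n * a' := by
    have hmem : η ^ n' * a - θ ^ n * a' ∈ 𝒜 (n' + d) := by
      refine sub_mem (SetLike.mul_mem_graded (hpow hη1 n') ha) ?_
      rw [show n' + d = n + d' by omega]
      exact SetLike.mul_mem_graded (hpow hθ1 n) ha'
    obtain ⟨l, hl⟩ := exists_pow_mul_eq_zero (𝒜 := 𝒜) (θ := θ * η)
      (mem_irrelevant_of_mem (SetLike.mul_mem_graded hθ1 hη1) (by norm_num)) hmem fun p hp => by
        have h1 : p ∈ Proj.basicOpen 𝒜 θ := fun h => hp (Ideal.mul_mem_right _ _ h)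
        have h2 : p ∈ Proj.basicOpen 𝒜 η := fun h => hp (Ideal.mul_mem_left _ _ h)
        rw [map_sub, map_mul, map_mul, ← hfa ⟨p, h1⟩, ← hfa' ⟨p, h2⟩]
        ring
    exact sub_eq_zero.mp (pow_mul_eq_zero_of_regular (fun x hx => hη x (hθ _ (by rw [← hx]; ring)))
      l _ hl)
  obtain ⟨w, rfl⟩ := exists_eq_pow_mul_of_regular hθ hηθ n' n a a' hcross
  -- replace `w` by its component of degree `m`
  obtain ⟨v, hv, hvm, hvneg⟩ : ∃ v : A, θ ^ n * v = θ ^ n * w ∧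
      (∀ d : ℕ, (d : ℤ) = m → v ∈ 𝒜 d) ∧ (m < 0 → v = 0) := by
    have hself := DirectSum.decompose_of_mem_same 𝒜 ha
    by_cases hm : 0 ≤ m
    · refine ⟨DirectSum.decompose 𝒜 w (d - n), ?_, fun e he => ?_, fun h => by omega⟩
      · rw [← DirectSum.coe_decompose_mul_of_left_mem_of_le 𝒜 (hpow hθ1 n) (by omega), hself]
      · rw [show e = d - n by omega]; exact SetLike.coe_mem _
    · refine ⟨0, ?_, fun e he => by omega, fun _ => rfl⟩
      rw [mul_zero, ← hself,
        DirectSum.coe_decompose_mul_of_left_mem_of_not_le 𝒜 (hpow hθ1 n) (by omega)]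
  refine ⟨v, fun p => ?_, hvm, hvneg⟩
  -- the element `v` represents `f` on `D₊(θ)`; near any other point of `Proj 𝒜` compare it with a
  -- local fraction, using that `θ` is regular
  obtain ⟨V, hpV, hV⟩ := hf ⟨p, trivial⟩
  replace hpV : p ∈ V := hpV
  obtain ⟨_, a, s, d₁, e₁, ha₁, hs₁, hde, hV⟩ := hV
  obtain ⟨_, ⟨g, rfl⟩, hpg, hgV⟩ :=
    TopologicalSpace.Opens.isBasis_iff_nbhd.mp (Proj.isBasis_basicOpen 𝒜) hpV
  replace hpg : g ∉ projPrime p := hpg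
  have hfθ : ∀ q, θ ∉ projPrime q → f q = algebraMap A _ v := by
    intro q hq
    have := hfa ⟨q, hq⟩
    rw [← hv, map_mul, mul_comm] at this
    exact (isUnit_algebraMap_projLocalization
      (fun h => hq (Ideal.IsPrime.mem_of_pow_mem inferInstance n h))).mul_left_cancel this
  have hmem : a - s * v ∈ 𝒜 d₁ := by
    refine sub_mem ha₁ ?_
    by_cases hm : 0 ≤ m
    · rw [show d₁ = e₁ + m.toNat by omega]
      exact SetLike.mul_mem_graded hs₁ (hvm _ (by omega))
    · rw [hvneg (by omega), mul_zero]; exact Submodule.zero_mem _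
  obtain ⟨l, hl⟩ := exists_pow_mul_eq_zero (𝒜 := 𝒜) (θ := g * θ)
    (Ideal.mul_mem_left _ _ (mem_irrelevant_of_mem hθ1 one_pos)) hmem fun q hq => by
      have h1 : q ∈ V := hgV (show q ∈ Proj.basicOpen 𝒜 g from
        fun h => hq (Ideal.mul_mem_right _ _ h))
      have h2 : θ ∉ projPrime q := fun h => hq (Ideal.mul_mem_left _ _ h)
      have h3 : f q * algebraMap A _ s = algebraMap A _ a := (hV q h1).2
      rw [map_sub, map_mul, ← h3, ← hfθ q h2]
      ring
  have hl' : g ^ l * (a - s * v) = 0 :=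
    pow_mul_eq_zero_of_regular hθ l _ (by rw [← hl]; ring)
  have h1 : algebraMap A (ProjLocalization p) (a - s * v) = 0 := by
    have := congrArg (algebraMap A (ProjLocalization p)) hl'
    rw [map_mul, map_zero] at this
    exact (isUnit_algebraMap_projLocalization
      (fun h => hpg (Ideal.IsPrime.mem_of_pow_mem inferInstance l h))).mul_right_eq_zero.mp this
  have h3 : f p * algebraMap A _ s = algebraMap A _ a := (hV p hpV).2
  rw [map_sub, map_mul, ← h3, sub_eq_zero, mul_comm] at h1
  exact (isUnit_algebraMap_projLocalization (hV p hpV).1).mul_left_cancel h1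

end GlobalSections

/-! ### Twisted global sections of the kernel -/

section KernelTwistedSections

open Matrix

variable {k A : Type u} [Field k] [CommRing A] [Algebra k A]
  {𝒜 : ℕ → Submodule k A} [GradedAlgebra 𝒜]

/-- The homogeneous component of `A` of an integral degree, zero in negative degrees. -/
def intPiece (𝒜 : ℕ → Submodule k A) (m : ℤ) : AddSubgroup A where
  carrier := {w | (∀ d : ℕ, (d : ℤ) = m → w ∈ 𝒜 d) ∧ (m < 0 → w = 0)}
  zero_mem' := ⟨fun _ _ => Submodule.zero_mem _, fun _ => rfl⟩
  add_mem' ha hb := ⟨fun d hd => add_mem (ha.1 d hd) (hb.1 d hd), fun h => by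
    rw [ha.2 h, hb.2 h, add_zero]⟩
  neg_mem' ha := ⟨fun d hd => neg_mem (ha.1 d hd), fun h => by rw [ha.2 h, neg_zero]⟩

theorem intPiece_natCast {𝒜 : ℕ → Submodule k A} (d : ℕ) {w : A} : w ∈ intPiece 𝒜 d ↔ w ∈ 𝒜 d :=
  ⟨fun h => h.1 d rfl, fun h => ⟨fun e he => by rwa [Nat.cast_injective he], fun h => by omega⟩⟩

theorem mul_mem_intPiece {d : ℕ} {m : ℤ} {a w : A} (ha : a ∈ 𝒜 d) (hw : w ∈ intPiece 𝒜 m) :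
    a * w ∈ intPiece 𝒜 (d + m) := by
  by_cases hm : 0 ≤ m
  · lift m to ℕ using hm
    rw [intPiece_natCast] at hw
    rw [← Nat.cast_add, intPiece_natCast]
    exact SetLike.mul_mem_graded ha hw
  · rw [hw.2 (by omega), mul_zero]
    exact AddSubgroup.zero_mem _

variable {ι κ σ : Type} [Fintype ι] {Θ : Matrix κ ι A} {t : ℤ} {x : σ → 𝒜 1}

/-- The assumptions under which the twisted global sections of the kernel of `Θ` on `𝒪(t) ^ ι` are
the elements of the kernel of `Θ` on `A ^ ι`: the matrix `Θ` has linear entries, the coordinates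
`x` cover `Proj 𝒜`, and `A` has depth at least two, as witnessed by the linear elements `θ` and
`η`. -/
structure KernelSectionsHypothesis (Θ : Matrix κ ι A) (x : σ → 𝒜 1) (θ η : A) : Prop where
  linear : ∀ i j, Θ i j ∈ 𝒜 1
  cover : ∀ p : Proj 𝒜, ∃ i, (x i : A) ∉ projPrime p
  mem_left : θ ∈ 𝒜 1
  mem_right : η ∈ 𝒜 1
  left_regular : ∀ a, θ * a = 0 → a = 0
  right_regular : ∀ a, η * a = 0 → a = 0
  regular : ∀ a b, η * a = θ * b → ∃ c, a = θ * c

theorem projValue_projFrac_mul (x : σ → 𝒜 1) (i : σ) {d : ℕ} (f : 𝒜 d)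
    (p : Proj.basicOpen 𝒜 (x i : A)) :
    projValue p (projFrac x i d f) * algebraMap A _ (x i : A) ^ d = algebraMap A _ (f : A) := by
  have h1 : projValue p (projFrac x i d f) =
    Localization.mk (f : A) ((⟨x i, p.2⟩ : (projPrime p.1).primeCompl) ^ d) := rfl
  rw [h1, Localization.mk_eq_mk', ← map_pow]
  exact IsLocalization.mk'_spec _ _ _

/-- The element `w` of `A ^ ι` gives the twisted section `s` of degree `m`. -/
def IsGlobalValue (s : ∀ i, Γ(kernelSheaf 𝒜 Θ t, Proj.basicOpen 𝒜 (x i : A))) (m : ℤ)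
    (w : ι → A) : Prop :=
  ∀ i (p : Proj.basicOpen 𝒜 (x i : A)) j,
    kernelSheaf.eval (s i) p j * (projUnit p.2 ^ m : (ProjLocalization p.1)ˣ) =
      algebraMap A _ (w j)

theorem projOverlap.mem_left {i j : σ} (p : projOverlap x i j) :
    p.1 ∈ Proj.basicOpen 𝒜 (x i : A) := inf_le_left (b := Proj.basicOpen 𝒜 (x j : A)) p.2

theorem projOverlap.mem_right {i j : σ} (p : projOverlap x i j) :
    p.1 ∈ Proj.basicOpen 𝒜 (x j : A) := inf_le_right (a := Proj.basicOpen 𝒜 (x i : A)) p.2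

theorem units_map_projTransition (i j : σ) (p : projOverlap x i j) :
    Units.map (projValue p : _ →* _) (projTransition x i j) =
      projUnit (projOverlap.mem_right p) * (projUnit (projOverlap.mem_left p))⁻¹ := by
  rw [eq_mul_inv_iff_mul_eq]
  refine Units.ext ?_
  have h : projValue p (projTransition x i j : Γ(Proj 𝒜, projOverlap x i j)) =
      Localization.mk (x j : A) ((⟨x i, p.2.1⟩ : (projPrime p.1).primeCompl) ^ 1) := rfl
  rw [Units.val_mul, Units.coe_map]
  change projValue p (projTransition x i j : Γ(Proj 𝒜, projOverlap x i j)) * algebraMap A _ _ =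
    algebraMap A _ _
  rw [h, pow_one, Localization.mk_eq_mk']
  exact IsLocalization.mk'_spec _ _ _

theorem projValue_projTransition_zpow (i j : σ) (m : ℤ) (p : projOverlap x i j) :
    projValue p ((projTransition x i j ^ m : Γ(Proj 𝒜, projOverlap x i j)ˣ) :
        Γ(Proj 𝒜, projOverlap x i j)) =
      ((projUnit (projOverlap.mem_right p) ^ m * (projUnit (projOverlap.mem_left p) ^ m)⁻¹ :
        (ProjLocalization p.1)ˣ) : ProjLocalization p.1) := by
  have h : Units.map (projValue p : _ →* _) (projTransition x i j ^ m) =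
      projUnit (projOverlap.mem_right p) ^ m * (projUnit (projOverlap.mem_left p) ^ m)⁻¹ := by
    rw [map_zpow, units_map_projTransition, mul_zpow, _root_.inv_zpow]
  rw [← h]; rfl

/-- On an overlap the gluing condition says that `s_i x_i ^ m` and `s_j x_j ^ m` are the same
function. -/
theorem mem_twistedSections_kernelSheaf {m : ℤ}
    {s : ∀ i, Γ(kernelSheaf 𝒜 Θ t, Proj.basicOpen 𝒜 (x i : A))} :
    s ∈ twistedSections x (kernelSheaf 𝒜 Θ t) m ↔
      ∀ i j (p : projOverlap x i j) l,
        kernelSheaf.eval (s i) ⟨p.1, projOverlap.mem_left p⟩ l *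
            (projUnit (projOverlap.mem_left p) ^ m : (ProjLocalization p.1)ˣ) =
          kernelSheaf.eval (s j) ⟨p.1, projOverlap.mem_right p⟩ l *
            (projUnit (projOverlap.mem_right p) ^ m : (ProjLocalization p.1)ˣ) := by
  refine forall₂_congr fun i j => ?_
  rw [← kernelSheaf.eval_injective.eq_iff, funext_iff]
  refine forall_congr' fun p => ?_
  rw [kernelSheaf.eval_smul, projValue_projTransition_zpow, funext_iff]
  refine forall_congr' fun l => ?_
  change kernelSheaf.eval (s i) ⟨p.1, projOverlap.mem_left p⟩ l =
    _ * kernelSheaf.eval (s j) ⟨p.1, projOverlap.mem_right p⟩ l ↔ _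
  generalize kernelSheaf.eval (s i) ⟨p.1, projOverlap.mem_left p⟩ l = a
  generalize kernelSheaf.eval (s j) ⟨p.1, projOverlap.mem_right p⟩ l = b
  generalize projUnit (projOverlap.mem_left p) ^ m = u
  generalize projUnit (projOverlap.mem_right p) ^ m = v
  have key : ∀ {R : Type u} [CommRing R] (a b : R) (u v : Rˣ),
      a = ((v * u⁻¹ : Rˣ) : R) * b ↔ a * u = b * v := fun a b u v => by
    rw [← u.isUnit.mul_left_inj, Units.val_mul, mul_right_comm, Units.inv_mul_cancel_right,
      mul_comm b]
  exact key a b u v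

namespace KernelSectionsHypothesis

variable {θ η : A}

theorem eq_zero_of_forall (H : KernelSectionsHypothesis Θ x θ η) {m : ℤ} {w : A}
    (hw : w ∈ intPiece 𝒜 m) (h : ∀ p : Proj 𝒜, algebraMap A (ProjLocalization p) w = 0) :
    w = 0 := by
  by_cases hm : 0 ≤ m
  · lift m to ℕ using hm
    exact eq_zero_of_forall_projLocalization H.mem_left H.left_regular
      ((intPiece_natCast m).mp hw) h
  · exact hw.2 (by omega)

theorem value_unique (H : KernelSectionsHypothesis Θ x θ η)
    {s : ∀ i, Γ(kernelSheaf 𝒜 Θ t, Proj.basicOpen 𝒜 (x i : A))} {m : ℤ} {w w' : ι → A}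
    (hw : ∀ j, w j ∈ intPiece 𝒜 (t + m)) (hw' : ∀ j, w' j ∈ intPiece 𝒜 (t + m))
    (h : IsGlobalValue s m w) (h' : IsGlobalValue s m w') : w = w' := by
  funext j
  rw [← sub_eq_zero]
  refine H.eq_zero_of_forall (sub_mem (hw j) (hw' j)) fun p => ?_
  obtain ⟨i, hi⟩ := H.cover p
  rw [map_sub, ← h i ⟨p, hi⟩ j, ← h' i ⟨p, hi⟩ j, sub_self]

theorem eq_zero_of_isGlobalValue_zero
    {s : ∀ i, Γ(kernelSheaf 𝒜 Θ t, Proj.basicOpen 𝒜 (x i : A))} {m : ℤ}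
    (h : IsGlobalValue s m 0) : s = 0 := by
  funext i
  refine kernelSheaf.eval_injective (funext fun p => funext fun j => ?_)
  have := h i p j
  rw [Pi.zero_apply, map_zero] at this
  simpa using this

/-- The functions `s_i x_i ^ m` glue to a family of global sections of `𝒪(t + m)`, which are
elements of `A`. -/
theorem exists_value (H : KernelSectionsHypothesis Θ x θ η) {m : ℤ}
    (s : twistedSections x (kernelSheaf 𝒜 Θ t) m) :
    ∃ w : ι → A, (∀ j, w j ∈ intPiece 𝒜 (t + m)) ∧ IsGlobalValue s.1 m w ∧ Θ *ᵥ w = 0 := by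
  have hs := mem_twistedSections_kernelSheaf.mp s.2
  choose c hc using fun p : Proj 𝒜 => (H.cover p).imp fun i hi => mem_projBasicOpen.mpr hi
  let f (j : ι) (p : Proj 𝒜) : ProjLocalization p :=
    kernelSheaf.eval (s.1 (c p)) ⟨p, hc p⟩ j * (projUnit (hc p) ^ m : (ProjLocalization p)ˣ)
  have hf : ∀ (j : ι) (i : σ) (p : Proj.basicOpen 𝒜 (x i : A)),
      f j p.1 = kernelSheaf.eval (s.1 i) p j * (projUnit p.2 ^ m : (ProjLocalization p.1)ˣ) :=
    fun j i p => hs (c p.1) i ⟨p.1, ⟨hc p.1, p.2⟩⟩ j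
  have hfrac : ∀ j, IsTwistedFraction (U := ⊤) (t + m) fun p => f j p.1 := by
    refine fun j => IsTwistedFraction.locality fun p =>
      ⟨Proj.basicOpen 𝒜 (x (c p.1) : A), hc p.1, le_top, ?_⟩
    have h := (kernelSheaf.isTwistedFraction_eval (s.1 (c p.1)) j).mul
      (IsTwistedFraction.zpow (x (c p.1)).2 (fun q => q.2) m)
    convert h using 2 with q
    exact hf j _ q
  choose w hw hwd hwn using fun j => exists_eq_of_isTwistedFraction_top H.mem_left H.mem_right
    H.left_regular H.right_regular H.regular (hfrac j)
  have hmem : ∀ j, w j ∈ intPiece 𝒜 (t + m) := fun j => ⟨hwd j, hwn j⟩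
  refine ⟨w, hmem, fun i p j => (hf j i p).symm.trans (hw j p.1), funext fun l => ?_⟩
  refine H.eq_zero_of_forall (m := (1 : ℕ) + (t + m))
    (AddSubgroup.sum_mem _ fun j _ => mul_mem_intPiece (H.linear l j) (hmem j)) fun p => ?_
  have hk := congrFun (kernelSheaf.mulVec_eval (s.1 (c p)) ⟨p, hc p⟩) l
  have hk' : ∑ j, algebraMap A (ProjLocalization p) (Θ l j) *
      kernelSheaf.eval (s.1 (c p)) ⟨p, hc p⟩ j = 0 := hk
  rw [show (Θ *ᵥ w) l = ∑ j, Θ l j * w j from rfl, map_sum]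
  simp_rw [map_mul, ← hw]
  simp_rw [f, ← mul_assoc]
  rw [← Finset.sum_mul, hk', zero_mul]

/-- The element of `A ^ ι` that gives a twisted section of the kernel sheaf. -/
def value (H : KernelSectionsHypothesis Θ x θ η) {m : ℤ} :
    twistedSections x (kernelSheaf 𝒜 Θ t) m →+ (ι → A) where
  toFun s := (H.exists_value s).choose
  map_zero' := by
    obtain ⟨h1, h2, -⟩ := (H.exists_value (0 : twistedSections x (kernelSheaf 𝒜 Θ t) m)).choose_spec
    refine H.value_unique h1 (fun _ => AddSubgroup.zero_mem _) h2 fun i p j => ?_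
    change kernelSheaf.eval (0 : Γ(kernelSheaf 𝒜 Θ t, Proj.basicOpen 𝒜 (x i : A))) p j * _ = _
    rw [map_zero]
    exact (zero_mul _).trans (map_zero _).symm
  map_add' s s' := by
    obtain ⟨h1, h2, -⟩ := (H.exists_value (s + s')).choose_spec
    obtain ⟨h3, h4, -⟩ := (H.exists_value s).choose_spec
    obtain ⟨h5, h6, -⟩ := (H.exists_value s').choose_spec
    refine H.value_unique h1 (fun j => add_mem (h3 j) (h5 j)) h2 fun i p j => ?_
    change kernelSheaf.eval (s.1 i + s'.1 i) p j * _ = _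
    rw [map_add]
    refine Eq.trans ?_ (map_add _ _ _).symm
    rw [← h4 i p j, ← h6 i p j]
    exact add_mul _ _ _

variable (H : KernelSectionsHypothesis Θ x θ η) {m : ℤ}

theorem value_mem (s : twistedSections x (kernelSheaf 𝒜 Θ t) m) (j : ι) :
    H.value s j ∈ intPiece 𝒜 (t + m) := (H.exists_value s).choose_spec.1 j

theorem isGlobalValue_value (s : twistedSections x (kernelSheaf 𝒜 Θ t) m) :
    IsGlobalValue s.1 m (H.value s) := (H.exists_value s).choose_spec.2.1

theorem mulVec_value (s : twistedSections x (kernelSheaf 𝒜 Θ t) m) : Θ *ᵥ H.value s = 0 :=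
  (H.exists_value s).choose_spec.2.2

theorem value_eq_zero {s : twistedSections x (kernelSheaf 𝒜 Θ t) m} (h : H.value s = 0) :
    s = 0 := by
  have := H.isGlobalValue_value s
  rw [h] at this
  exact Subtype.ext (eq_zero_of_isGlobalValue_zero this)

theorem value_smul {d : ℕ} (a : 𝒜 d) (s : twistedSections x (kernelSheaf 𝒜 Θ t) m) :
    H.value (twistedSections.smul x _ a s) = (a : A) • H.value s := by
  refine H.value_unique (H.value_mem _) (fun j => ?_) (H.isGlobalValue_value _) fun i p j => ?_
  · rw [show t + (d + m) = d + (t + m) by ring]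
    exact mul_mem_intPiece a.2 (H.value_mem s j)
  · have hv := projValue_projFrac_mul x i a p
    change kernelSheaf.eval (projFrac x i d a • s.1 i) p j * _ = _
    rw [kernelSheaf.eval_smul]
    change (_ * kernelSheaf.eval (s.1 i) p j) * _ = algebraMap A _ ((a : A) * H.value s j)
    rw [map_mul, ← H.isGlobalValue_value s i p j, ← hv, _root_.zpow_add, Units.val_mul,
      zpow_natCast, Units.val_pow_eq_pow_val, coe_projUnit]
    ring

/-- Conversely, `w` gives the sections `w / x_i ^ m`. -/
theorem exists_value_eq (H : KernelSectionsHypothesis Θ x θ η) {w : ι → A} {d : ℕ}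
    (hm : (d : ℤ) = t + m) (hw : ∀ j, w j ∈ 𝒜 d)
    (hΘ : Θ *ᵥ w = 0) : ∃ s : twistedSections x (kernelSheaf 𝒜 Θ t) m, H.value s = w := by
  have key : ∀ i, ∃ s : Γ(kernelSheaf 𝒜 Θ t, Proj.basicOpen 𝒜 (x i : A)),
      kernelSheaf.eval s =
        fun (p : Proj.basicOpen 𝒜 (x i : A)) j => algebraMap A (ProjLocalization p.1) (w j) *
          (projUnit p.2 ^ (-m) : (ProjLocalization p.1)ˣ) := by
    intro i
    refine kernelSheaf.exists_eval_eq (fun j => ?_) fun p => ?_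
    · have := (IsTwistedFraction.of_mem (U := Proj.basicOpen 𝒜 (x i : A)) (hw j)).mul
        (IsTwistedFraction.zpow (x i).2 (fun p => p.2) (-m))
      rwa [hm, add_neg_cancel_right] at this
    · funext l
      change ∑ j, algebraMap A _ (Θ l j) * (algebraMap A _ (w j) *
        ((projUnit p.2 ^ (-m) : (ProjLocalization p.1)ˣ) : ProjLocalization p.1)) = 0
      simp_rw [← mul_assoc, ← map_mul]
      rw [← Finset.sum_mul, ← map_sum, show ∑ j, Θ l j * w j = 0 from congrFun hΘ l, map_zero,
        zero_mul]
  choose s hs using key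
  have hval : IsGlobalValue s m w := fun i p j => by
    rw [hs, mul_assoc, ← Units.val_mul, ← _root_.zpow_add, neg_add_cancel, zpow_zero, Units.val_one,
      mul_one]
  refine ⟨⟨s, mem_twistedSections_kernelSheaf.mpr fun i j p l => ?_⟩, ?_⟩
  · exact (hval i ⟨p.1, projOverlap.mem_left p⟩ l).trans
      (hval j ⟨p.1, projOverlap.mem_right p⟩ l).symm
  · refine H.value_unique (H.value_mem _) (fun j => ?_) (H.isGlobalValue_value _) hval
    rw [← hm, intPiece_natCast]
    exact hw j

/-- The twisted global sections of the kernel sheaf, as elements of `A ^ ι`. -/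
def globalValue : TwistedGlobalSections x (kernelSheaf 𝒜 Θ t) →+ (ι → A) :=
  DirectSum.toAddMonoid fun _ => H.value

/-- The component of degree `m` of a twisted global section. -/
def component (m : ℤ) : TwistedGlobalSections x (kernelSheaf 𝒜 Θ t) →+
    twistedSections x (kernelSheaf 𝒜 Θ t) m :=
  DFinsupp.evalAddMonoidHom m

theorem globalValue_ofDegree (s : twistedSections x (kernelSheaf 𝒜 Θ t) m) :
    H.globalValue (TwistedGlobalSections.ofDegree x _ m s) = H.value s :=
  DirectSum.toAddMonoid_of _ _ _

theorem induction_on {motive : TwistedGlobalSections x (kernelSheaf 𝒜 Θ t) → Prop}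
    (z : TwistedGlobalSections x (kernelSheaf 𝒜 Θ t)) (zero : motive 0)
    (of : ∀ m s, motive (TwistedGlobalSections.ofDegree x _ m s))
    (add : ∀ z z', motive z → motive z' → motive (z + z')) : motive z :=
  DirectSum.induction_on z zero of add

theorem globalValue_smul (a : A) (z : TwistedGlobalSections x (kernelSheaf 𝒜 Θ t)) :
    H.globalValue (a • z) = a • H.globalValue z := by
  induction z using induction_on with
  | zero => simp
  | add z z' hz hz' => rw [smul_add, map_add, hz, hz', map_add, smul_add]
  | of m s =>
    induction a using DirectSum.Decomposition.inductionOn 𝒜 with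
    | zero => simp
    | add a b ha hb => rw [add_smul, map_add, ha, hb, add_smul]
    | homogeneous a =>
      rw [TwistedGlobalSections.smul_ofDegree, globalValue_ofDegree, globalValue_ofDegree,
        value_smul]

theorem mulVec_globalValue (z : TwistedGlobalSections x (kernelSheaf 𝒜 Θ t)) :
    Θ *ᵥ H.globalValue z = 0 := by
  induction z using induction_on with
  | zero => simp
  | add z z' hz hz' => rw [map_add, mulVec_add, hz, hz', add_zero]
  | of m s => rw [globalValue_ofDegree, mulVec_value]

/-- The homogeneous components of a twisted global section are those of its value. -/
theorem decompose_globalValue (z : TwistedGlobalSections x (kernelSheaf 𝒜 Θ t)) (j : ι) (d : ℕ)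
    (hm : (d : ℤ) = t + m) :
    (DirectSum.decompose 𝒜 (H.globalValue z j) d : A) =
      H.value (component m z) j := by
  induction z using induction_on with
  | zero =>
    rw [map_zero, Pi.zero_apply, DirectSum.decompose_zero]
    rw [map_zero, map_zero, Pi.zero_apply]
    rfl
  | add z z' hz hz' =>
    rw [map_add, Pi.add_apply, DirectSum.decompose_add, DirectSum.add_apply, Submodule.coe_add, hz,
      hz', map_add, map_add, Pi.add_apply]
  | of m' s =>
    rw [globalValue_ofDegree]
    have hs := H.value_mem s j
    by_cases h : m' = m
    · subst h
      rw [DirectSum.decompose_of_mem_same 𝒜 (hs.1 d hm)]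
      have h0 : component m' (TwistedGlobalSections.ofDegree x (kernelSheaf 𝒜 Θ t) m' s) = s :=
        DirectSum.of_eq_same (β := fun m => twistedSections x (kernelSheaf 𝒜 Θ t) m) m' s
      rw [h0]
    · have h0 : component m (TwistedGlobalSections.ofDegree x (kernelSheaf 𝒜 Θ t) m' s) = 0 :=
        DirectSum.of_eq_of_ne _ _ _ (Ne.symm h)
      rw [h0, map_zero, Pi.zero_apply]
      rcases lt_or_ge (t + m') 0 with hlt | hge
      · rw [hs.2 hlt, DirectSum.decompose_zero]; rfl
      · exact DirectSum.decompose_of_mem_ne 𝒜 (hs.1 (t + m').toNat (by omega)) (by omega)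

theorem globalValue_injective : Function.Injective (H.globalValue (t := t)) := by
  refine (injective_iff_map_eq_zero _).mpr fun z hz => ?_
  refine DFinsupp.ext fun m => H.value_eq_zero (funext fun j => ?_)
  rcases lt_or_ge (t + m) 0 with hlt | hge
  · exact (H.value_mem _ j).2 hlt
  · have := H.decompose_globalValue z j (m := m) (t + m).toNat (by omega)
    rw [hz, Pi.zero_apply, DirectSum.decompose_zero] at this
    exact this.symm

theorem exists_globalValue_eq {w : ι → A} (hw : Θ *ᵥ w = 0) :
    ∃ z, H.globalValue (t := t) z = w := by
  classical
  let c (d : ℕ) : ι → A := fun j => DirectSum.decompose 𝒜 (w j) d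
  have hc : ∀ d, ∃ z, H.globalValue (t := t) z = c d := by
    intro d
    obtain ⟨s, hs⟩ := H.exists_value_eq (t := t) (m := d - t) (d := d) (w := c d) (by ring)
      (fun j => SetLike.coe_mem _) (funext fun i => by
        have h1 := congrArg (fun a => (DirectSum.decompose 𝒜 a (1 + d) : A)) (congrFun hw i)
        simp only [Pi.zero_apply, DirectSum.decompose_zero] at h1
        rw [show (Θ *ᵥ w) i = ∑ j, Θ i j * w j from rfl, DirectSum.decompose_sum,
          DFinsupp.finsetSum_apply, AddSubmonoidClass.coe_finsetSum] at h1
        simp_rw [DirectSum.coe_decompose_mul_add_of_left_mem 𝒜 (H.linear i _)] at h1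
        exact h1)
    exact ⟨TwistedGlobalSections.ofDegree x _ _ s, (H.globalValue_ofDegree s).trans hs⟩
  choose z hz using hc
  refine ⟨∑ d ∈ Finset.univ.biUnion fun j => (DirectSum.decompose 𝒜 (w j)).support, z d, ?_⟩
  rw [map_sum]
  funext j
  rw [Finset.sum_apply]
  simp_rw [hz]
  conv_rhs => rw [← DirectSum.sum_support_decompose 𝒜 (w j)]
  refine (Finset.sum_subset (fun d hd => Finset.mem_biUnion.mpr ⟨j, Finset.mem_univ _, hd⟩)
    fun d _ hd => ?_).symm
  have h0 : DirectSum.decompose 𝒜 (w j) d = 0 := by simpa using hd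
  change (DirectSum.decompose 𝒜 (w j) d : A) = 0
  rw [h0, Submodule.coe_zero]

/-- The twisted global sections of the kernel of `Θ` on `𝒪(t) ^ ι` are the kernel of `Θ`
on `A ^ ι`. -/
def linearEquiv :
    TwistedGlobalSections x (kernelSheaf 𝒜 Θ t) ≃ₗ[A] LinearMap.ker Θ.mulVecLin :=
  LinearEquiv.ofBijective
    (LinearMap.codRestrict _ ⟨⟨H.globalValue, map_add _⟩, H.globalValue_smul⟩
      H.mulVec_globalValue)
    ⟨fun _ _ h => H.globalValue_injective (congrArg Subtype.val h), fun w =>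
      (H.exists_globalValue_eq w.2).imp fun _ h => Subtype.ext h⟩

theorem mem_range_ofDegree_zero {z : TwistedGlobalSections x (kernelSheaf 𝒜 Θ t)} {d : ℕ}
    (hd : (d : ℤ) = t) (h : ∀ j, (H.linearEquiv z).1 j ∈ 𝒜 d) :
    z ∈ (TwistedGlobalSections.ofDegree x (kernelSheaf 𝒜 Θ t) 0).range := by
  obtain ⟨s, hs⟩ := H.exists_value_eq (m := 0) (by rw [hd, add_zero]) h (H.linearEquiv z).2
  exact ⟨s, H.globalValue_injective ((H.globalValue_ofDegree s).trans hs)⟩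

end KernelSectionsHypothesis

end KernelTwistedSections

/-! ### Tangent vectors and smoothness -/

section Jacobian

open TrivSqZeroExt

/-- A ring homomorphism `ρ` from `S` to the dual numbers on the dual of `W` is a family of tangent
vectors of `S` at a `K`-valued point, parametrized by `W`. If `S` is smooth of relative dimension
`d`, the vectors that give the zero derivation have codimension at most `d`. -/
theorem exists_submodule_forall_snd_eq_zero {R S K W : Type*} [CommRing R] [CommRing S]
    [Algebra R S] {d : ℕ} [Algebra.IsStandardSmoothOfRelativeDimension d R S] [Field K]
    [AddCommGroup W] [Module K W] [FiniteDimensional K W]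
    (ρ : S →+* TrivSqZeroExt K (Module.Dual K W))
    (hR : ∀ r, (ρ (algebraMap R S r)).snd = 0) :
    ∃ W' : Submodule K W, Module.finrank K W ≤ Module.finrank K W' + d ∧
      ∀ v ∈ W', ∀ s, (ρ s).snd v = 0 := by
  let φ : S →+* K := (fstHom K K (Module.Dual K W)).toRingHom.comp ρ
  let _ : Module S (Module.Dual K W) := Module.compHom _ φ
  let _ : Module R (Module.Dual K W) := Module.compHom _ (algebraMap R S)
  have : IsScalarTower R S (Module.Dual K W) := ⟨fun r s m => by
    rw [Algebra.smul_def, mul_smul]; rfl⟩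
  have hsmul : ∀ (s : S) (m : Module.Dual K W) v, (s • m) v = φ s * m v := fun _ _ _ => rfl
  -- the infinitesimal part of `ρ` is a derivation, determined by its values on a basis of `Ω`
  let D : Derivation R S (Module.Dual K W) := Derivation.mk'
    { toFun := fun s => (ρ s).snd
      map_add' := fun s t => by rw [map_add, snd_add]
      map_smul' := fun r s => by
        rw [Algebra.smul_def, map_mul, snd_mul, hR, smul_zero, add_zero]
        rfl }
    (fun s t => by
      change (ρ (s * t)).snd = _
      rw [map_mul, snd_mul, op_smul_eq_smul]
      rfl)
  have : Nontrivial S := φ.domain_nontrivial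
  have : Algebra.IsStandardSmooth R S :=
    Algebra.IsStandardSmoothOfRelativeDimension.isStandardSmooth d
  have hrank := Algebra.IsStandardSmoothOfRelativeDimension.rank_kaehlerDifferential (R := R)
    (S := S) d
  have : Module.Finite S (Ω[S⁄R]) := Module.finite_of_rank_eq_nat hrank
  let b := Module.finBasisOfFinrankEq S (Ω[S⁄R]) (Module.finrank_eq_of_rank_eq hrank)
  let L : W →ₗ[K] (Fin d → K) := LinearMap.pi fun i => D.liftKaehlerDifferential (b i)
  refine ⟨LinearMap.ker L, ?_, fun v hv s => ?_⟩
  · have h1 := L.finrank_range_add_finrank_ker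
    have h2 := Submodule.finrank_le (LinearMap.range L)
    rw [Module.finrank_fin_fun] at h2
    omega
  · let F : Submodule S (Ω[S⁄R]) :=
      { carrier := {ω | D.liftKaehlerDifferential ω v = 0}
        zero_mem' := by simp
        add_mem' := fun {a b} ha hb => by
          rw [Set.mem_ofPred_eq, map_add, LinearMap.add_apply, ha, hb, add_zero]
        smul_mem' := fun c a ha => by
          rw [Set.mem_ofPred_eq, map_smul, hsmul, ha, mul_zero] }
    have hF : F = ⊤ := by
      rw [eq_top_iff, ← b.span_eq, Submodule.span_le]
      rintro _ ⟨i, rfl⟩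
      exact congrFun (LinearMap.mem_ker.mp hv) i
    have : KaehlerDifferential.D R S s ∈ F := hF ▸ Submodule.mem_top
    have h3 : D.liftKaehlerDifferential (KaehlerDifferential.D R S s) v = 0 := this
    rwa [Derivation.liftKaehlerDifferential_comp_D] at h3

theorem snd_mul_apply {K W : Type*} [Field K] [AddCommGroup W] [Module K W]
    (b c : TrivSqZeroExt K (Module.Dual K W)) (v : W) :
    (b * c).snd v = b.fst * c.snd v + c.fst * b.snd v := by
  simp

theorem snd_pow_apply_eq_zero {K W : Type*} [Field K] [AddCommGroup W] [Module K W]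
    {b : TrivSqZeroExt K (Module.Dual K W)} {v : W} (h : b.snd v = 0) (n : ℕ) :
    (b ^ n).snd v = 0 := by
  induction n with
  | zero => simp
  | succ n ih => rw [pow_succ, snd_mul_apply, h, ih, mul_zero, mul_zero, add_zero]

theorem snd_apply_eq_zero {K W : Type*} [Field K] [AddCommGroup W] [Module K W]
    {r b : TrivSqZeroExt K (Module.Dual K W)} {n : ℕ} {v : W} (h : (r * b ^ n).snd v = 0)
    (hb : b.fst ≠ 0) (hb' : b.snd v = 0) : r.snd v = 0 := by
  rwa [snd_mul_apply, snd_pow_apply_eq_zero hb', mul_zero, zero_add, fst_pow, mul_eq_zero,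
    or_iff_right (pow_ne_zero n hb)] at h

/-- If the affine coordinate `r = X_j / X_i` is constant along the tangent vector `v`, then the
coordinates of `v` are proportional to those of the point. -/
theorem snd_cross_mul {K W : Type*} [Field K] [AddCommGroup W] [Module K W]
    {r : TrivSqZeroExt K (Module.Dual K W)} {v : W} (h : r.snd v = 0)
    {y y' : K} {m m' : Module.Dual K W}
    (hr : r * (inl y + inr m) = inl y' + inr m') : m' v * y = m v * y' := by
  have h1 := congrArg fst hr
  have h2 := congrArg (fun z => z.snd v) hr
  simp only [snd_mul_apply, h, fst_mul, fst_add, fst_inl, fst_inr, snd_add, snd_inl, snd_inr,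
    zero_add, add_zero, mul_zero] at h1 h2
  linear_combination m v * h1 - y * h2

theorem isUnit_and_exists_mul_pow_eq {S T Z : Type*} [CommRing S] [CommRing T] [CommRing Z]
    [Algebra S T] (h : S) [IsLocalization.Away h T] {ψ : T →+* Z} {ρ : S →+* Z}
    (hψ : ∀ b, ψ (algebraMap S T b) = ρ b) (r : T) :
    IsUnit (ρ h) ∧ ∃ (n : ℕ) (a : S), ψ r * ρ h ^ n = ρ a := by
  refine ⟨hψ h ▸ (IsLocalization.Away.algebraMap_isUnit h).map ψ, ?_⟩
  obtain ⟨n, a, ha⟩ := IsLocalization.Away.surj h r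
  exact ⟨n, a, by rw [← hψ a, ← ha, map_mul, map_pow, hψ]⟩

/-- The first order Taylor formula for polynomials. -/
theorem eval₂Hom_trivSqZeroExt {k K M σ : Type*} [Field k] [Field K] [Algebra k K] [Fintype σ]
    [AddCommGroup M] [Module K M] [Module Kᵐᵒᵖ M] [IsCentralScalar K M] (y : σ → K) (m : σ → M)
    (q : MvPolynomial σ k) :
    MvPolynomial.eval₂Hom ((inlHom K M).comp (algebraMap k K)) (fun i => inl (y i) + inr (m i)) q =
      inl (MvPolynomial.aeval y q) +
        inr (∑ i, MvPolynomial.aeval y (MvPolynomial.pderiv i q) • m i) := by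
  classical
  induction q using MvPolynomial.induction_on with
  | C a => simp
  | add p q hp hq =>
    rw [map_add, hp, hq]
    simp only [map_add, add_smul, Finset.sum_add_distrib, inl_add, inr_add]
    abel
  | mul_X p j hp =>
    rw [map_mul, hp]
    ext
    · simp
    · simp [Derivation.leibniz, add_smul, Finset.sum_add_distrib, MvPolynomial.pderiv_X,
        Pi.single_apply, mul_smul, Finset.smul_sum, apply_ite (MvPolynomial.aeval y), ite_smul]
end Jacobian

/-! ### The Jacobian criterion -/

section StructureMorphism

theorem decompose_quotientGrading_mk {k A : Type u} [Field k] [CommRing A] [Algebra k A]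
    {𝒜 : ℕ → Submodule k A} [GradedAlgebra 𝒜] (I : HomogeneousIdeal 𝒜) (a : A) (i : ℕ) :
    (DirectSum.decompose (quotientGrading I) (Ideal.Quotient.mk I.toIdeal a) i : A ⧸ I.toIdeal) =
      Ideal.Quotient.mk I.toIdeal (DirectSum.decompose 𝒜 a i : A) := by
  change ((DirectSum.map (quotientGrading.proj I) (DirectSum.decompose 𝒜 a)) i :
    A ⧸ I.toIdeal) = _
  rw [DirectSum.map_apply]
  rfl

theorem projValue_map {k A : Type u} [Field k] [CommRing A] [Algebra k A] {𝒜 : ℕ → Submodule k A}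
    [GradedAlgebra 𝒜] {U V : (Proj 𝒜).Opens} (h : V ≤ U) (s : Γ(Proj 𝒜, U)) (p : V) :
    projValue p ((Proj 𝒜).presheaf.map (homOfLE h).op s) = projValue ⟨p.1, h p.2⟩ s := rfl

theorem projValue_awayToSection_fromZeroRingHom {k A : Type u} [Field k] [CommRing A] [Algebra k A]
    {𝒜 : ℕ → Submodule k A} [GradedAlgebra 𝒜] (f : A) (a : 𝒜 0) (p : Proj.basicOpen 𝒜 f) :
    projValue p (Proj.awayToSection 𝒜 f (HomogeneousLocalization.fromZeroRingHom 𝒜 _ a)) =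
      algebraMap A _ (a : A) :=
  Localization.mk_one_eq_algebraMap _

/-- The structure morphism of `Proj 𝒜`, described on the open subset `D₊(1)`, which is
everything. -/
theorem basicOpen_one_ι_comp_toSpecZero {σ A : Type u} [CommRing A] [SetLike σ A]
    [AddSubgroupClass σ A] (𝒜 : ℕ → σ) [GradedRing 𝒜] :
    (Proj.basicOpen 𝒜 (1 : A)).ι ≫ Proj.toSpecZero 𝒜 = Proj.basicOpenToSpec 𝒜 1 ≫
      Spec.map (CommRingCat.ofHom (HomogeneousLocalization.fromZeroRingHom 𝒜 _)) := by
  have (U) (e : U = ⊤) : (Proj.basicOpen 𝒜 (1 : A)).ι ≫ (Scheme.topIso _).inv ≫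
      (Scheme.isoOfEq _ e).inv = Scheme.homOfLE _ (le_top.trans_eq e.symm) := by
    simp only [← Category.assoc, Iso.comp_inv_eq]
    simp only [Scheme.topIso_hom, Category.assoc, Scheme.isoOfEq_hom_ι, Scheme.homOfLE_ι]
  rw [Proj.toSpecZero, reassoc_of% this]
  simp

attribute [local instance] MvPolynomial.gradedAlgebra

variable {k : Type u} [Field k] {N : ℕ}
  (I : HomogeneousIdeal (MvPolynomial.homogeneousSubmodule (Fin (N + 1)) k))

theorem toSpec_appTop_comp_map_basicOpen_one :
    (Scheme.ΓSpecIso (CommRingCat.of k)).inv ≫ (ProjectiveSubscheme.toSpec I).appTop ≫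
      (ProjectiveSubscheme I).presheaf.map
        (homOfLE (le_top : Proj.basicOpen (quotientGrading I) 1 ≤ ⊤)).op =
        CommRingCat.ofHom (algebraMap k (quotientGrading I 0)) ≫
        CommRingCat.ofHom (HomogeneousLocalization.fromZeroRingHom _ _) ≫
        Proj.awayToSection (quotientGrading I) 1 := by
  have hι : (ProjectiveSubscheme I).presheaf.map
      (homOfLE (le_top : Proj.basicOpen (quotientGrading I) 1 ≤ ⊤)).op =
      (Proj.basicOpen (quotientGrading I) 1).ι.appTop ≫
        (Proj.basicOpen (quotientGrading I) 1).topIso.hom := by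
    simp
    rfl
  have h1 : (Scheme.ΓSpecIso _).inv ≫ (Proj.basicOpenToSpec (quotientGrading I) 1).appTop ≫
      (Proj.basicOpen (quotientGrading I) 1).topIso.hom =
        Proj.awayToSection (quotientGrading I) 1 := by
    have := Proj.basicOpenToSpec_app_top (quotientGrading I) 1
    rw [Iso.inv_comp_eq, ← Iso.eq_comp_inv, Category.assoc]
    exact this
  rw [hι, ProjectiveSubscheme.toSpec, ← Scheme.Hom.comp_appTop_assoc,
    reassoc_of% basicOpen_one_ι_comp_toSpecZero (quotientGrading I), Scheme.Hom.comp_appTop,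
    Scheme.Hom.comp_appTop, Category.assoc, Category.assoc,
    ← Scheme.ΓSpecIso_inv_naturality_assoc, ← Scheme.ΓSpecIso_inv_naturality_assoc, h1]

/-- The structure morphism of `X` pulls scalars back to constant functions. -/
theorem projValue_toSpec_appTop (a : k) (p : (⊤ : (ProjectiveSubscheme I).Opens)) :
    projValue p ((ProjectiveSubscheme.toSpec I).appTop
        ((Scheme.ΓSpecIso (CommRingCat.of k)).inv a)) =
      algebraMap _ (ProjLocalization p.1) (algebraMap k
        (MvPolynomial (Fin (N + 1)) k ⧸ I.toIdeal) a) := by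
  have hp : p.1 ∈ Proj.basicOpen (quotientGrading I) 1 :=
    fun h => (inferInstance : (projPrime p.1).IsPrime).one_notMem h
  have h3 := ConcreteCategory.congr_hom (toSpec_appTop_comp_map_basicOpen_one I) a
  have h4 := congrArg (projValue (⟨p.1, hp⟩ : Proj.basicOpen (quotientGrading I) 1)) h3
  refine Eq.trans ?_ (h4.trans ?_)
  · exact (projValue_map (le_top : Proj.basicOpen (quotientGrading I) 1 ≤ ⊤) _ ⟨p.1, hp⟩).symm
  · exact projValue_awayToSection_fromZeroRingHom (𝒜 := quotientGrading I) 1 _ ⟨p.1, hp⟩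

variable {I}

/-- Tangent vectors of `Proj 𝒜` at a point `p`, with values in `K` and parametrized by `W`, form a
space of dimension at most `d`, if `Proj 𝒜` is smooth of relative dimension `d`: up to
codimension `d` they annihilate the affine coordinates `x_j / x_i`. -/
theorem exists_submodule_of_smoothOfRelativeDimension {k A : Type u} [Field k] [CommRing A]
    [Algebra k A] {𝒜 : ℕ → Submodule k A} [GradedAlgebra 𝒜] {σ : Type} (x : σ → 𝒜 1) {d : ℕ}
    (f : Proj 𝒜 ⟶ Spec (CommRingCat.of k)) [SmoothOfRelativeDimension d f]
    (hf : ∀ (a : k) (p : (⊤ : (Proj 𝒜).Opens)),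
      projValue p (f.appTop ((Scheme.ΓSpecIso (CommRingCat.of k)).inv a)) =
        algebraMap A (ProjLocalization p.1) (algebraMap k A a))
    {K W : Type u} [Field K] [AddCommGroup W] [Module K W] [FiniteDimensional K W] (p : Proj 𝒜)
    (τ : ProjLocalization p →+* TrivSqZeroExt K (Module.Dual K W))
    (hτ : ∀ c : k, (τ (algebraMap _ _ (algebraMap k A c))).snd = 0) :
    ∃ W' : Submodule K W, Module.finrank K W ≤ Module.finrank K W' + d ∧
      ∀ i j, p ∈ Proj.basicOpen 𝒜 (x i : A) → ∃ r : ProjLocalization p,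
        r * algebraMap A _ (x i) = algebraMap A _ (x j) ∧ ∀ v ∈ W', (τ r).snd v = 0 := by
  obtain ⟨U, hU, V, hV, hpV, e, hsmooth⟩ :=
    SmoothOfRelativeDimension.exists_isStandardSmoothOfRelativeDimension (n := d) (f := f) p
  obtain rfl : U = ⊤ := by
    refine top_le_iff.mp fun z _ => ?_
    have : Subsingleton (Spec (CommRingCat.of k)) :=
      inferInstanceAs (Subsingleton (PrimeSpectrum k))
    exact Subsingleton.elim (f p) z ▸ e hpV
  let _ : Algebra Γ(Spec (CommRingCat.of k), ⊤) Γ(Proj 𝒜, V) := (f.appLE ⊤ V e).hom.toAlgebra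
  have : Algebra.IsStandardSmoothOfRelativeDimension d Γ(Spec (CommRingCat.of k), ⊤)
    Γ(Proj 𝒜, V) := hsmooth
  let ρ : Γ(Proj 𝒜, V) →+* TrivSqZeroExt K (Module.Dual K W) := τ.comp (projValue (⟨p, hpV⟩ : V))
  obtain ⟨W', hW', hρ⟩ := exists_submodule_forall_snd_eq_zero
    (R := Γ(Spec (CommRingCat.of k), ⊤)) (d := d) ρ fun c => by
      obtain ⟨a, rfl⟩ : ∃ a, (Scheme.ΓSpecIso (CommRingCat.of k)).inv a = c :=
        ⟨(Scheme.ΓSpecIso (CommRingCat.of k)).hom c, by simp⟩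
      exact (congrArg (fun z => (τ z).snd) (hf a ⟨p, trivial⟩)).trans (hτ a)
  refine ⟨W', hW', fun i j hpi => ?_⟩
  obtain ⟨h, hle, hph⟩ := hV.exists_basicOpen_le ⟨p, hpi⟩ hpV
  have hloc := hV.isLocalization_basicOpen h
  let r : Γ(Proj 𝒜, (Proj 𝒜).basicOpen h) :=
    (Proj 𝒜).presheaf.map (homOfLE hle).op (projFrac x i 1 (x j))
  let p' : (Proj 𝒜).basicOpen h := ⟨p, hph⟩
  obtain ⟨hunit, n, a, h1⟩ := isUnit_and_exists_mul_pow_eq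
    (T := Γ(Proj 𝒜, (Proj 𝒜).basicOpen h)) h
    (ψ := τ.comp (projValue p')) (ρ := ρ) (fun b => rfl) r
  rw [TrivSqZeroExt.isUnit_iff_isUnit_fst] at hunit
  refine ⟨projValue p' r, ?_, fun v hv => ?_⟩
  · have h2 : projValue p' r = projValue ⟨p, hpi⟩ (projFrac x i 1 (x j)) := projValue_map hle _ p'
    have h3 := projValue_projFrac_mul x i (x j) ⟨p, hpi⟩
    rw [h2, ← h3, pow_one]
  · exact snd_apply_eq_zero ((congrArg (fun z => z.snd v) h1).trans (hρ v hv a)) hunit.ne_zero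
      (hρ v hv h)

theorem finrank_le_one_of_apply_eq_zero {K σ : Type*} [Field K] [Fintype σ]
    {W : Submodule K (σ → K)} {W' : Submodule K W} (j : σ) (h : ∀ v ∈ W', v.1 j = 0 → v = 0) :
    Module.finrank K W' ≤ 1 := by
  let f : W' →ₗ[K] K :=
    (LinearMap.proj (R := K) (φ := fun _ : σ => K) j).comp (W.subtype.comp W'.subtype)
  have hf : Function.Injective f := fun a b hab => sub_eq_zero.mp <|
    Subtype.ext (h (a - b).1 (a - b).2 (sub_eq_zero.mpr hab))
  have := LinearMap.finrank_le_finrank_of_injective hf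
  rwa [Module.finrank_self] at this

/-- The Jacobian criterion: if `X` is smooth of relative dimension `d` over `k`, and at some
point of `X` with coordinates `y` in a field `K` the gradients of all the equations of `X` are
multiples of one linear form, then `N ≤ d + 1`, as the affine cone has a tangent space of dimension
at least `N` there. -/
theorem le_relativeDimension_add_one {d : ℕ}
    [SmoothOfRelativeDimension d (ProjectiveSubscheme.toSpec I)] {K : Type u} [Field K]
    [Algebra k K] {y : Fin (N + 1) → K} (hy : y ≠ 0)
    (hyh : ∀ q : MvPolynomial (Fin (N + 1)) k, MvPolynomial.aeval y q = 0 → ∀ i,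
      MvPolynomial.aeval y (MvPolynomial.homogeneousComponent i q) = 0)
    (hI : ∀ q ∈ I.toIdeal, MvPolynomial.aeval y q = 0) (l : Module.Dual K (Fin (N + 1) → K))
    (hl : ∀ q ∈ I.toIdeal, ∃ c : K, ∀ v : Fin (N + 1) → K,
      ∑ i, MvPolynomial.aeval y (MvPolynomial.pderiv i q) * v i = c * l v) : N ≤ d + 1 := by
  -- the point `p` of `X`
  let φ : MvPolynomial (Fin (N + 1)) k ⧸ I.toIdeal →+* K :=
    Ideal.Quotient.lift _ (MvPolynomial.aeval y : _ →ₐ[k] K).toRingHom hI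
  have hφ : ∀ q, φ (Ideal.Quotient.mk _ q) = MvPolynomial.aeval y q := fun q => rfl
  have hhom : (RingHom.ker φ).IsHomogeneous (quotientGrading I) := by
    intro i a ha
    obtain ⟨q, rfl⟩ := Ideal.Quotient.mk_surjective a
    have hdec : (DirectSum.decompose (quotientGrading I) (Ideal.Quotient.mk I.toIdeal q) i :
        MvPolynomial (Fin (N + 1)) k ⧸ I.toIdeal) =
        Ideal.Quotient.mk _ (MvPolynomial.homogeneousComponent i q) :=
      (decompose_quotientGrading_mk I q i).trans
        (congrArg _ (MvPolynomial.decomposition.decompose'_apply q i))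
    rw [hdec, RingHom.mem_ker, hφ]
    exact hyh q ((hφ q).symm.trans ha) i
  obtain ⟨j₀, hj₀⟩ : ∃ j, y j ≠ 0 := Function.ne_iff.mp hy
  have hφX : ∀ j, φ (ProjectiveSubscheme.coord I j) = y j := fun j =>
    (hφ _).trans (MvPolynomial.aeval_X _ _)
  let p : ProjectiveSubscheme I := (⟨⟨RingHom.ker φ, hhom⟩, RingHom.ker_isPrime φ, fun hle =>
    hj₀ ((hφX j₀).symm.trans
      (hle (mem_irrelevant_of_mem (ProjectiveSubscheme.coord I j₀).2 one_pos)))⟩ :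
        ProjectiveSpectrum (quotientGrading I))
  have hp : ∀ a, a ∉ projPrime p ↔ φ a ≠ 0 := fun a => Iff.rfl
  -- the tangent vectors at `p`
  let W := LinearMap.ker l
  let M := Module.Dual K W
  let m : Fin (N + 1) → M := fun i =>
    (LinearMap.proj (R := K) (φ := fun _ => K) i).comp W.subtype
  let τ : MvPolynomial (Fin (N + 1)) k ⧸ I.toIdeal →+* TrivSqZeroExt K M :=
    Ideal.Quotient.lift _ (MvPolynomial.eval₂Hom ((TrivSqZeroExt.inlHom K M).comp (algebraMap k K))
      fun i => TrivSqZeroExt.inl (y i) + TrivSqZeroExt.inr (m i)) fun q hq => by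
        rw [eval₂Hom_trivSqZeroExt, hI q hq, TrivSqZeroExt.inl_zero, zero_add]
        obtain ⟨c, hc⟩ := hl q hq
        have h0 : ∑ i, MvPolynomial.aeval y (MvPolynomial.pderiv i q) • m i = 0 := by
          refine LinearMap.ext fun v => ?_
          rw [LinearMap.sum_apply]
          refine (hc v.1).trans ?_
          rw [show l v.1 = 0 from v.2, mul_zero, LinearMap.zero_apply]
        rw [h0, TrivSqZeroExt.inr_zero]
  have hτ : ∀ a, (τ a).fst = φ a := fun a => by
    obtain ⟨q, rfl⟩ := Ideal.Quotient.mk_surjective a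
    rw [hφ, Ideal.Quotient.lift_mk, eval₂Hom_trivSqZeroExt]
    simp
  have hτX : ∀ i, τ (ProjectiveSubscheme.coord I i : _) =
      TrivSqZeroExt.inl (y i) + TrivSqZeroExt.inr (m i) := fun i =>
    MvPolynomial.eval₂Hom_X' _ _ _
  have hτC : ∀ c : k, τ (algebraMap k _ c) = TrivSqZeroExt.inl (algebraMap k K c) := fun c =>
    MvPolynomial.eval₂Hom_C _ _ _
  let τ' : ProjLocalization p →+* TrivSqZeroExt K M :=
    IsLocalization.lift (M := (projPrime p).primeCompl) (g := τ) fun s => by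
      rw [TrivSqZeroExt.isUnit_iff_isUnit_fst, hτ]
      exact ((hp s.1).mp s.2).isUnit
  have hτ' : ∀ a, τ' (algebraMap _ _ a) = τ a := fun a => IsLocalization.lift_eq _ _
  obtain ⟨W', hW', hr⟩ := exists_submodule_of_smoothOfRelativeDimension
    (ProjectiveSubscheme.coord I) (d := d) _ (projValue_toSpec_appTop I) p τ'
    fun c => by rw [hτ', hτC, TrivSqZeroExt.snd_inl]
  -- vectors in `W'` are multiples of `y`
  have hmul : ∀ v ∈ W', ∀ j, v.1 j * y j₀ = v.1 j₀ * y j := by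
    intro v hv j
    obtain ⟨r, hr1, hr2⟩ := hr j₀ j fun h => hj₀ ((hφX j₀).symm.trans h)
    have h2 : τ' r * (TrivSqZeroExt.inl (y j₀) + TrivSqZeroExt.inr (m j₀)) =
        TrivSqZeroExt.inl (y j) + TrivSqZeroExt.inr (m j) := by
      refine Eq.trans ?_ (((congrArg τ' hr1).trans (hτ' _)).trans (hτX j))
      rw [map_mul]
      exact congrArg _ ((hτ' _).trans (hτX j₀)).symm
    exact snd_cross_mul (hr2 v hv) h2
  have hle : Module.finrank K W' ≤ 1 := by
    refine finrank_le_one_of_apply_eq_zero j₀ fun v hv h0 => Subtype.ext (funext fun j => ?_)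
    have h1 := hmul v hv j
    rw [h0, zero_mul, mul_eq_zero] at h1
    exact h1.resolve_right hj₀
  have hW : N ≤ Module.finrank K W := by
    have h1 := l.finrank_range_add_finrank_ker
    have h2 := Submodule.finrank_le (LinearMap.range l)
    rw [Module.finrank_fin_fun] at h1
    rw [Module.finrank_self] at h2
    change N ≤ Module.finrank K (LinearMap.ker l)
    omega
  omega

end StructureMorphism

/-! ### Smooth pencils of quadratic forms -/

section QuadraticForms

open Matrix

/-- The quadratic form with matrix `S`, as a polynomial. -/
def quadraticPolynomial {R ι : Type*} [CommRing R] [Fintype ι] (S : Matrix ι ι R) :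
    MvPolynomial ι R :=
  MvPolynomial.X ⬝ᵥ S.map MvPolynomial.C *ᵥ MvPolynomial.X

variable {k ι : Type*} [Field k] [Fintype ι]

theorem aeval_quadraticPolynomial {K : Type*} [Field K] [Algebra k K] (S : Matrix ι ι k)
    (y : ι → K) :
    MvPolynomial.aeval y (quadraticPolynomial S) = y ⬝ᵥ S.map (algebraMap k K) *ᵥ y := by
  simp [quadraticPolynomial, dotProduct, mulVec, map_sum]

theorem aeval_pderiv_quadraticPolynomial {K : Type*} [Field K] [Algebra k K] {S : Matrix ι ι k}
    (hS : S.IsSymm) (y : ι → K) (i : ι) :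
    MvPolynomial.aeval y (MvPolynomial.pderiv i (quadraticPolynomial S)) =
      2 * (S.map (algebraMap k K) *ᵥ y) i := by
  classical
  have h : ∀ a b, S a b = S b a := fun a b => hS.apply b a
  simp only [quadraticPolynomial, dotProduct, mulVec, map_sum, Derivation.leibniz,
    MvPolynomial.pderiv_X, Pi.single_apply, smul_eq_mul, Matrix.map_apply, map_add, map_mul,
    MvPolynomial.aeval_X, MvPolynomial.pderiv_C, MvPolynomial.aeval_C, mul_zero, add_zero,
    Finset.sum_add_distrib, apply_ite (MvPolynomial.aeval y), map_zero, mul_ite, mul_one,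
    Finset.sum_ite_eq', Finset.mem_univ, if_true, Finset.mul_sum, two_mul]
  simp only [Finset.sum_ite_irrel, Finset.sum_const_zero, Finset.sum_ite_eq',
    Finset.mem_univ, if_true]
  congr 1
  exact Finset.sum_congr rfl fun j _ => by rw [h j i]; ring

/-- Half the matrix of second derivatives represents a quadratic form, by Euler's formula. -/
theorem exists_isSymm_eq_quadraticPolynomial (h2 : (2 : k) ≠ 0) {q : MvPolynomial ι k}
    (hq : q.IsHomogeneous 2) : ∃ S : Matrix ι ι k, S.IsSymm ∧ q = quadraticPolynomial S := by
  have hc : ∀ i j, MvPolynomial.pderiv i (MvPolynomial.pderiv j q) =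
      MvPolynomial.C (MvPolynomial.coeff 0 (MvPolynomial.pderiv i (MvPolynomial.pderiv j q))) :=
    fun i j => MvPolynomial.totalDegree_eq_zero_iff_eq_C.mp
      (MvPolynomial.totalDegree_zero_iff_isHomogeneous _ |>.mpr hq.pderiv.pderiv)
  have hcomm : ∀ i j, MvPolynomial.pderiv i (MvPolynomial.pderiv j q) =
      MvPolynomial.pderiv j (MvPolynomial.pderiv i q) := fun i j => by
    have h : ⁅MvPolynomial.pderiv (R := k) i, MvPolynomial.pderiv j⁆ = 0 :=
      MvPolynomial.derivation_ext fun l => by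
        classical
        rw [Derivation.commutator_apply, MvPolynomial.pderiv_X, MvPolynomial.pderiv_X,
          Pi.single_apply, Pi.single_apply]
        split_ifs <;> simp
    have := congrArg (fun D : Derivation k (MvPolynomial ι k) (MvPolynomial ι k) => D q) h
    rwa [Derivation.commutator_apply, Derivation.zero_apply, sub_eq_zero] at this
  obtain ⟨S, hS⟩ : ∃ S : Matrix ι ι k, ∀ i j, S i j = 2⁻¹ * MvPolynomial.coeff 0
      (MvPolynomial.pderiv j (MvPolynomial.pderiv i q)) := ⟨Matrix.of fun i j => _, fun _ _ => rfl⟩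
  refine ⟨S, ?_, ?_⟩
  · ext i j
    rw [transpose_apply, hS, hS, hcomm]
  · have h1 := hq.sum_X_mul_pderiv
    have h4 : (MvPolynomial.C (2⁻¹ : k) * 2 : MvPolynomial ι k) = 1 := by
      rw [← map_ofNat MvPolynomial.C 2, ← map_mul, inv_mul_cancel₀ h2, map_one]
    have h5 : q = MvPolynomial.C (2⁻¹ : k) *
        ∑ i, MvPolynomial.X i * MvPolynomial.pderiv i q := by
      rw [h1, nsmul_eq_mul, ← mul_assoc, Nat.cast_ofNat, h4, one_mul]
    have h6 : ∀ i, MvPolynomial.pderiv i q =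
        ∑ j, MvPolynomial.X j * MvPolynomial.pderiv j (MvPolynomial.pderiv i q) := fun i => by
      rw [(hq.pderiv (i := i)).sum_X_mul_pderiv, show (2 - 1 : ℕ) = 1 from rfl, one_smul]
    have h7 : ∀ i j, MvPolynomial.C (S i j) =
        MvPolynomial.C 2⁻¹ * MvPolynomial.pderiv j (MvPolynomial.pderiv i q) := fun i j => by
      rw [hS, map_mul, ← hc]
    simp only [quadraticPolynomial, dotProduct, mulVec, Matrix.map_apply, h7]
    refine (h5.trans (congrArg _ (Finset.sum_congr rfl fun i _ => congrArg _ (h6 i)))).trans ?_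
    rw [Finset.mul_sum]
    refine Finset.sum_congr rfl fun i _ => ?_
    rw [mul_left_comm, Finset.mul_sum]
    refine congrArg (MvPolynomial.X i * ·) (Finset.sum_congr rfl fun j _ => ?_)
    ring

theorem _root_.Matrix.IsSymm.dotProduct_mulVec_comm {S : Matrix ι ι k} (hS : S.IsSymm)
    (x y : ι → k) : x ⬝ᵥ S *ᵥ y = y ⬝ᵥ S *ᵥ x := by
  rw [dotProduct_mulVec, ← mulVec_transpose, hS.eq, dotProduct_comm]

/-- The variety where both forms vanish is smooth away from the origin: at a nonzero common zero
the gradients of the two forms are linearly independent. -/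
def PencilIsSmooth (S T : Matrix ι ι k) : Prop :=
  ∀ x : ι → k, x ≠ 0 → x ⬝ᵥ S *ᵥ x = 0 → x ⬝ᵥ T *ᵥ x = 0 →
    ∀ α β : k, α • (S *ᵥ x) + β • (T *ᵥ x) = 0 → α = 0 ∧ β = 0

/-- A pencil whose members are all degenerate has a kernel vector depending polynomially on the
parameter, and its values are singular points of the base locus. -/
theorem PencilIsSmooth.exists_det_ne_zero [Infinite k] [DecidableEq ι] {S T : Matrix ι ι k}
    (hS : S.IsSymm) (hT : T.IsSymm) (h : PencilIsSmooth S T) : ∃ c : k, (S + c • T).det ≠ 0 := by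
  by_contra! hdet
  -- the generic member of the pencil, with a kernel vector `v`
  let M : Matrix ι ι (Polynomial k) := S.map Polynomial.C + (Polynomial.X : Polynomial k) •
    T.map Polynomial.C
  have hM : ∀ c, M.map (Polynomial.evalRingHom c) = S + c • T := fun c => by
    ext i j; simp [M, mul_comm c]
  have hM0 : M.det = 0 := Polynomial.funext fun c => by
    rw [← Polynomial.coe_evalRingHom, RingHom.map_det, RingHom.mapMatrix_apply, hM, hdet, map_zero]
  obtain ⟨v, hv, hMv⟩ := Matrix.exists_mulVec_eq_zero_iff.mpr hM0
  let x : k → ι → k := fun c i => (v i).eval c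
  have hx : ∀ c, S *ᵥ x c = -(c • T *ᵥ x c) := fun c => by
    rw [eq_neg_iff_add_eq_zero, ← smul_mulVec, ← add_mulVec, ← hM]
    funext i
    have h0 := RingHom.map_mulVec (Polynomial.evalRingHom c) M v i
    rw [hMv, Pi.zero_apply, map_zero] at h0
    exact h0.symm
  have hsymm : ∀ {U : Matrix ι ι k} (_ : U.IsSymm) (a b : ι → k), a ⬝ᵥ U *ᵥ b = b ⬝ᵥ U *ᵥ a :=
    fun {U} hU a b => hU.dotProduct_mulVec_comm a b
  -- kernel vectors of different members are orthogonal
  have h1 : ∀ c d, c ≠ d → x c ⬝ᵥ T *ᵥ x d = 0 := fun c d hcd => by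
    have h3 := congrArg (x d ⬝ᵥ ·) (hx c)
    have h4 := congrArg (x c ⬝ᵥ ·) (hx d)
    simp only [dotProduct_neg, dotProduct_smul, smul_eq_mul] at h3 h4
    rw [hsymm hS, h4, hsymm hT] at h3
    have : (c - d) * (x c ⬝ᵥ T *ᵥ x d) = 0 := by
      rw [hsymm hT (x c)]
      linear_combination h3
    exact (mul_eq_zero.mp this).resolve_left (sub_ne_zero.mpr hcd)
  obtain ⟨i, hi⟩ : ∃ i, v i ≠ 0 := Function.ne_iff.mp hv
  obtain ⟨c, hc⟩ : ∃ c, (v i).eval c ≠ 0 := by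
    by_contra! h0
    exact hi (Polynomial.funext fun c => by rw [h0, Polynomial.eval_zero])
  let p : Polynomial k := ∑ i, ∑ j, Polynomial.C (x c i * T i j) * v j
  have hp : ∀ d, p.eval d = x c ⬝ᵥ T *ᵥ x d := fun d => by
    simp [p, dotProduct, mulVec, Polynomial.eval_finsetSum, Finset.mul_sum, x, mul_assoc]
  -- as `p` is a polynomial, `x c` is isotropic for `T`, hence a singular point of the base locus
  have hp0 : p = 0 := by
    have : p * (Polynomial.X - Polynomial.C c) = 0 := Polynomial.funext fun d => by
      rw [Polynomial.eval_mul, hp]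
      rcases eq_or_ne c d with rfl | hcd
      · simp
      · rw [h1 c d hcd, zero_mul, Polynomial.eval_zero]
    exact (mul_eq_zero.mp this).resolve_right (Polynomial.X_sub_C_ne_zero c)
  have h2 : x c ⬝ᵥ T *ᵥ x c = 0 := by rw [← hp, hp0, Polynomial.eval_zero]
  have h3 := h (x c) (Function.ne_iff.mpr ⟨i, hc⟩) (by
    rw [hx, dotProduct_neg, dotProduct_smul, h2, smul_zero, neg_zero]) h2 1 c (by
    rw [hx, one_smul, neg_add_cancel])
  exact one_ne_zero h3.1

/-- Eigenvectors of a smooth pencil are not isotropic. -/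
theorem PencilIsSmooth.eq_zero_of_isotropic {S T : Matrix ι ι k} (h : PencilIsSmooth S T) {μ : k}
    {x : ι → k} (hx : T *ᵥ x = μ • S *ᵥ x) (h0 : x ⬝ᵥ S *ᵥ x = 0) : x = 0 := by
  by_contra hne
  have := h x hne h0 (by rw [hx, dotProduct_smul, h0, smul_zero]) μ (-1) (by
    rw [hx, neg_one_smul, add_neg_cancel])
  exact one_ne_zero (neg_eq_zero.mp this.2)

section Eigenvectors

variable {S T : Matrix ι ι k} {f : Module.End k (ι → k)}

theorem mulVec_eq_smul_of_mem_eigenspace (hf : ∀ x, S *ᵥ f x = T *ᵥ x) {μ : k} {x : ι → k}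
    (hx : x ∈ f.eigenspace μ) : T *ᵥ x = μ • S *ᵥ x := by
  rw [← hf, Module.End.mem_eigenspace_iff.mp hx, mulVec_smul]

/-- There are no Jordan blocks: `f - μ` is self-adjoint for `S`, so a vector `(f - μ) y` in its
kernel is isotropic. -/
theorem PencilIsSmooth.maxGenEigenspace_le (h : PencilIsSmooth S T) (hS : S.IsSymm) (hT : T.IsSymm)
    (hf : ∀ x, S *ᵥ f x = T *ᵥ x) (μ : k) : f.maxGenEigenspace μ ≤ f.eigenspace μ := by
  intro x hx
  obtain ⟨m, hm⟩ := Module.End.mem_maxGenEigenspace f μ x |>.mp hx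
  let g := f - μ • (1 : Module.End k (ι → k))
  have hg : ∀ y, g y = f y - μ • y := fun y => rfl
  have hgadj : ∀ x y, x ⬝ᵥ S *ᵥ g y = g x ⬝ᵥ S *ᵥ y := fun x y => by
    rw [hS.dotProduct_mulVec_comm (g x), hg, hg, mulVec_sub, mulVec_sub, dotProduct_sub,
      dotProduct_sub, hf, hf, mulVec_smul, mulVec_smul, dotProduct_smul, dotProduct_smul,
      hT.dotProduct_mulVec_comm x, hS.dotProduct_mulVec_comm x]
  have hg2 : ∀ y, g (g y) = 0 → g y = 0 := fun y hy => by
    refine h.eq_zero_of_isotropic (mulVec_eq_smul_of_mem_eigenspace hf (μ := μ)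
      (Module.End.mem_eigenspace_iff.mpr (sub_eq_zero.mp hy))) ?_
    rw [← hgadj, hy, mulVec_zero, dotProduct_zero]
  have hgm : ∀ m : ℕ, (g ^ m) x = 0 → g x = 0 := by
    intro m
    induction m with
    | zero => intro h; rw [show x = 0 from h, map_zero]
    | succ m ih =>
      rcases m with _ | m
      · intro h; simpa using h
      · intro h
        refine ih ?_
        rw [pow_succ', Module.End.mul_apply]
        refine hg2 _ ?_
        rwa [pow_succ', pow_succ', Module.End.mul_apply, Module.End.mul_apply] at h
  exact Module.End.mem_eigenspace_iff.mpr (sub_eq_zero.mp (hgm m hm))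

theorem PencilIsSmooth.exists_unit_eigenvector [IsAlgClosed k] (h : PencilIsSmooth S T)
    (hf : ∀ x, S *ᵥ f x = T *ᵥ x) (μ : f.Eigenvalues) :
    ∃ v, v ∈ f.eigenspace μ.1 ∧ v ⬝ᵥ S *ᵥ v = 1 := by
  obtain ⟨v, hv⟩ := Module.End.HasEigenvalue.exists_hasEigenvector μ.2
  obtain ⟨r, hr⟩ := IsAlgClosed.exists_pow_nat_eq (v ⬝ᵥ S *ᵥ v) (n := 2) two_pos
  have hr0 : r ≠ 0 := fun h0 => hv.2 <|
    h.eq_zero_of_isotropic (mulVec_eq_smul_of_mem_eigenspace hf hv.1) (by rw [← hr, h0]; simp)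
  refine ⟨r⁻¹ • v, Submodule.smul_mem _ _ hv.1, ?_⟩
  rw [mulVec_smul, dotProduct_smul, smul_dotProduct, ← hr, smul_eq_mul, smul_eq_mul]
  field_simp

/-- The eigenspaces are lines, since a plane contains an isotropic vector. -/
theorem PencilIsSmooth.mem_span_singleton [IsAlgClosed k] (h : PencilIsSmooth S T) (hS : S.IsSymm)
    (hf : ∀ x, S *ᵥ f x = T *ᵥ x) {μ : k} {v y : ι → k} (hv : v ∈ f.eigenspace μ)
    (hv1 : v ⬝ᵥ S *ᵥ v = 1) (hy : y ∈ f.eigenspace μ) : y ∈ Submodule.span k {v} := by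
  -- the part of `y` orthogonal to `v`; some `w + r v` is isotropic
  let w := y - (y ⬝ᵥ S *ᵥ v) • v
  have hw : w ∈ f.eigenspace μ := sub_mem hy (Submodule.smul_mem _ _ hv)
  have hwv : w ⬝ᵥ S *ᵥ v = 0 := by
    rw [sub_dotProduct, smul_dotProduct, hv1, smul_eq_mul, mul_one, sub_self]
  obtain ⟨r, hr⟩ := IsAlgClosed.exists_pow_nat_eq (-(w ⬝ᵥ S *ᵥ w)) (n := 2) two_pos
  have h0 : w + r • v = 0 := by
    refine h.eq_zero_of_isotropic (mulVec_eq_smul_of_mem_eigenspace hf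
      (add_mem hw (Submodule.smul_mem _ r hv))) ?_
    rw [mulVec_add, mulVec_smul, dotProduct_add, add_dotProduct, dotProduct_smul,
      add_dotProduct, hwv, smul_dotProduct, smul_dotProduct, hv1, hS.dotProduct_mulVec_comm v, hwv]
    simp only [smul_eq_mul]
    linear_combination hr
  have hr0 : r = 0 := by
    have := congrArg (· ⬝ᵥ S *ᵥ v) h0
    simpa [add_dotProduct, smul_dotProduct, hwv, hv1] using this
  rw [hr0, zero_smul, add_zero, sub_eq_zero] at h0
  rw [h0]
  exact Submodule.smul_mem _ _ (Submodule.mem_span_singleton_self _)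

/-- The eigenvectors of `S⁻¹ T` form a basis, and the eigenvalues are distinct. -/
theorem PencilIsSmooth.exists_eigenbasis [IsAlgClosed k] [DecidableEq ι] (h : PencilIsSmooth S T)
    (hS : S.IsSymm) (hT : T.IsSymm) (hdet : S.det ≠ 0) :
    ∃ (a : ι → k) (v : ι → ι → k), Function.Injective a ∧ (∀ i, T *ᵥ v i = a i • S *ᵥ v i) ∧
      ∀ i, v i ⬝ᵥ S *ᵥ v i = 1 := by
  obtain ⟨f, hf⟩ : ∃ f : Module.End k (ι → k), ∀ x, S *ᵥ f x = T *ᵥ x :=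
    ⟨(S⁻¹ * T).mulVecLin, fun x => by
      rw [mulVecLin_apply, mulVec_mulVec, mul_nonsing_inv_cancel_left _ _ hdet.isUnit]⟩
  choose v hv hv1 using h.exists_unit_eigenvector hf
  have hvne : ∀ μ, v μ ≠ 0 := fun μ h0 => by
    have := hv1 μ
    rw [h0, zero_dotProduct] at this
    exact zero_ne_one this
  have hli : LinearIndependent k v := by
    refine f.eigenvectors_linearIndependent' (fun μ : f.Eigenvalues => (μ.1 : k)) ?_ v fun μ => ?_
    · exact fun μ ν h => Subtype.ext h
    · exact ⟨hv μ, hvne μ⟩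
  have htop : ⊤ ≤ Submodule.span k (Set.range v) := by
    rw [← Module.End.iSup_maxGenEigenspace_eq_top f]
    refine iSup_le fun μ => (h.maxGenEigenspace_le hS hT hf μ).trans fun y hy => ?_
    by_cases hy0 : y = 0
    · rw [hy0]; exact Submodule.zero_mem _
    · have hμ : f.HasEigenvalue μ := Module.End.hasEigenvalue_of_hasEigenvector ⟨hy, hy0⟩
      let ν : f.Eigenvalues := ⟨μ, hμ⟩
      refine Submodule.span_mono ?_ (h.mem_span_singleton hS hf (hv ν) (hv1 ν) hy)
      exact Set.singleton_subset_iff.mpr ⟨ν, rfl⟩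
  have e : ι ≃ f.Eigenvalues := (Pi.basisFun k ι).indexEquiv (Module.Basis.mk hli htop)
  refine ⟨fun i => (e i).1, fun i => v (e i), fun i j hij => e.injective (Subtype.ext hij),
    fun i => ?_, fun i => hv1 (e i)⟩
  exact mulVec_eq_smul_of_mem_eigenspace hf (hv (e i))

end Eigenvectors

/-- A smooth pencil with a nondegenerate member is diagonal in an orthonormal basis of that member,
with distinct eigenvalues. -/
theorem PencilIsSmooth.exists_diagonal [IsAlgClosed k] [DecidableEq ι] {S T : Matrix ι ι k}
    (h : PencilIsSmooth S T) (hS : S.IsSymm) (hT : T.IsSymm) (hdet : S.det ≠ 0) :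
    ∃ (G : Matrix ι ι k) (a : ι → k), IsUnit G.det ∧ Function.Injective a ∧ S = Gᵀ * G ∧
      T = Gᵀ * diagonal a * G := by
  obtain ⟨a, v, ha, hTv, hv1⟩ := h.exists_eigenbasis hS hT hdet
  let V : Matrix ι ι k := of fun j i => v i j
  have hVV : ∀ (U : Matrix ι ι k) i j, (Vᵀ * U * V) i j = v i ⬝ᵥ U *ᵥ v j := by
    intro U i j
    rw [Matrix.mul_assoc]
    rfl
  have horth : ∀ i j, i ≠ j → v i ⬝ᵥ S *ᵥ v j = 0 := by
    intro i j hij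
    have h1 := hT.dotProduct_mulVec_comm (v i) (v j)
    rw [hTv, hTv, dotProduct_smul, dotProduct_smul, hS.dotProduct_mulVec_comm (v j), smul_eq_mul,
      smul_eq_mul, ← sub_eq_zero, ← sub_mul, mul_eq_zero] at h1
    exact h1.resolve_left fun h => hij (ha (sub_eq_zero.mp h).symm)
  have hSV : Vᵀ * S * V = 1 := by
    ext i j
    rw [hVV, one_apply]
    split_ifs with hij
    · rw [hij, hv1]
    · exact horth i j hij
  have hTV : Vᵀ * T * V = diagonal a := by
    ext i j
    rw [hVV, hTv, dotProduct_smul, ← hVV, hSV, one_apply, diagonal_apply]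
    split_ifs with hij
    · rw [hij, smul_eq_mul, mul_one]
    · rw [smul_zero]
  have hdetV : IsUnit V.det := by
    have := congrArg det hSV
    rw [det_mul, det_one] at this
    exact .of_mul_eq_one_right _ this
  have hVt : IsUnit (Vᵀ).det := by rwa [det_transpose]
  have hback : ∀ U W : Matrix ι ι k, Vᵀ * U * V = W → U = V⁻¹ᵀ * W * V⁻¹ := by
    rintro U _ rfl
    rw [transpose_nonsing_inv, ← Matrix.mul_assoc, ← Matrix.mul_assoc, nonsing_inv_mul _ hVt,
      Matrix.one_mul, Matrix.mul_assoc, mul_nonsing_inv _ hdetV, Matrix.mul_one]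
  refine ⟨V⁻¹, a, isUnit_nonsing_inv_det _ hdetV, ha, ?_, hback _ _ hTV⟩
  have := hback _ _ hSV
  rwa [Matrix.mul_one] at this

end QuadraticForms

/-! ### Smooth complete intersections of two quadrics -/

section ConePoint

open MvPolynomial

variable {k σ : Type*} [Field k]

/-- The restriction of a homogeneous polynomial to the line through a point. -/
theorem aeval_C_mul_X_of_isHomogeneous {q : MvPolynomial σ k} {d : ℕ} (hq : q.IsHomogeneous d)
    (x : σ → k) : aeval (fun i => Polynomial.C (x i) * Polynomial.X) q =
      Polynomial.C (eval x q) * Polynomial.X ^ d := by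
  rw [aeval_def, eval₂_eq, eval_eq, map_sum, Finset.sum_mul]
  refine Finset.sum_congr rfl fun s hs => ?_
  have hd : ∑ i ∈ s.support, s i = d := by
    rw [← hq (mem_support_iff.mp hs), Finsupp.weight_apply, Finsupp.sum]
    simp
  simp_rw [mul_pow]
  rw [Finset.prod_mul_distrib, Finset.prod_pow_eq_pow_sum, hd, map_mul, map_prod]
  simp_rw [map_pow]
  rw [← mul_assoc]
  rfl

theorem coeff_aeval_C_mul_X (q : MvPolynomial σ k) (x : σ → k) (d : ℕ) :
    (aeval (fun i => Polynomial.C (x i) * Polynomial.X) q).coeff d =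
      eval x (homogeneousComponent d q) := by
  conv_lhs => rw [← sum_homogeneousComponent q]
  rw [map_sum, Polynomial.finsetSum_coeff]
  simp_rw [aeval_C_mul_X_of_isHomogeneous (homogeneousComponent_isHomogeneous _ q),
    Polynomial.coeff_C_mul_X_pow]
  rw [Finset.sum_ite_eq]
  split_ifs with h
  · rfl
  · rw [homogeneousComponent_eq_zero _ _ (by simpa using h), map_zero]

end ConePoint

section SmoothPencil

open Matrix

attribute [local instance] MvPolynomial.gradedAlgebra

/-- By the Jacobian criterion, applied at the generic point of the line over a point of `X` in the
affine cone, the pencil of quadrics that defines a smooth complete intersection is smooth. -/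
theorem IsSmoothCompleteIntersection.pencilIsSmooth {k : Type u} [Field k] {N : ℕ} (hN : 2 ≤ N)
    {S T : Matrix (Fin (N + 1)) (Fin (N + 1)) k} (hS : S.IsSymm) (hT : T.IsSymm)
    {h₁ : (quadraticPolynomial S).IsHomogeneous 2} {h₂ : (quadraticPolynomial T).IsHomogeneous 2}
    (hX : IsSmoothCompleteIntersection (quadraticPolynomial S) (quadraticPolynomial T) h₁ h₂) :
    PencilIsSmooth S T := by
  intro x hx hSx hTx α β hαβ
  by_contra hne
  obtain ⟨w, c, d, hc, hd⟩ : ∃ (w : Fin (N + 1) → k) (c d : k), S *ᵥ x = c • w ∧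
      T *ᵥ x = d • w := by
    by_cases hα : α = 0
    · have hβ : β ≠ 0 := fun hβ => hne ⟨hα, hβ⟩
      refine ⟨S *ᵥ x, 1, 0, (one_smul _ _).symm, ?_⟩
      rw [hα, zero_smul, zero_add, smul_eq_zero] at hαβ
      rw [hαβ.resolve_left hβ, zero_smul]
    · refine ⟨T *ᵥ x, -(α⁻¹ * β), 1, ?_, (one_smul _ _).symm⟩
      rw [neg_smul, mul_smul, ← smul_neg, eq_inv_smul_iff₀ hα]
      exact eq_neg_of_add_eq_zero_left hαβ
  -- the generic point of the line through `x`: the elements of the coordinate ring that vanish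
  -- there form a homogeneous prime
  let K := FractionRing (Polynomial k)
  let y : Fin (N + 1) → K := fun i =>
    algebraMap (Polynomial k) K (Polynomial.C (x i) * Polynomial.X)
  have hy : ∀ q : MvPolynomial (Fin (N + 1)) k, MvPolynomial.aeval y q =
      algebraMap (Polynomial k) K
      (MvPolynomial.aeval (fun i => Polynomial.C (x i) * Polynomial.X) q) := fun q =>
    MvPolynomial.aeval_algebraMap_apply K _ q
  have hinj : Function.Injective (algebraMap (Polynomial k) K) := IsFractionRing.injective _ _
  have hSy : ∀ U : Matrix (Fin (N + 1)) (Fin (N + 1)) k,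
      U.map (algebraMap k K) *ᵥ y = fun i => algebraMap k K ((U *ᵥ x) i) *
        algebraMap (Polynomial k) K Polynomial.X := fun U => by
    funext i
    simp only [mulVec, dotProduct, y, map_mul, map_sum, Finset.sum_mul, Matrix.map_apply,
      IsScalarTower.algebraMap_apply k (Polynomial k) K, Polynomial.algebraMap_eq, mul_assoc]
  have hzero : ∀ {U : Matrix (Fin (N + 1)) (Fin (N + 1)) k},
      x ⬝ᵥ U *ᵥ x = 0 → MvPolynomial.aeval y (quadraticPolynomial U) = 0 := fun {U} hU => by
    have h0 : algebraMap k K (x ⬝ᵥ U *ᵥ x) = 0 := by rw [hU, map_zero]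
    rw [aeval_quadraticPolynomial, hSy]
    have h1 : ∀ i, y i = algebraMap k K (x i) * algebraMap (Polynomial k) K Polynomial.X :=
      fun i => by
        simp only [y, map_mul, IsScalarTower.algebraMap_apply k (Polynomial k) K,
          Polynomial.algebraMap_eq]
    simp only [dotProduct, h1, mul_mul_mul_comm, ← Finset.sum_mul, ← map_mul, ← map_sum]
    rw [show ∑ i, x i * (U *ᵥ x) i = 0 from hU, map_zero, zero_mul]
  have hmem : ∀ q ∈ (twoQuadricsIdeal _ _ h₁ h₂).toIdeal, ∃ a b, a * quadraticPolynomial S +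
      b * quadraticPolynomial T = q := fun q hq => Ideal.mem_span_pair.mp hq
  have hsmooth := hX.smooth
  have := le_relativeDimension_add_one (I := twoQuadricsIdeal _ _ h₁ h₂) (d := N - 2) (K := K)
    (y := y) ?_ ?_ ?_
    (∑ i, algebraMap k K (w i) • LinearMap.proj (R := K) (φ := fun _ : Fin (N + 1) => K) i) ?_
  · omega
  · obtain ⟨i, hi⟩ := Function.ne_iff.mp hx
    refine Function.ne_iff.mpr ⟨i, fun h => hi ?_⟩
    have := hinj (h.trans (map_zero _).symm)
    simpa using this
  · intro q hq d
    rw [hy, ← map_zero (algebraMap (Polynomial k) K)] at hq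
    rw [hy, aeval_C_mul_X_of_isHomogeneous (MvPolynomial.homogeneousComponent_isHomogeneous d q),
      ← coeff_aeval_C_mul_X, hinj hq, Polynomial.coeff_zero, map_zero, zero_mul, map_zero]
  · intro q hq
    obtain ⟨a, b, rfl⟩ := hmem q hq
    rw [map_add, map_mul, map_mul, hzero hSx, hzero hTx, mul_zero, mul_zero, add_zero]
  · intro q hq
    obtain ⟨a, b, rfl⟩ := hmem q hq
    refine ⟨2 * algebraMap (Polynomial k) K Polynomial.X * (MvPolynomial.aeval y a *
      algebraMap k K c + MvPolynomial.aeval y b * algebraMap k K d), fun v => ?_⟩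
    have hgrad : ∀ i, MvPolynomial.aeval y (MvPolynomial.pderiv i
        (a * quadraticPolynomial S + b * quadraticPolynomial T)) =
        2 * algebraMap (Polynomial k) K Polynomial.X * (MvPolynomial.aeval y a *
          algebraMap k K c + MvPolynomial.aeval y b * algebraMap k K d) * algebraMap k K (w i) :=
      fun i => by
        rw [map_add, Derivation.leibniz, Derivation.leibniz]
        simp only [map_add, map_mul, smul_eq_mul, hzero hSx, hzero hTx,
          aeval_pderiv_quadraticPolynomial hS, aeval_pderiv_quadraticPolynomial hT, hSy, hc, hd,
          Pi.smul_apply]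
        ring
    rw [LinearMap.sum_apply, Finset.mul_sum]
    refine Finset.sum_congr rfl fun i _ => ?_
    rw [hgrad, LinearMap.smul_apply, LinearMap.proj_apply, smul_eq_mul]
    ring

end SmoothPencil

/-! ### Orthogonal compressions of a diagonal form -/

section Cauchy

open Matrix

variable {k : Type*} [Field k] {n : ℕ} {ν : Fin (n + 1) → k} {μ : Fin n → k}

/-- Lagrange's formula for the top coefficient of a polynomial. -/
theorem sum_eval_mul_nodalWeight (hν : Function.Injective ν) {f : Polynomial k}
    (hf : f.natDegree ≤ n) :
    ∑ j, f.eval (ν j) * Lagrange.nodalWeight Finset.univ ν j = f.coeff n := by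
  have h := Lagrange.coeff_eq_sum (s := Finset.univ) (v := ν) hν.injOn (P := f) (by
    rw [Finset.card_univ, Fintype.card_fin]
    exact Polynomial.degree_lt_iff_coeff_zero _ _ |>.mpr fun m hm =>
      Polynomial.coeff_eq_zero_of_natDegree_lt (by omega))
  rw [Finset.card_univ, Fintype.card_fin, Nat.add_sub_cancel] at h
  rw [h]
  refine Finset.sum_congr rfl fun j _ => ?_
  rw [Lagrange.nodalWeight, Finset.prod_inv_distrib, div_eq_mul_inv]

theorem eval_nodal_erase {ι : Type*} [DecidableEq ι] {s : Finset ι} {v : ι → k} {i : ι}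
    (hi : i ∈ s) {x : k} (hx : x ≠ v i) :
    (Lagrange.nodal (s.erase i) v).eval x = (Lagrange.nodal s v).eval x / (x - v i) := by
  rw [eq_div_iff (sub_ne_zero.mpr hx), Lagrange.eval_nodal, Lagrange.eval_nodal, mul_comm,
    Finset.mul_prod_erase s (fun j => x - v j) hi]

/-- Given interlacing data without the reality conditions, `n + 1` distinct scalars `ν` and `n`
distinct scalars `μ` different from them, there is an orthonormal basis in which the compression of
`diag ν` to the span of the last `n` basis vectors is `diag μ`. The first basis vector `w` is
determined by `∑ w_j² / (ν_j - t) = ∏ (μ_i - t) / ∏ (ν_j - t)`. -/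
theorem exists_orthogonal_compression [IsAlgClosed k] (hν : Function.Injective ν)
    (hμ : Function.Injective μ) (hνμ : ∀ j i, ν j ≠ μ i) :
    ∃ O : Matrix (Fin (n + 1)) (Fin (n + 1)) k, Oᵀ * O = 1 ∧
      ∀ i i' : Fin n, (Oᵀ * diagonal ν * O) i.succ i'.succ = diagonal μ i i' := by
  -- `p j = ∏ (ν_j - μ_i) / ∏ (ν_j - ν_l)` will be the square of the `j`-th entry of `w`
  let W := Lagrange.nodalWeight Finset.univ ν
  let f (s : Finset (Fin n)) := Lagrange.nodal s μ
  have hfdeg : ∀ s : Finset (Fin n), (f s).natDegree = s.card := fun s => Lagrange.natDegree_nodal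
  let p (j : Fin (n + 1)) := (f Finset.univ).eval (ν j) * W j
  have hsum : ∀ s : Finset (Fin n), s ≠ Finset.univ → ∑ j, (f s).eval (ν j) * W j = 0 := by
    intro s hs
    have hcard : s.card < n := by
      simpa using Finset.card_lt_univ_of_notMem (Finset.eq_univ_iff_forall.not.mp hs
        |> not_forall.mp |>.choose_spec)
    rw [sum_eval_mul_nodalWeight hν (by rw [hfdeg]; omega)]
    exact Polynomial.coeff_eq_zero_of_natDegree_lt (by rw [hfdeg]; omega)
  -- Lagrange's formula for `∏ (t - μ_i)` and for the products without one or two of the factors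
  have h0 : ∑ j, p j = 1 := by
    rw [sum_eval_mul_nodalWeight hν (by rw [hfdeg, Finset.card_univ, Fintype.card_fin])]
    have := (Lagrange.nodal_monic (s := Finset.univ) (v := μ)).coeff_natDegree
    rwa [Lagrange.natDegree_nodal, Finset.card_univ, Fintype.card_fin] at this
  have h1 : ∀ i, ∑ j, p j / (ν j - μ i) = 0 := fun i => by
    rw [← hsum (Finset.univ.erase i) fun h => by simpa using congrArg (i ∈ ·) h]
    refine Finset.sum_congr rfl fun j _ => ?_
    rw [eval_nodal_erase (Finset.mem_univ i) (hνμ j i), mul_div_right_comm]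
  have h2 : ∀ i i', i ≠ i' → ∑ j, p j / ((ν j - μ i) * (ν j - μ i')) = 0 := fun i i' hii' => by
    rw [← hsum ((Finset.univ.erase i).erase i') fun h => by simpa using congrArg (i ∈ ·) h]
    refine Finset.sum_congr rfl fun j _ => ?_
    rw [eval_nodal_erase (Finset.mem_erase.mpr ⟨hii'.symm, Finset.mem_univ _⟩) (hνμ j i'),
      eval_nodal_erase (Finset.mem_univ i) (hνμ j i), div_div, mul_div_right_comm]
  -- the squared norms: up to a unit, the value at `μ i` of `∏ (t - μ_l)` without the factor
  -- `t - μ i`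
  have h3 : ∀ i, ∑ j, p j / ((ν j - μ i) * (ν j - μ i)) ≠ 0 := fun i => by
    have h4 := Lagrange.eval_interpolate_not_at_node (s := Finset.univ) (v := ν) (x := μ i)
      (fun j => (f (Finset.univ.erase i)).eval (ν j)) fun j _ => (hνμ j i).symm
    rw [← Lagrange.eq_interpolate hν.injOn (f := f (Finset.univ.erase i)) (by
      rw [Lagrange.degree_nodal, Nat.cast_lt, Finset.card_erase_of_mem (Finset.mem_univ i),
        Finset.card_univ, Finset.card_univ, Fintype.card_fin, Fintype.card_fin]
      omega)] at h4
    intro h5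
    have h6 : ∑ j, W j * (μ i - ν j)⁻¹ * (f (Finset.univ.erase i)).eval (ν j) = 0 := by
      rw [← neg_eq_zero, ← h5, ← Finset.sum_neg_distrib]
      refine Finset.sum_congr rfl fun j _ => ?_
      have h7 := sub_ne_zero.mpr (hνμ j i)
      have h8 := sub_ne_zero.mpr (hνμ j i).symm
      rw [eval_nodal_erase (Finset.mem_univ i) (hνμ j i)]
      change -(W j * _ * (_ / _)) = _ * W j / _
      field_simp
      ring
    rw [h6, mul_zero, Lagrange.eval_nodal, Finset.prod_eq_zero_iff] at h4
    obtain ⟨i', hi', h9⟩ := h4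
    exact (Finset.mem_erase.mp hi').1 (hμ (sub_eq_zero.mp h9)).symm
  choose w hw using fun j => IsAlgClosed.exists_pow_nat_eq (p j) (n := 2) two_pos
  choose c hc using fun i => IsAlgClosed.exists_pow_nat_eq
    (∑ j, p j / ((ν j - μ i) * (ν j - μ i)))⁻¹ (n := 2) two_pos
  -- the other basis vectors are proportional to `(diag ν - μ i)⁻¹ w`
  let O : Matrix (Fin (n + 1)) (Fin (n + 1)) k := of fun j =>
    Fin.cons (w j) fun i => c i * w j / (ν j - μ i)
  have hO0 : ∀ j, O j 0 = w j := fun j => rfl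
  have hOs : ∀ j i, O j (Fin.succ i) = c i * w j / (ν j - μ i) := fun j i => rfl
  have hdot : ∀ i i' : Fin n, ∑ j, O j i.succ * O j i'.succ = (1 : Matrix _ _ k) i i' := by
    intro i i'
    have h10 : ∑ j, O j i.succ * O j i'.succ =
        c i * c i' * ∑ j, p j / ((ν j - μ i) * (ν j - μ i')) := by
      rw [Finset.mul_sum]
      refine Finset.sum_congr rfl fun j _ => ?_
      rw [hOs, hOs, ← hw j, div_mul_div_comm]
      ring
    rw [h10, one_apply]
    split_ifs with hii'
    · rw [← hii', ← pow_two, hc, inv_mul_cancel₀ (h3 i)]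
    · rw [h2 i i' hii', mul_zero]
  have h0i : ∀ i : Fin n, ∑ j, O j 0 * O j i.succ = 0 := by
    intro i
    rw [← mul_zero (c i), ← h1 i, Finset.mul_sum]
    refine Finset.sum_congr rfl fun j _ => ?_
    rw [hOs, hO0, ← hw j]
    ring
  refine ⟨O, ?_, fun i i' => ?_⟩
  · ext a b
    rw [mul_apply]
    simp only [transpose_apply]
    refine Fin.cases ?_ (fun i => ?_) a <;> refine Fin.cases ?_ (fun i' => ?_) b
    · rw [one_apply_eq, ← h0]
      exact Finset.sum_congr rfl fun j _ => by rw [hO0, ← hw j, pow_two]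
    · rw [h0i, one_apply_ne (Fin.succ_ne_zero i').symm]
    · rw [one_apply_ne (Fin.succ_ne_zero i), ← h0i i]
      exact Finset.sum_congr rfl fun j _ => mul_comm _ _
    · rw [hdot, one_apply, one_apply]
      simp
  · have h10 : (Oᵀ * diagonal ν * O) i.succ i'.succ =
        c i * ∑ j, O j 0 * O j i'.succ + μ i * ∑ j, O j i.succ * O j i'.succ := by
      rw [mul_apply, Finset.mul_sum, Finset.mul_sum, ← Finset.sum_add_distrib]
      refine Finset.sum_congr rfl fun j _ => ?_
      have h7 := sub_ne_zero.mpr (hνμ j i)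
      rw [mul_diagonal, transpose_apply, hO0, hOs j i]
      field_simp
      ring
    rw [h10, h0i, mul_zero, zero_add, hdot, one_apply, diagonal_apply]
    split_ifs <;> simp

end Cauchy

/-! ### Clifford matrices -/

section Clifford

open Matrix

variable {k : Type*} [Field k]

/-- The two families of matrices `c` and `d` are the action of an orthonormal basis, indexed by `S`,
of a quadratic space on its half spinors: they satisfy the Clifford relations. -/
structure IsCliffordPair {S J : Type*} [DecidableEq S] [Fintype J] [DecidableEq J]
    (c d : S → Matrix J J k) : Prop where
  left : ∀ s t, c s * d t + c t * d s = (if s = t then 2 else 0 : k) • 1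
  right : ∀ s t, d s * c t + d t * c s = (if s = t then 2 else 0 : k) • 1

/-- The half spinors of a quadratic space of dimension `2n + 2` have dimension `2 ^ n`. -/
theorem exists_isCliffordPair_sum [IsAlgClosed k] (n : ℕ) :
    ∃ (S J : Type) (_ : Fintype S) (_ : DecidableEq S) (_ : Fintype J) (_ : DecidableEq J)
      (c d : S → Matrix J J k), Fintype.card S = 2 * n + 2 ∧ Fintype.card J = 2 ^ n ∧
      IsCliffordPair c d := by
  obtain ⟨r, hr⟩ := IsAlgClosed.exists_pow_nat_eq (-1 : k) (n := 2) two_pos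
  rw [pow_two] at hr
  induction n with
  | zero =>
    refine ⟨Bool, Unit, inferInstance, inferInstance, inferInstance, inferInstance,
      fun b => if b then 1 else r • 1, fun b => if b then 1 else (-r) • 1, rfl, rfl, ?_, ?_⟩ <;>
    · intro s t
      rw [← one_add_one_eq_two]
      cases s <;> cases t <;> simp [smul_smul, hr, add_smul]
  | succ n ih =>
    obtain ⟨S, J, _, _, _, _, c, d, hS, hJ, h⟩ := ih
    -- two new basis vectors exchange the two copies of the half spinors
    refine ⟨S ⊕ Bool, J ⊕ J, inferInstance, inferInstance, inferInstance, inferInstance,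
      Sum.elim (fun s => fromBlocks (c s) 0 0 (-d s))
        fun b => if b then fromBlocks 0 1 1 0 else fromBlocks 0 (r • 1) (-r • 1) 0,
      Sum.elim (fun s => fromBlocks (d s) 0 0 (-c s))
        fun b => if b then fromBlocks 0 1 1 0 else fromBlocks 0 (r • 1) (-r • 1) 0,
      by rw [Fintype.card_sum, hS, Fintype.card_bool]; ring,
      by rw [Fintype.card_sum, hJ]; ring, ?_, ?_⟩ <;>
    · have h1 : ∀ a : k, (a • 1 : Matrix (J ⊕ J) (J ⊕ J) k) = fromBlocks (a • 1) 0 0 (a • 1) :=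
        fun a => by rw [← fromBlocks_one, fromBlocks_smul, smul_zero]
      rintro (s | s) (t | t)
      · simp [fromBlocks_multiply, fromBlocks_add, h1, h.left, h.right]
      · cases t <;> simp [fromBlocks_multiply, fromBlocks_add]
      · cases s <;> simp [fromBlocks_multiply, fromBlocks_add]
      · have h2 : (1 + 1 : Matrix (J ⊕ J) (J ⊕ J) k) =
            fromBlocks ((2 : k) • 1) 0 0 ((2 : k) • 1) := by rw [← h1, two_smul]
        cases s <;> cases t <;>
          simp [fromBlocks_multiply, fromBlocks_add, smul_smul, hr, two_smul, h2]

theorem IsCliffordPair.symm {S J : Type*} [DecidableEq S] [Fintype J] [DecidableEq J]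
    {c d : S → Matrix J J k} (h : IsCliffordPair c d) : IsCliffordPair d c :=
  ⟨h.right, h.left⟩

/-- Clifford multiplication by the vector `h`, with coordinates in a `k`-algebra. -/
def cliffordMatrix {S J R : Type*} [Fintype S] [CommRing R] [Algebra k R] (c : S → Matrix J J k)
    (h : S → R) : Matrix J J R :=
  ∑ s, h s • (c s).map (algebraMap k R)

section

variable {S J R R' : Type*} [Fintype S] [CommRing R] [Algebra k R] [CommRing R'] [Algebra k R']
  (c : S → Matrix J J k)

theorem cliffordMatrix_apply (h : S → R) (i j : J) :
    cliffordMatrix c h i j = ∑ s, h s * algebraMap k R (c s i j) := by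
  simp [cliffordMatrix, Matrix.sum_apply]

theorem cliffordMatrix_map (f : R →ₐ[k] R') (h : S → R) :
    (cliffordMatrix c h).map f = cliffordMatrix c (f ∘ h) := by
  ext i j
  simp [cliffordMatrix_apply]

theorem cliffordMatrix_zero : cliffordMatrix c (0 : S → R) = 0 := by
  simp [cliffordMatrix]

variable {c} {d : S → Matrix J J k} [DecidableEq S] [Fintype J] [DecidableEq J]

theorem IsCliffordPair.mul_add_mul (H : IsCliffordPair c d) (h g : S → R) :
    cliffordMatrix c h * cliffordMatrix d g + cliffordMatrix c g * cliffordMatrix d h =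
      (2 * (h ⬝ᵥ g)) • 1 := by
  have h1 : ∀ u v : S → R, cliffordMatrix c u * cliffordMatrix d v =
      ∑ s, ∑ t, (u s * v t) • (c s * d t).map (algebraMap k R) := fun u v => by
    simp only [cliffordMatrix, Finset.sum_mul, Finset.mul_sum, smul_mul_smul_comm, Matrix.map_mul]
    exact Finset.sum_comm
  have h2 : ∀ s t, (c s * d t).map (algebraMap k R) + (c t * d s).map (algebraMap k R) =
      if s = t then 2 else 0 := fun s t => by
    rw [← Matrix.map_add _ (map_add _), H.left]
    split_ifs
    · rw [two_smul, ← one_add_one_eq_two, Matrix.map_add _ (map_add _),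
        Matrix.map_one _ (map_zero _) (map_one _)]
    · simp
  rw [h1, h1,
    Finset.sum_comm (s := Finset.univ) (t := Finset.univ) (f := fun s t => (g s * h t) • _),
    ← Finset.sum_add_distrib]
  simp_rw [← Finset.sum_add_distrib, mul_comm (g _), ← smul_add, h2]
  simp only [smul_ite, smul_zero, Finset.sum_ite_eq, Finset.mem_univ, if_true, ← Finset.sum_smul]
  rw [dotProduct, mul_comm, mul_smul, two_smul, one_add_one_eq_two]

theorem IsCliffordPair.mul_self (H : IsCliffordPair c d) (h2 : (2 : k) ≠ 0) (h : S → R) :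
    cliffordMatrix c h * cliffordMatrix d h = (h ⬝ᵥ h) • 1 := by
  have h3 := H.mul_add_mul h h
  rw [← two_smul R, mul_smul] at h3
  have h4 : IsUnit (2 : R) := by
    have h5 := (IsUnit.mk0 _ h2).map (algebraMap k R)
    rwa [map_ofNat] at h5
  exact h4.smul_left_cancel.mp h3

theorem IsCliffordPair.mul_add_mul_eq_zero (H : IsCliffordPair c d) {h g : S → R}
    (hg : h ⬝ᵥ g = 0) :
    cliffordMatrix c h * cliffordMatrix d g + cliffordMatrix c g * cliffordMatrix d h = 0 := by
  rw [H.mul_add_mul, hg, mul_zero, zero_smul]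

end

end Clifford

/-! ### Coprimality of diagonal forms -/

section RegularPair

variable {R R' : Type*} [CommRing R] [CommRing R']

/-- The elements `f, g` are nonzerodivisors, and they are coprime in the sense that the Koszul
complex on them is exact. -/
structure IsRegularPair (f g : R) : Prop where
  left : ∀ u, f * u = 0 → u = 0
  right : ∀ u, g * u = 0 → u = 0
  coprime : ∀ u v, f * u = g * v → ∃ h, u = g * h ∧ v = f * h

theorem IsRegularPair.map_ringEquiv {f g : R} (h : IsRegularPair f g) (e : R ≃+* R') :
    IsRegularPair (e f) (e g) where
  left u hu := by
    have := h.left (e.symm u) (e.injective (by simpa using hu))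
    simpa using this
  right u hu := by
    have := h.right (e.symm u) (e.injective (by simpa using hu))
    simpa using this
  coprime u v huv := by
    obtain ⟨w, hu, hv⟩ := h.coprime (e.symm u) (e.symm v) (e.injective (by simpa using huv))
    exact ⟨e w, by rw [← map_mul, ← hu, e.apply_symm_apply],
      by rw [← map_mul, ← hv, e.apply_symm_apply]⟩

end RegularPair

section DiagonalForms

open MvPolynomial

variable {k ι : Type*} [Field k]

/-- The quadratic form `∑ a_j X_j²` in the variables `X_j`, `j ∈ s`. -/
def diagonalForm (s : Finset ι) (a : ι → k) : MvPolynomial ι k := ∑ j ∈ s, C (a j) * X j ^ 2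

theorem degreeOf_diagonalForm {s : Finset ι} (a : ι → k) {i : ι} (hi : i ∉ s) :
    degreeOf i (diagonalForm s a) = 0 := by
  classical
  refine Nat.eq_zero_of_le_zero ((degreeOf_sum_le i s _).trans (Finset.sup_le fun j hj => ?_))
  have hij : i ≠ j := fun h => hi (h ▸ hj)
  refine (degreeOf_C_mul_le _ _ _).trans ?_
  rw [degreeOf_X_pow_of_ne _ hij]

theorem diagonalForm_ne_zero {s : Finset ι} {a : ι → k} {i : ι} (hi : i ∈ s) (ha : a i ≠ 0) :
    diagonalForm s a ≠ 0 := by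
  classical
  intro h
  have h1 := congrArg (eval (Pi.single i 1)) h
  rw [diagonalForm, map_sum, Finset.sum_eq_single i] at h1
  · simp [ha] at h1
  · intro j _ hj
    simp [hj]
  · exact fun h => (h hi).elim

/-- A common divisor of `∑ X_j²` and `∑ a_j X_j²` divides `∑ (a_j - a_i) X_j²`, which does not
involve `X_i`. Hence it involves no variable. -/
theorem isRelPrime_diagonalForm {s : Finset ι} {a : ι → k} (ha : Function.Injective a)
    (hs : 1 < s.card) : IsRelPrime (diagonalForm s 1) (diagonalForm s a) := by
  classical
  obtain ⟨i₀, hi₀, i₁, hi₁, hne⟩ := Finset.one_lt_card.mp hs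
  have h1 : diagonalForm s (1 : ι → k) ≠ 0 := diagonalForm_ne_zero hi₀ one_ne_zero
  intro p hp hq
  have hp0 : p ≠ 0 := fun h => h1 (zero_dvd_iff.mp (h ▸ hp))
  have hdeg : ∀ i, degreeOf i p = 0 := by
    intro i
    have hle : ∀ f : MvPolynomial ι k, f ≠ 0 → degreeOf i f = 0 → p ∣ f → degreeOf i p = 0 := by
      rintro _ hf hf' ⟨r, rfl⟩
      rw [degreeOf_mul_eq hp0 (right_ne_zero_of_mul hf)] at hf'
      omega
    by_cases hi : i ∈ s
    · have h2 : diagonalForm s a - C (a i) * diagonalForm s 1 =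
          diagonalForm (s.erase i) fun j => a j - a i := by
        rw [diagonalForm, diagonalForm, diagonalForm, Finset.mul_sum, ← Finset.sum_sub_distrib,
          ← Finset.add_sum_erase s _ hi]
        rw [Pi.one_apply, map_one, one_mul, sub_self, zero_add]
        refine Finset.sum_congr rfl fun j _ => ?_
        simp only [Pi.one_apply, map_one, map_sub]
        ring
      refine hle _ ?_ (degreeOf_diagonalForm _ (Finset.notMem_erase i s))
        (h2 ▸ dvd_sub hq (hp.mul_left _))
      obtain ⟨j, hj, hji⟩ := Finset.exists_mem_ne hs i
      exact diagonalForm_ne_zero (Finset.mem_erase.mpr ⟨hji, hj⟩) (sub_ne_zero.mpr (ha.ne hji))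
    · exact hle _ h1 (degreeOf_diagonalForm _ hi) hp
  have hvars : p.vars = ∅ := Finset.eq_empty_of_forall_notMem fun i hi => by
    rw [vars_def, Multiset.mem_toFinset, ← Multiset.count_pos, ← degreeOf_def, hdeg] at hi
    exact hi.false
  have hC := vars_eq_empty_iff_eq_C.mp hvars
  rw [hC]
  exact (IsUnit.mk0 _ fun h => hp0 (by rw [hC, h, map_zero])).map C

/-- Setting the variables in `s` equal to zero. -/
def killVariables (k : Type*) [Field k] (s : Finset ι) [DecidableEq ι] :
    MvPolynomial ι k →ₐ[k] MvPolynomial ι k :=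
  aeval fun j => if j ∈ s then 0 else X j

variable [DecidableEq ι]

theorem sub_killVariables_mem (s : Finset ι) (u : MvPolynomial ι k) :
    u - killVariables k s u ∈ Ideal.span (X '' (s : Set ι) : Set (MvPolynomial ι k)) := by
  rw [← Ideal.Quotient.eq]
  change (Ideal.Quotient.mkₐ k _) u = ((Ideal.Quotient.mkₐ k _).comp (killVariables k s)) u
  congr 1
  refine algHom_ext fun j => ?_
  rw [AlgHom.comp_apply, killVariables, aeval_X]
  split_ifs with hj
  · rw [map_zero]
    exact Ideal.Quotient.eq_zero_iff_mem.mpr (Ideal.subset_span ⟨j, hj, rfl⟩)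
  · rfl

theorem killVariables_eq_zero_iff {s : Finset ι} {u : MvPolynomial ι k} :
    killVariables k s u = 0 ↔ u ∈ Ideal.span (X '' (s : Set ι) : Set (MvPolynomial ι k)) := by
  refine ⟨fun h => by simpa [h] using sub_killVariables_mem s u, fun h => ?_⟩
  suffices h1 : Ideal.span (X '' (s : Set ι)) ≤ RingHom.ker (killVariables k s) from h1 h
  rw [Ideal.span_le]
  rintro _ ⟨j, hj, rfl⟩
  exact (aeval_X _ _).trans (if_pos hj)

theorem killVariables_killVariables (s : Finset ι) (u : MvPolynomial ι k) :
    killVariables k s (killVariables k s u) = killVariables k s u := by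
  have := killVariables_eq_zero_iff.mpr (sub_killVariables_mem s u)
  rw [map_sub, sub_eq_zero] at this
  exact this.symm

theorem killVariables_diagonalForm [Fintype ι] (s : Finset ι) (a : ι → k) :
    killVariables k s (diagonalForm Finset.univ a) = diagonalForm sᶜ a := by
  rw [diagonalForm, diagonalForm, map_sum, ← Finset.sum_compl_add_sum s]
  rw [Finset.sum_eq_zero (s := s), add_zero]
  · refine Finset.sum_congr rfl fun j hj => ?_
    rw [Finset.mem_compl] at hj
    simp [killVariables, hj]
  · intro j hj
    simp [killVariables, hj]

theorem isPrime_span_X_image (s : Finset ι) :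
    (Ideal.span (X '' (s : Set ι) : Set (MvPolynomial ι k))).IsPrime := by
  have : Ideal.span (X '' (s : Set ι) : Set (MvPolynomial ι k)) =
      RingHom.ker (killVariables k s) := by
    ext u
    exact killVariables_eq_zero_iff.symm
  rw [this]
  exact RingHom.ker_isPrime _

/-- Modulo some of the variables the two forms are diagonal forms in the remaining ones. They are
coprime as long as two variables remain. -/
theorem isRegularPair_diagonalForm_mod [Fintype ι] {a : ι → k} (ha : Function.Injective a)
    {s : Finset ι} (hs : s.card + 2 ≤ Fintype.card ι) :
    IsRegularPair
      (Ideal.Quotient.mk (Ideal.span (X '' (s : Set ι))) (diagonalForm Finset.univ (1 : ι → k)))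
      (Ideal.Quotient.mk (Ideal.span (X '' (s : Set ι))) (diagonalForm Finset.univ a)) := by
  have hc : 1 < sᶜ.card := by
    rw [Finset.card_compl]
    omega
  have hrel := isRelPrime_diagonalForm ha hc
  obtain ⟨i₀, hi₀, i₁, hi₁, hne⟩ := Finset.one_lt_card.mp hc
  have h1 : diagonalForm sᶜ (1 : ι → k) ≠ 0 := diagonalForm_ne_zero hi₀ one_ne_zero
  have h2 : diagonalForm sᶜ a ≠ 0 := by
    by_cases h : a i₀ = 0
    · exact diagonalForm_ne_zero hi₁ fun h' => hne (ha (h.trans h'.symm))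
    · exact diagonalForm_ne_zero hi₀ h
  refine ⟨fun u hu => ?_, fun u hu => ?_, fun u v huv => ?_⟩
  · obtain ⟨u, rfl⟩ := Ideal.Quotient.mk_surjective u
    rw [← map_mul, Ideal.Quotient.eq_zero_iff_mem, ← killVariables_eq_zero_iff, map_mul,
      killVariables_diagonalForm] at hu
    rw [Ideal.Quotient.eq_zero_iff_mem, ← killVariables_eq_zero_iff]
    exact (mul_eq_zero.mp hu).resolve_left h1
  · obtain ⟨u, rfl⟩ := Ideal.Quotient.mk_surjective u
    rw [← map_mul, Ideal.Quotient.eq_zero_iff_mem, ← killVariables_eq_zero_iff, map_mul,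
      killVariables_diagonalForm] at hu
    rw [Ideal.Quotient.eq_zero_iff_mem, ← killVariables_eq_zero_iff]
    exact (mul_eq_zero.mp hu).resolve_left h2
  · obtain ⟨u, rfl⟩ := Ideal.Quotient.mk_surjective u
    obtain ⟨v, rfl⟩ := Ideal.Quotient.mk_surjective v
    rw [← map_mul, ← map_mul, Ideal.Quotient.eq, ← killVariables_eq_zero_iff, map_sub, map_mul,
      map_mul, killVariables_diagonalForm, killVariables_diagonalForm, sub_eq_zero] at huv
    obtain ⟨h, hh⟩ := hrel.symm.dvd_of_dvd_mul_left (Dvd.intro _ huv.symm)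
    have hv : killVariables k s v = diagonalForm sᶜ 1 * h := by
      rw [hh, mul_left_comm] at huv
      exact (mul_left_cancel₀ h2 huv).symm
    refine ⟨Ideal.Quotient.mk _ h, ?_, ?_⟩
    · rw [← map_mul, Ideal.Quotient.eq, ← killVariables_eq_zero_iff, map_sub, map_mul,
        killVariables_diagonalForm, ← killVariables_killVariables, hh, map_mul,
        ← killVariables_diagonalForm, killVariables_killVariables, sub_self]
    · rw [← map_mul, Ideal.Quotient.eq, ← killVariables_eq_zero_iff, map_sub, map_mul,
        killVariables_diagonalForm, ← killVariables_killVariables, hv, map_mul,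
        ← killVariables_diagonalForm, killVariables_killVariables, sub_self]

end DiagonalForms

/-! ### Anticommuting matrix factorizations -/

section Quadruple

open Matrix

variable {R R' J : Type*} [CommRing R] [CommRing R']

theorem IsRegularPair.exists_smul_eq {f g : R} (h : IsRegularPair f g) {u v : J → R}
    (huv : f • u = g • v) : ∃ w, u = g • w ∧ v = f • w := by
  choose w hw using fun j => h.coprime (u j) (v j) (congrFun huv j)
  exact ⟨w, funext fun j => (hw j).1, funext fun j => (hw j).2⟩

variable [Fintype J] [DecidableEq J]

/-- Two matrix factorizations `(A, C)` of `f` and `(B, D)` of `g` that anticommute. For the Clifford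
matrices of two orthogonal vectors, `f` and `g` are the values of the quadratic form. -/
structure IsAnticommutingFactorization (f g : R) (A B C D : Matrix J J R) : Prop where
  mul_AC : A * C = f • 1
  mul_CA : C * A = f • 1
  mul_BD : B * D = g • 1
  mul_DB : D * B = g • 1
  mul_AD : A * D + B * C = 0
  mul_CB : C * B + D * A = 0

namespace IsAnticommutingFactorization

variable {f g : R} {A B C D : Matrix J J R} {u v w p q r s : J → R}

theorem symm (H : IsAnticommutingFactorization f g A B C D) :
    IsAnticommutingFactorization f g C D A B :=
  ⟨H.mul_CA, H.mul_AC, H.mul_DB, H.mul_BD, H.mul_CB, H.mul_AD⟩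

theorem swap (H : IsAnticommutingFactorization f g A B C D) :
    IsAnticommutingFactorization g f B A D C :=
  ⟨H.mul_BD, H.mul_DB, H.mul_AC, H.mul_CA, by rw [add_comm, H.mul_AD],
    by rw [add_comm, H.mul_CB]⟩

theorem map (H : IsAnticommutingFactorization f g A B C D)
    (φ : R →+* R') : IsAnticommutingFactorization (φ f) (φ g) (A.map φ) (B.map φ)
    (C.map φ) (D.map φ) := by
  have h1 : ∀ a : R, (a • (1 : Matrix J J R)).map φ = φ a • 1 := fun a => by
    rw [Matrix.map_smul' _ a _ (map_mul φ), Matrix.map_one _ (map_zero φ) (map_one φ)]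
  constructor
  · rw [← Matrix.map_mul, H.mul_AC, h1]
  · rw [← Matrix.map_mul, H.mul_CA, h1]
  · rw [← Matrix.map_mul, H.mul_BD, h1]
  · rw [← Matrix.map_mul, H.mul_DB, h1]
  · rw [← Matrix.map_mul, ← Matrix.map_mul, ← Matrix.map_add _ (map_add φ), H.mul_AD,
      Matrix.map_zero _ (map_zero φ)]
  · rw [← Matrix.map_mul, ← Matrix.map_mul, ← Matrix.map_add _ (map_add φ), H.mul_CB,
      Matrix.map_zero _ (map_zero φ)]

theorem AC_mulVec (H : IsAnticommutingFactorization f g A B C D) : A *ᵥ C *ᵥ u = f • u := by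
  rw [mulVec_mulVec, H.mul_AC, smul_mulVec, one_mulVec]

theorem AD_mulVec (H : IsAnticommutingFactorization f g A B C D) :
    A *ᵥ D *ᵥ u = -(B *ᵥ C *ᵥ u) := by
  rw [mulVec_mulVec, mulVec_mulVec, ← neg_mulVec, ← eq_neg_of_add_eq_zero_left H.mul_AD]

theorem eq_zero_of_mulVec (H : IsAnticommutingFactorization f g A B C D)
    (hfg : IsRegularPair f g) (h : D *ᵥ u = 0) : u = 0 := by
  have h1 := H.symm.swap.symm.AC_mulVec (u := u)
  rw [h, mulVec_zero] at h1
  exact funext fun j => hfg.right _ (congrFun h1.symm j)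

/-- The complex `R^J → R^J ⊕ R^J → R^J` with maps `(D, C)` and `(A, B)` is exact in the middle. -/
theorem exact (H : IsAnticommutingFactorization f g A B C D)
    (hfg : IsRegularPair f g) (h : A *ᵥ u + B *ᵥ v = 0) :
    ∃ w, u = D *ᵥ w ∧ v = C *ᵥ w := by
  have h1 : f • u = D *ᵥ A *ᵥ v := by
    rw [← H.symm.AC_mulVec, eq_neg_of_add_eq_zero_left h, mulVec_neg, H.symm.swap.AD_mulVec]
  have h2 : f • B *ᵥ u = g • A *ᵥ v := by
    rw [← mulVec_smul, h1, H.swap.AC_mulVec]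
  obtain ⟨w, hu, hv⟩ := hfg.exists_smul_eq h2
  refine ⟨w, ?_, ?_⟩
  · have h3 : g • (u - D *ᵥ w) = 0 := by
      rw [smul_sub, ← H.swap.symm.AC_mulVec, hu, mulVec_smul, sub_self]
    exact sub_eq_zero.mp (funext fun j => hfg.right _ (congrFun h3 j))
  · have h3 : f • (v - C *ᵥ w) = 0 := by
      rw [smul_sub, ← H.symm.AC_mulVec, hv, mulVec_smul, sub_self]
    exact sub_eq_zero.mp (funext fun j => hfg.left _ (congrFun h3 j))

/-- The kernel of `B C` modulo `(f, g)` is the image of `(A, B)`. -/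
theorem exists_eq_of_BC_mulVec (H : IsAnticommutingFactorization f g A B C D)
    (hfg : IsRegularPair f g)
    (h : B *ᵥ C *ᵥ w = f • p + g • q) : ∃ u v, w = A *ᵥ u + B *ᵥ v := by
  have h1 : f • D *ᵥ p = g • (C *ᵥ w - D *ᵥ q) := by
    have h2 := congrArg (D *ᵥ ·) h
    simp only [H.swap.symm.AC_mulVec, mulVec_add, mulVec_smul] at h2
    rw [smul_sub, h2, add_sub_cancel_right]
  obtain ⟨h, hp, hq⟩ := hfg.exists_smul_eq h1
  have h3 : C *ᵥ (w - A *ᵥ h) + D *ᵥ (-q) = 0 := by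
    rw [mulVec_sub, H.symm.AC_mulVec, ← hq, mulVec_neg]
    abel
  obtain ⟨x, hx, -⟩ := H.symm.exact hfg h3
  exact ⟨h, x, by rw [← hx]; abel⟩

/-- A vector killed by `C` and `D` modulo `(f, g)` is in the image of `B C` modulo `(f, g)`. -/
theorem exists_eq_BC_mulVec (H : IsAnticommutingFactorization f g A B C D)
    (hfg : IsRegularPair f g) (hC : C *ᵥ w = f • p + g • q)
    (hD : D *ᵥ w = f • r + g • s) : ∃ x y z, w = B *ᵥ C *ᵥ x + f • y + g • z := by
  have h1 : f • (w - A *ᵥ p) = g • A *ᵥ q := by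
    rw [smul_sub, ← H.AC_mulVec, hC, mulVec_add, mulVec_smul, mulVec_smul, add_sub_cancel_left]
  have h2 : f • B *ᵥ r = g • (w - B *ᵥ s) := by
    rw [smul_sub, ← H.swap.AC_mulVec (u := w), hD, mulVec_add, mulVec_smul, mulVec_smul,
      add_sub_cancel_right]
  obtain ⟨h, hp, -⟩ := hfg.exists_smul_eq h1
  obtain ⟨h', -, hs⟩ := hfg.exists_smul_eq h2
  have h3 : A *ᵥ (p - C *ᵥ h') + B *ᵥ (D *ᵥ h - s) = 0 := by
    rw [mulVec_sub, mulVec_sub, H.AC_mulVec, H.swap.AC_mulVec, ← hp, ← hs]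
    abel
  obtain ⟨x, hx, -⟩ := H.exact hfg h3
  refine ⟨-x, h', h, ?_⟩
  rw [mulVec_neg, mulVec_neg, ← H.AD_mulVec, ← hx, mulVec_sub, H.AC_mulVec, ← hp]
  abel

/-- If the complex of `(A, B)` stays exact modulo `θ`, then `θ` is regular on its cokernel. -/
theorem exists_sub_mem (H : IsAnticommutingFactorization f g A B C D)
    (I : Ideal R) {θ : R} (hθ : ∀ a, θ * a ∈ I → a ∈ I)
    (hfg : IsRegularPair (Ideal.Quotient.mk (I ⊔ Ideal.span {θ}) f)
      (Ideal.Quotient.mk (I ⊔ Ideal.span {θ}) g))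
    (h : ∀ j, θ * w j - (A *ᵥ u + B *ᵥ v) j ∈ I) :
    ∃ u' v', ∀ j, w j - (A *ᵥ u' + B *ᵥ v') j ∈ I := by
  let φ := Ideal.Quotient.mk (I ⊔ Ideal.span {θ})
  have hφ : ∀ (M : Matrix J J R) (x : J → R), M.map φ *ᵥ (φ ∘ x) = φ ∘ (M *ᵥ x) := fun M x =>
    funext fun i => (RingHom.map_mulVec φ M x i).symm
  have h1 : A.map φ *ᵥ (φ ∘ u) + B.map φ *ᵥ (φ ∘ v) = 0 := by
    rw [hφ, hφ]
    funext j
    have h2 : (A *ᵥ u + B *ᵥ v) j ∈ I ⊔ Ideal.span {θ} := by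
      have h3 := sub_mem (Ideal.mul_mem_right (w j)
        _ (Ideal.mem_sup_right (Ideal.mem_span_singleton_self θ))) (Ideal.mem_sup_left (h j))
      rwa [sub_sub_cancel] at h3
    exact (map_add φ _ _).symm.trans (Ideal.Quotient.eq_zero_iff_mem.mpr h2)
  obtain ⟨x, hu, hv⟩ := (H.map φ).exact hfg h1
  obtain ⟨x, rfl⟩ : ∃ y, x = φ ∘ y :=
    ⟨fun j => (x j).out, funext fun j => (Ideal.Quotient.mk_out (x j)).symm⟩
  rw [hφ] at hu hv
  have key : ∀ a b : J → R, φ ∘ a = φ ∘ b → ∃ c d : J → R, (∀ j, c j ∈ I) ∧ a = b + c + θ • d := by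
    intro a b hab
    have h3 : ∀ j, ∃ c d, c ∈ I ∧ a j = b j + c + θ * d := fun j => by
      obtain ⟨c, hc, y, hy, hcy⟩ := Submodule.mem_sup.mp (Ideal.Quotient.eq.mp (congrFun hab j))
      obtain ⟨d, rfl⟩ := Ideal.mem_span_singleton.mp hy
      exact ⟨c, d, hc, by rw [add_assoc, hcy]; ring⟩
    choose c d hc hd using h3
    exact ⟨c, d, hc, funext hd⟩
  obtain ⟨c, u', hc, rfl⟩ := key _ _ hu
  obtain ⟨d, v', hd, rfl⟩ := key _ _ hv
  refine ⟨u', v', fun j => hθ _ ?_⟩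
  have h4 : ∀ (M : Matrix J J R) (x : J → R), (∀ j, x j ∈ I) → (M *ᵥ x) j ∈ I := fun M x hx =>
    sum_mem fun i _ => Ideal.mul_mem_left _ _ (hx i)
  have h5 : A *ᵥ (D *ᵥ x + c + θ • u') + B *ᵥ (C *ᵥ x + d + θ • v') =
      A *ᵥ c + B *ᵥ d + θ • (A *ᵥ u' + B *ᵥ v') := by
    rw [mulVec_add, mulVec_add, mulVec_add, mulVec_add, H.AD_mulVec, mulVec_smul, mulVec_smul,
      smul_add]
    abel
  have h6 := add_mem (h j) (add_mem (h4 A c hc) (h4 B d hd))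
  rw [h5] at h6
  convert h6 using 1
  simp only [Pi.add_apply, Pi.smul_apply, smul_eq_mul]
  ring

end IsAnticommutingFactorization

/-- If `f, g` is a regular pair modulo `I` and `θ`, then `θ` is regular modulo `I` and `(f, g)`. -/
theorem IsRegularPair.exists_sub_mem {f g : R} (I : Ideal R) {θ w u v : R}
    (hθ : ∀ a, θ * a ∈ I → a ∈ I)
    (hfg : IsRegularPair (Ideal.Quotient.mk (I ⊔ Ideal.span {θ}) f)
      (Ideal.Quotient.mk (I ⊔ Ideal.span {θ}) g))
    (h : θ * w - (f * u + g * v) ∈ I) : ∃ u' v', w - (f * u' + g * v') ∈ I := by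
  let φ := Ideal.Quotient.mk (I ⊔ Ideal.span {θ})
  have h1 : φ f * φ u = φ g * φ (-v) := by
    rw [← map_mul, ← map_mul, Ideal.Quotient.eq]
    have h3 := sub_mem (Ideal.mul_mem_right w
      _ (Ideal.mem_sup_right (Ideal.mem_span_singleton_self θ))) (Ideal.mem_sup_left h)
    rw [sub_sub_cancel] at h3
    convert h3 using 1
    ring
  obtain ⟨x, hu, hv⟩ := hfg.coprime _ _ h1
  obtain ⟨x, rfl⟩ := Ideal.Quotient.mk_surjective x
  rw [← map_mul, Ideal.Quotient.eq] at hu hv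
  obtain ⟨c, hc, y, hy, hcy⟩ := Submodule.mem_sup.mp hu
  obtain ⟨u', rfl⟩ := Ideal.mem_span_singleton.mp hy
  obtain ⟨d, hd, y, hy, hdy⟩ := Submodule.mem_sup.mp hv
  obtain ⟨v', rfl⟩ := Ideal.mem_span_singleton.mp hy
  refine ⟨u', -v', hθ _ ?_⟩
  have h6 := add_mem h (sub_mem (Ideal.mul_mem_left I f hc) (Ideal.mul_mem_left I g hd))
  convert h6 using 1
  linear_combination g * hdy - f * hcy

end Quadruple

/-! ### Regular sequences and dimension -/

section Dimension

open Module RingTheory.Sequence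

theorem length_le_supportDim_of_isRegular {R M : Type*} [CommRing R] [IsNoetherianRing R]
    [AddCommGroup M] [Module R M] [Module.Finite R M] {rs : List R} (h : IsRegular M rs) :
    (rs.length : WithBot ℕ∞) ≤ supportDim R M := by
  induction rs generalizing M with
  | nil =>
    have := h.nontrivial
    have h0 := (supportDim_ne_bot_iff_nontrivial R M).mpr this
    obtain ⟨d, hd⟩ := WithBot.ne_bot_iff_exists.mp h0
    rw [← hd]
    exact WithBot.coe_le_coe.mpr zero_le
  | cons r rs ih =>
    rw [isRegular_cons_iff] at h
    have h1 := supportDim_quotSMulTop_succ_le_of_notMem_minimalPrimes (x := r) (M := M)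
      fun _ => h.1.notMem_of_mem_minimalPrimes
    refine le_trans ?_ h1
    rw [List.length_cons, Nat.cast_add, Nat.cast_one]
    gcongr
    exact ih h.2

theorem length_le_ringKrullDim_of_isRegular {R M : Type*} [CommRing R] [IsNoetherianRing R]
    [AddCommGroup M] [Module R M] [Module.Finite R M] {rs : List R} (h : IsRegular M rs) :
    (rs.length : WithBot ℕ∞) ≤ ringKrullDim R :=
  (length_le_supportDim_of_isRegular h).trans (supportDim_le_ringKrullDim R M)

theorem IsRegularPair.ringKrullDim_quotient_add_two_le {R : Type*} [CommRing R] {f g : R}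
    (h : IsRegularPair f g) {I : Ideal R} (hf : f ∈ I) (hg : g ∈ I) :
    ringKrullDim (R ⧸ I) + 1 + 1 ≤ ringKrullDim R := by
  have h1 : ringKrullDim (R ⧸ Ideal.span {f}) + 1 ≤ ringKrullDim R :=
    ringKrullDim_quotient_succ_le_of_nonZeroDivisor (mem_nonZeroDivisors_iff_left.mpr h.left)
  refine le_trans (add_le_add_left ?_ 1) h1
  have hle : Ideal.span {f} ≤ I := (Ideal.span_singleton_le_iff_mem I).mpr hf
  refine ringKrullDim_succ_le_of_surjective (Ideal.Quotient.factor hle)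
    (Ideal.Quotient.factor_surjective hle) (r := Ideal.Quotient.mk _ g)
    (mem_nonZeroDivisors_iff_left.mpr fun u hu => ?_) ?_
  · obtain ⟨u, rfl⟩ := Ideal.Quotient.mk_surjective u
    rw [← map_mul, Ideal.Quotient.eq_zero_iff_mem] at hu
    obtain ⟨v, hv⟩ := Ideal.mem_span_singleton.mp hu
    obtain ⟨w, -, hw⟩ := h.coprime v u hv.symm
    rw [hw, Ideal.Quotient.eq_zero_iff_mem]
    exact Ideal.mul_mem_right _ _ (Ideal.mem_span_singleton_self f)
  · rw [Ideal.Quotient.factor_mk]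
    exact Ideal.Quotient.eq_zero_iff_mem.mpr hg

end Dimension

/-! ### Regular sequences on the cokernel -/

section Cokernel

open Matrix RingTheory.Sequence

variable {R J X : Type*} [CommRing R] [Fintype J] [DecidableEq J] [AddCommGroup X] [Module R X]

theorem mem_ideal_smul_top_pi (I : Ideal R) (y : J → R) :
    y ∈ (I • ⊤ : Submodule R (J → R)) ↔ ∀ j, y j ∈ I := by
  constructor
  · intro h j
    exact Submodule.smul_induction_on (p := fun y => y j ∈ I) h
      (fun r hr x _ => Ideal.mul_mem_right _ _ hr) fun x y hx hy => add_mem hx hy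
  · intro h
    rw [pi_eq_sum_univ' y]
    exact sum_mem fun j _ => Submodule.smul_mem_smul (h j) trivial

/-- A regular sequence on the cokernel of `(A, B)`: the quotient map is `π`. -/
theorem IsAnticommutingFactorization.isRegular [Nonempty J] {f g : R} {A B C D : Matrix J J R}
    (H : IsAnticommutingFactorization f g A B C D) (π : (J → R) →ₗ[R] X)
    (hπ : Function.Surjective π) (hker : ∀ w, π w = 0 ↔ ∃ u v, w = A *ᵥ u + B *ᵥ v) {rs : List R}
    (hreg : ∀ i (h : i < rs.length), ∀ a, rs[i] * a ∈ Ideal.ofList (rs.take i) →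
      a ∈ Ideal.ofList (rs.take i))
    (hpair : ∀ i (h : i < rs.length),
      IsRegularPair (Ideal.Quotient.mk (Ideal.ofList (rs.take i) ⊔ Ideal.span {rs[i]}) f)
        (Ideal.Quotient.mk (Ideal.ofList (rs.take i) ⊔ Ideal.span {rs[i]}) g))
    {K : Ideal R} (hK : K ≠ ⊤) (hrs : ∀ r ∈ rs, r ∈ K) (hA : ∀ i j, A i j ∈ K)
    (hB : ∀ i j, B i j ∈ K) : IsRegular X rs := by
  have hmap : ∀ (I : Ideal R) (w : J → R), π w ∈ (I • ⊤ : Submodule R X) →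
      ∃ y u v, (∀ j, y j ∈ I) ∧ w = y + (A *ᵥ u + B *ᵥ v) := by
    intro I w hw
    rw [← LinearMap.range_eq_top.mpr hπ, ← Submodule.map_top, ← Submodule.map_smul''] at hw
    obtain ⟨y, hy, hyw⟩ := hw
    obtain ⟨u, v, huv⟩ := (hker (w - y)).mp (by rw [map_sub, hyw, sub_self])
    exact ⟨y, u, v, (mem_ideal_smul_top_pi I y).mp hy, by rw [← huv]; abel⟩
  refine ⟨⟨fun i hi => ?_⟩, fun htop => ?_⟩
  · rw [isSMulRegular_iff_right_eq_zero_of_smul]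
    intro x hx
    obtain ⟨x, rfl⟩ := Submodule.Quotient.mk_surjective _ x
    obtain ⟨w, rfl⟩ := hπ x
    rw [← Submodule.Quotient.mk_smul, ← map_smul, Submodule.Quotient.mk_eq_zero] at hx
    obtain ⟨y, u, v, hy, hw⟩ := hmap _ _ hx
    obtain ⟨u', v', h⟩ := H.exists_sub_mem (w := w) (u := u) (v := v) _ (hreg i hi) (hpair i hi)
      fun j => by
        have := congrFun hw j
        rw [Pi.smul_apply, smul_eq_mul, Pi.add_apply] at this
        rw [this, add_sub_cancel_right]
        exact hy j
    rw [Submodule.Quotient.mk_eq_zero, ← sub_add_cancel w (A *ᵥ u' + B *ᵥ v'), map_add,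
      (hker (A *ᵥ u' + B *ᵥ v')).mpr ⟨u', v', rfl⟩, add_zero, ← LinearMap.range_eq_top.mpr hπ,
      ← Submodule.map_top, ← Submodule.map_smul'']
    exact Submodule.mem_map_of_mem ((mem_ideal_smul_top_pi _ _).mpr h)
  · obtain ⟨j⟩ := ‹Nonempty J›
    obtain ⟨y, u, v, hy, hw⟩ := hmap _ (Pi.single j 1) (htop ▸ Submodule.mem_top)
    refine hK ((Ideal.eq_top_iff_one K).mpr ?_)
    have h1 := congrFun hw j
    rw [Pi.single_eq_same] at h1
    rw [h1]
    refine add_mem (Ideal.span_le.mpr hrs (hy j)) (add_mem ?_ ?_) <;>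
    exact sum_mem fun i _ => Ideal.mul_mem_right _ _ (by simp only [hA, hB])

end Cokernel

/-! ### The linear resolution -/

section Resolution

open Matrix

variable {k : Type u} [Field k] {σ J : Type} [Fintype J] [DecidableEq J] {X : Type u}
  [AddCommGroup X] [Module (MvPolynomial σ k) X]

/-- The complex with maps `(D, C)` and `(A, B)` is a linear free resolution. -/
theorem IsAnticommutingFactorization.hasLinearFreeResolution {f g : MvPolynomial σ k}
    {A B C D : Matrix J J (MvPolynomial σ k)} (H : IsAnticommutingFactorization f g A B C D)
    (hfg : IsRegularPair f g) (hA : ∀ i j, (A i j).IsHomogeneous 1)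
    (hB : ∀ i j, (B i j).IsHomogeneous 1) (hC : ∀ i j, (C i j).IsHomogeneous 1)
    (hD : ∀ i j, (D i j).IsHomogeneous 1) (π : (J → MvPolynomial σ k) →ₗ[MvPolynomial σ k] X)
    (hπ : Function.Surjective π) (hker : ∀ w, π w = 0 ↔ ∃ u v, w = A *ᵥ u + B *ᵥ v)
    {X₀ : AddSubgroup X} (h₀ : ∀ j, π (Pi.single j 1) ∈ X₀) :
    HasLinearFreeResolution (k := k) (σ := σ) X X₀ := by
  let eJ : Fin (Fintype.card J) ≃ J := (Fintype.equivFin J).symm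
  let eL : Fin (Fintype.card J + Fintype.card J) ≃ J ⊕ J :=
    finSumFinEquiv.symm.trans (eJ.sumCongr eJ)
  -- the Betti numbers are `|J|, 2 |J|, |J|, 0, …`
  let b : ℕ → ℕ
    | 0 => Fintype.card J
    | 1 => Fintype.card J + Fintype.card J
    | 2 => Fintype.card J
    | _ => 0
  let φ : ∀ i, Matrix (Fin (b i)) (Fin (b (i + 1))) (MvPolynomial σ k)
    | 0 => (fromCols A B).submatrix eJ eL
    | 1 => (fromRows D C).submatrix eL eJ
    | _ + 2 => 0
  have he : ∀ w : Fin (Fintype.card J) → MvPolynomial σ k,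
      Fintype.linearCombination (MvPolynomial σ k) (fun j => π (Pi.single (eJ j) 1)) w =
        π (w ∘ eJ.symm) := by
    intro w
    rw [Fintype.linearCombination_apply, pi_eq_sum_univ' (w ∘ eJ.symm), map_sum,
      ← Equiv.sum_comp eJ]
    refine Finset.sum_congr rfl fun j _ => ?_
    rw [← map_smul, Function.comp_apply, eJ.symm_apply_apply]
  have hcols : ∀ u : J ⊕ J → MvPolynomial σ k,
      fromCols A B *ᵥ u = A *ᵥ (u ∘ Sum.inl) + B *ᵥ (u ∘ Sum.inr) := fun u => by
    rw [← Sum.elim_comp_inl_inr u, fromCols_mulVec_sumElim, Sum.elim_comp_inl, Sum.elim_comp_inr]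
  refine ⟨b, fun j => π (Pi.single (eJ j) 1), φ, fun j => h₀ _, ?_, ?_, ?_, ?_⟩
  · rintro (_ | _ | i) r c
    · change ((fromCols A B) (eJ r) (eL c)).IsHomogeneous 1
      rcases eL c with c | c
      · exact hA _ _
      · exact hB _ _
    · change ((fromRows D C) (eL r) (eJ c)).IsHomogeneous 1
      rcases eL r with r | r
      · exact hD _ _
      · exact hC _ _
    · exact MvPolynomial.isHomogeneous_zero _ _ _
  · intro x
    obtain ⟨w, rfl⟩ := hπ x
    exact ⟨w ∘ eJ, (he _).trans (by rw [Function.comp_assoc, eJ.self_comp_symm, Function.comp_id])⟩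
  · intro w
    refine (iff_of_eq (congrArg (· = 0) (he w))).trans ((hker _).trans ?_)
    constructor
    · rintro ⟨u, v, huv⟩
      refine ⟨Sum.elim u v ∘ eL, ?_⟩
      change (fromCols A B).submatrix eJ eL *ᵥ _ = _
      rw [submatrix_mulVec_equiv, Function.comp_assoc, eL.self_comp_symm, Function.comp_id,
        fromCols_mulVec_sumElim, ← huv, Function.comp_assoc, eJ.symm_comp_self, Function.comp_id]
    · rintro ⟨u, rfl⟩
      refine ⟨u ∘ eL.symm ∘ Sum.inl, u ∘ eL.symm ∘ Sum.inr, ?_⟩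
      change ((fromCols A B).submatrix eJ eL *ᵥ u) ∘ eJ.symm = _
      rw [submatrix_mulVec_equiv, Function.comp_assoc, eJ.self_comp_symm, Function.comp_id, hcols]
      rfl
  · rintro (_ | _ | i) w
    · constructor
      · intro h
        change (fromCols A B).submatrix eJ eL *ᵥ w = 0 at h
        rw [submatrix_mulVec_equiv, hcols] at h
        obtain ⟨x, hx, hx'⟩ := H.exact hfg (u := (w ∘ eL.symm) ∘ Sum.inl)
          (v := (w ∘ eL.symm) ∘ Sum.inr) (funext fun j => by
            simpa using congrFun h (eJ.symm j))
        refine ⟨x ∘ eJ, ?_⟩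
        change (fromRows D C).submatrix eL eJ *ᵥ _ = _
        rw [submatrix_mulVec_equiv, Function.comp_assoc, eJ.self_comp_symm, Function.comp_id,
          fromRows_mulVec, ← hx, ← hx', Sum.elim_comp_inl_inr, Function.comp_assoc,
          eL.symm_comp_self, Function.comp_id]
      · rintro ⟨x, rfl⟩
        change (fromCols A B).submatrix eJ eL *ᵥ (fromRows D C).submatrix eL eJ *ᵥ x = 0
        rw [submatrix_mulVec_equiv, submatrix_mulVec_equiv, Function.comp_assoc,
          eL.self_comp_symm, Function.comp_id, fromRows_mulVec, fromCols_mulVec_sumElim,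
          H.AD_mulVec, neg_add_cancel]
        rfl
    · constructor
      · intro h
        change (fromRows D C).submatrix eL eJ *ᵥ w = 0 at h
        rw [submatrix_mulVec_equiv, fromRows_mulVec] at h
        refine ⟨0, ?_⟩
        rw [map_zero]
        have h1 := H.eq_zero_of_mulVec hfg (u := w ∘ eJ.symm) (funext fun j => by
          simpa using congrFun h (eL.symm (Sum.inl j)))
        exact (funext fun j => by simpa using congrFun h1 (eJ j)).symm
      · rintro ⟨x, rfl⟩
        change (fromRows D C).submatrix eL eJ *ᵥ (0 *ᵥ x) = 0
        rw [zero_mulVec, mulVec_zero]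
    · have hempty : IsEmpty (Fin (b (i + 2 + 1))) := inferInstanceAs (IsEmpty (Fin 0))
      exact ⟨fun _ => ⟨0, funext fun j => hempty.elim j⟩, fun _ => by
        change (0 : Matrix (Fin (b (i + 2))) (Fin (b (i + 2 + 1))) (MvPolynomial σ k)) *ᵥ w = 0
        rw [zero_mulVec]⟩

end Resolution

/-! ### Two orthogonal vectors of linear forms -/

section SpinorVectors

open Matrix

theorem exists_isCliffordPair (k : Type*) [Field k] [IsAlgClosed k] {S : Type*} [Fintype S]
    [DecidableEq S] {n : ℕ} (hS : Fintype.card S = 2 * n + 2) :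
    ∃ (J : Type) (_ : Fintype J) (_ : DecidableEq J) (c d : S → Matrix J J k),
      Fintype.card J = 2 ^ n ∧ IsCliffordPair c d := by
  obtain ⟨S', J, _, _, _, _, c, d, hS', hJ, h⟩ := exists_isCliffordPair_sum (k := k) n
  let e : S ≃ S' := Fintype.equivOfCardEq (hS.trans hS'.symm)
  refine ⟨J, inferInstance, inferInstance, c ∘ e, d ∘ e, hJ, fun s t => ?_, fun s t => ?_⟩
  · simpa only [Function.comp_apply, e.injective.eq_iff] using h.left (e s) (e t)
  · simpa only [Function.comp_apply, e.injective.eq_iff] using h.right (e s) (e t)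

/-- Two diagonal forms in `n + 1` and in `n` variables are the Gram matrices of the rows of a
square matrix, and of its columns apart from the first. -/
theorem exists_gram_eq_diagonal {k : Type*} [Field k] [IsAlgClosed k] {n : ℕ} {ν : Fin (n + 1) → k}
    {μ : Fin n → k} (hν : Function.Injective ν) (hμ : Function.Injective μ)
    (hνμ : ∀ j i, ν j ≠ μ i) :
    ∃ L : Matrix (Fin (n + 1)) (Fin (n + 1)) k, L * Lᵀ = diagonal ν ∧
      ∀ i i' : Fin n, (Lᵀ * L) i.succ i'.succ = diagonal μ i i' := by
  obtain ⟨O, hO, h⟩ := exists_orthogonal_compression hν hμ hνμ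
  choose r hr using fun j => IsAlgClosed.exists_pow_nat_eq (ν j) (n := 2) two_pos
  have hD : diagonal r * diagonal r = diagonal ν := by
    rw [diagonal_mul_diagonal]
    exact congrArg diagonal (funext fun j => by rw [← hr j, pow_two])
  refine ⟨diagonal r * O, ?_, fun i i' => ?_⟩
  · rw [transpose_mul, diagonal_transpose, Matrix.mul_assoc, ← Matrix.mul_assoc O,
      mul_eq_one_comm.mp hO, Matrix.one_mul, hD]
  · rw [← h, transpose_mul, diagonal_transpose, Matrix.mul_assoc, ← Matrix.mul_assoc _ _ O, hD,
      ← Matrix.mul_assoc]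

variable {k R R' : Type*} [Field k] [CommRing R] [Algebra k R] [CommRing R'] [Algebra k R'] {n : ℕ}

/-- The vector `(z, (0, y))`, where `z` and `y` are the two blocks of the coordinates. -/
def spinorVector (z : Fin (n + 1) ⊕ Fin n → R) : Fin (n + 1) ⊕ Fin (n + 1) → R :=
  Sum.elim (z ∘ Sum.inl) (Fin.cons 0 (z ∘ Sum.inr))

/-- The vector `(L (0, y), -Lᵀ z)`, where `z` and `y` are the two blocks of the coordinates. It is
orthogonal to `(z, (0, y))`. -/
def twistedSpinorVector (L : Matrix (Fin (n + 1)) (Fin (n + 1)) k)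
    (z : Fin (n + 1) ⊕ Fin n → R) : Fin (n + 1) ⊕ Fin (n + 1) → R :=
  Sum.elim (L.map (algebraMap k R) *ᵥ Fin.cons 0 (z ∘ Sum.inr))
    (-((L.map (algebraMap k R))ᵀ *ᵥ (z ∘ Sum.inl)))

theorem dotProduct_spinorVector (z : Fin (n + 1) ⊕ Fin n → R) :
    spinorVector z ⬝ᵥ spinorVector z = ∑ i, z i ^ 2 := by
  simp [spinorVector, dotProduct, Fin.sum_univ_succ, pow_two]

theorem spinorVector_dotProduct_twistedSpinorVector (L : Matrix (Fin (n + 1)) (Fin (n + 1)) k)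
    (z : Fin (n + 1) ⊕ Fin n → R) : spinorVector z ⬝ᵥ twistedSpinorVector L z = 0 := by
  rw [spinorVector, twistedSpinorVector, sumElim_dotProduct_sumElim, dotProduct_neg,
    dotProduct_mulVec, mulVec_transpose, dotProduct_comm (Fin.cons _ _), add_neg_cancel]

variable {L : Matrix (Fin (n + 1)) (Fin (n + 1)) k} {ν : Fin (n + 1) → k} {μ : Fin n → k}

theorem mulVec_transpose_mulVec (hL : L * Lᵀ = diagonal ν) (v : Fin (n + 1) → R)
    (j : Fin (n + 1)) : (L.map (algebraMap k R) *ᵥ (L.map (algebraMap k R))ᵀ *ᵥ v) j =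
      algebraMap k R (ν j) * v j := by
  rw [mulVec_mulVec, ← transpose_map, ← Matrix.map_mul, hL, diagonal_map (map_zero _),
    mulVec_diagonal]

theorem transpose_mulVec_mulVec_cons
    (hL : ∀ i i' : Fin n, (Lᵀ * L) i.succ i'.succ = diagonal μ i i') (v : Fin n → R) (i : Fin n) :
    ((L.map (algebraMap k R))ᵀ *ᵥ L.map (algebraMap k R) *ᵥ Fin.cons 0 v) i.succ =
      algebraMap k R (μ i) * v i := by
  rw [mulVec_mulVec, ← transpose_map, ← Matrix.map_mul, mulVec, dotProduct, Fin.sum_univ_succ]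
  simp only [Fin.cons_zero, mul_zero, zero_add, Fin.cons_succ, map_apply, hL]
  rw [Finset.sum_eq_single i (fun i' _ h => by rw [diagonal_apply_ne _ h.symm]; simp) (by simp),
    diagonal_apply_eq]

theorem dotProduct_twistedSpinorVector (hL : L * Lᵀ = diagonal ν)
    (hL' : ∀ i i' : Fin n, (Lᵀ * L) i.succ i'.succ = diagonal μ i i')
    (z : Fin (n + 1) ⊕ Fin n → R) :
    twistedSpinorVector L z ⬝ᵥ twistedSpinorVector L z =
      ∑ i, algebraMap k R (Sum.elim ν μ i) * z i ^ 2 := by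
  have h1 : ∀ (M : Matrix (Fin (n + 1)) (Fin (n + 1)) R) (v : Fin (n + 1) → R),
      M *ᵥ v ⬝ᵥ M *ᵥ v = v ⬝ᵥ Mᵀ *ᵥ M *ᵥ v := fun M v => by
    rw [dotProduct_mulVec v, vecMul_transpose]
  rw [twistedSpinorVector, sumElim_dotProduct_sumElim, neg_dotProduct_neg, h1, h1,
    transpose_transpose, add_comm, Fintype.sum_sum_type]
  congr 1
  · exact Finset.sum_congr rfl fun j _ => by
      rw [mulVec_transpose_mulVec hL, Function.comp_apply, Sum.elim_inl]
      ring
  · rw [dotProduct, Fin.sum_univ_succ, Fin.cons_zero, zero_mul, zero_add]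
    refine Finset.sum_congr rfl fun i _ => ?_
    rw [transpose_mulVec_mulVec_cons hL', Fin.cons_succ, Function.comp_apply, Sum.elim_inr]
    ring

theorem comp_spinorVector (f : R →ₐ[k] R') (z : Fin (n + 1) ⊕ Fin n → R) :
    f ∘ spinorVector z = spinorVector (f ∘ z) := by
  funext s
  rcases s with s | s
  · rfl
  · refine Fin.cases ?_ (fun i => ?_) s
    · exact map_zero f
    · rfl

theorem comp_twistedSpinorVector (f : R →ₐ[k] R') (z : Fin (n + 1) ⊕ Fin n → R) :
    f ∘ twistedSpinorVector L z = twistedSpinorVector L (f ∘ z) := by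
  funext s
  rcases s with s | s
  · simp [twistedSpinorVector, mulVec, dotProduct, Fin.sum_univ_succ]
  · simp [twistedSpinorVector, mulVec, dotProduct]

theorem spinorVector_mem {V : Submodule k R} {z : Fin (n + 1) ⊕ Fin n → R} (hz : ∀ i, z i ∈ V)
    (s) : spinorVector z s ∈ V := by
  rcases s with s | s
  · exact hz _
  · refine Fin.cases ?_ (fun i => ?_) s
    · exact V.zero_mem
    · exact hz _

theorem twistedSpinorVector_mem {V : Submodule k R} {z : Fin (n + 1) ⊕ Fin n → R}
    (hz : ∀ i, z i ∈ V) (s) : twistedSpinorVector L z s ∈ V := by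
  have h : ∀ (a : k) {r : R}, r ∈ V → algebraMap k R a * r ∈ V := fun a r hr => by
    rw [← Algebra.smul_def]
    exact V.smul_mem a hr
  rcases s with s | s
  · exact sum_mem (t := Finset.univ) (f := fun j => algebraMap k R (L s j) * _) fun j _ =>
      h (L s j) (spinorVector_mem hz (Sum.inr j))
  · exact neg_mem (sum_mem (t := Finset.univ) (f := fun j => algebraMap k R (L j s) * _) fun j _ =>
      h (L j s) (hz (Sum.inl j)))

/-- The two vectors are linearly independent at every point where the first quadratic form
vanishes: `σ Φ = τ Ψ` gives `(σ² + τ² a_i) z_i = 0` for all `i`, so that at most one coordinate is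
nonzero. -/
theorem eq_zero_of_spinorVector_minors [IsDomain R] (hL : L * Lᵀ = diagonal ν)
    (hL' : ∀ i i' : Fin n, (Lᵀ * L) i.succ i'.succ = diagonal μ i i')
    (ha : Function.Injective (Sum.elim ν μ)) {z : Fin (n + 1) ⊕ Fin n → R}
    (hz : ∑ i, z i ^ 2 = 0)
    (h : ∀ s t, spinorVector z s * twistedSpinorVector L z t =
      spinorVector z t * twistedSpinorVector L z s) : z = 0 := by
  by_contra hne
  obtain ⟨i₀, hi₀⟩ := Function.ne_iff.mp hne
  obtain ⟨s, hs⟩ : ∃ s, spinorVector z s ≠ 0 := by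
    rcases i₀ with j | i
    · exact ⟨Sum.inl j, hi₀⟩
    · exact ⟨Sum.inr i.succ, hi₀⟩
  obtain ⟨τ, hτ⟩ : ∃ τ, τ = spinorVector z s := ⟨_, rfl⟩
  obtain ⟨σ, hσ⟩ : ∃ σ, σ = twistedSpinorVector L z s := ⟨_, rfl⟩
  rw [← hτ] at hs
  have h1 : σ • (z ∘ Sum.inl) = τ • L.map (algebraMap k R) *ᵥ Fin.cons 0 (z ∘ Sum.inr) :=
    funext fun j => by
      have := h s (Sum.inl j)
      rw [← hτ, ← hσ] at this
      exact (mul_comm _ _).trans this.symm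
  have h2 : σ • (Fin.cons 0 (z ∘ Sum.inr) : Fin (n + 1) → R) =
      τ • -((L.map (algebraMap k R))ᵀ *ᵥ (z ∘ Sum.inl)) :=
    funext fun j => by
      have := h s (Sum.inr j)
      rw [← hτ, ← hσ] at this
      exact (mul_comm _ _).trans this.symm
  have h3 : ∀ i, (σ ^ 2 + τ ^ 2 * algebraMap k R (Sum.elim ν μ i)) * z i = 0 := by
    rintro (j | i)
    · have h4 : σ • σ • (z ∘ Sum.inl) = -(τ • τ • (L.map (algebraMap k R) *ᵥ
          (L.map (algebraMap k R))ᵀ *ᵥ (z ∘ Sum.inl))) := by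
        rw [h1, smul_comm, ← mulVec_smul, h2, mulVec_smul, mulVec_neg, smul_neg, smul_neg]
      have h5 := congrFun h4 j
      simp only [Pi.smul_apply, Pi.neg_apply, mulVec_transpose_mulVec hL, smul_eq_mul,
        Function.comp_apply] at h5
      rw [Sum.elim_inl]
      linear_combination h5
    · have h4 : σ • σ • (Fin.cons 0 (z ∘ Sum.inr) : Fin (n + 1) → R) =
          -(τ • τ • ((L.map (algebraMap k R))ᵀ *ᵥ L.map (algebraMap k R) *ᵥ
            Fin.cons 0 (z ∘ Sum.inr))) := by
        rw [h2, smul_comm, smul_neg, ← mulVec_smul, h1, mulVec_smul, smul_neg]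
      have h5 := congrFun h4 i.succ
      simp only [Pi.smul_apply, Pi.neg_apply, transpose_mulVec_mulVec_cons hL', smul_eq_mul,
        Function.comp_apply, Fin.cons_succ] at h5
      rw [Sum.elim_inr]
      linear_combination h5
  have h6 : ∀ i, i ≠ i₀ → z i = 0 := fun i hi => by
    by_contra hzi
    have h7 := (mul_eq_zero.mp (h3 i)).resolve_right hzi
    have h8 := (mul_eq_zero.mp (h3 i₀)).resolve_right hi₀
    have h9 : τ ^ 2 * algebraMap k R (Sum.elim ν μ i - Sum.elim ν μ i₀) = 0 := by
      rw [map_sub]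
      linear_combination h7 - h8
    rcases mul_eq_zero.mp h9 with h10 | h10
    · exact hs (pow_eq_zero_iff two_ne_zero |>.mp h10)
    · rw [map_eq_zero_iff _ (algebraMap k R).injective, sub_eq_zero] at h10
      exact hi (ha h10)
  rw [Finset.sum_eq_single i₀ (fun i _ hi => by rw [h6 i hi, zero_pow two_ne_zero]) (by simp)] at hz
  exact hi₀ (pow_eq_zero_iff two_ne_zero |>.mp hz)

end SpinorVectors

/-! ### Local frames of the kernel -/

section Idempotent

open Matrix

/-- If `E² = γ E` with `γ ≠ 0`, then columns of `E` and columns of `γ - E` form a basis. -/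
theorem exists_basis_of_mul_self_eq_smul {K ι : Type*} [Field K] [Fintype ι] [DecidableEq ι]
    {E : Matrix ι ι K} {γ : K} (hγ : γ ≠ 0) (hE : E * E = γ • E) :
    ∃ (r : ℕ) (f : Fin E.rank → ι) (f' : Fin r → ι) (e : ι ≃ Fin E.rank ⊕ Fin r),
      (of fun i j => Sum.elim (fun a => E i (f a)) (fun b => (γ • 1 - E) i (f' b))
        (e j)).det ≠ 0 := by
  obtain ⟨F, hF⟩ : ∃ F, F = γ • 1 - E := ⟨_, rfl⟩
  rw [← hF]
  have hEF : E * F = 0 := by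
    rw [hF, Matrix.mul_sub, mul_smul_one, hE, sub_self]
  have hFE : F * E = 0 := by
    rw [hF, Matrix.sub_mul, smul_one_mul, hE, sub_self]
  have hsum : ∀ x, E *ᵥ x + F *ᵥ x = γ • x := fun x => by
    rw [hF, sub_mulVec, smul_mulVec, one_mulVec, add_sub_cancel]
  have hrange : ∀ G : Matrix ι ι K,
      Submodule.span K (Set.range G.col) = LinearMap.range G.mulVecLin := fun G =>
    (range_mulVecLin G).symm
  have hcompl : IsCompl (LinearMap.range E.mulVecLin) (LinearMap.range F.mulVecLin) := by
    constructor
    · rw [Submodule.disjoint_def]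
      rintro x ⟨a, ha⟩ ⟨b, hb⟩
      have h1 := hsum x
      have h2 : E *ᵥ x = 0 := by
        rw [← hb, mulVecLin_apply, mulVec_mulVec, hEF, zero_mulVec]
      have h3 : F *ᵥ x = 0 := by
        rw [← ha, mulVecLin_apply, mulVec_mulVec, hFE, zero_mulVec]
      rw [h2, h3, add_zero] at h1
      exact (smul_eq_zero.mp h1.symm).resolve_left hγ
    · rw [codisjoint_iff, eq_top_iff]
      intro x _
      rw [← inv_smul_smul₀ hγ x, ← hsum]
      exact Submodule.smul_mem _ _ (Submodule.add_mem_sup ⟨x, rfl⟩ ⟨x, rfl⟩)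
  have hbasis : ∀ G : Matrix ι ι K, ∃ f : Fin G.rank → ι,
      LinearIndependent K (fun a => G.col (f a)) ∧
      Submodule.span K (Set.range fun a => G.col (f a)) = LinearMap.range G.mulVecLin := by
    intro G
    have h1 : Module.finrank K (Submodule.span K (Set.range G.col)) = G.rank := by
      rw [hrange]; rfl
    have h2 := Submodule.exists_fun_fin_finrank_span_eq K (Set.range G.col)
    rw [h1] at h2
    obtain ⟨v, hv, hspan, hind⟩ := h2
    choose f hf using hv
    obtain rfl : (fun a => G.col (f a)) = v := funext hf
    exact ⟨f, hind, hspan.trans (hrange G)⟩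
  obtain ⟨f, hf, hfE⟩ := hbasis E
  obtain ⟨f', hf', hfF⟩ := hbasis F
  have hcard : Fintype.card ι = Fintype.card (Fin E.rank ⊕ Fin F.rank) := by
    rw [Fintype.card_sum, Fintype.card_fin, Fintype.card_fin]
    have := Submodule.finrank_add_eq_of_isCompl hcompl
    rw [Module.finrank_fintype_fun_eq_card] at this
    exact this.symm
  let e := Fintype.equivOfCardEq hcard
  refine ⟨F.rank, f, f', e, ?_⟩
  have hind := hf.sum_type hf' (by rw [hfE, hfF]; exact hcompl.disjoint)
  have hcols : LinearIndependent K
      (of fun i j => Sum.elim (fun a => E i (f a)) (fun b => F i (f' b)) (e j)).col := by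
    have h1 : (of fun i j => Sum.elim (fun a => E i (f a)) (fun b => F i (f' b)) (e j)).col =
        Sum.elim (fun a => E.col (f a)) (fun b => F.col (f' b)) ∘ e := by
      funext j i
      rcases h : e j with a | b <;> simp [h, Matrix.col]
    rw [h1]
    exact hind.comp e e.injective
  exact isUnit_iff_ne_zero.mp ((isUnit_iff_isUnit_det _).mp
    (linearIndependent_cols_iff_isUnit.mp hcols))

end Idempotent

section GradedDeterminant

variable {k A : Type u} [Field k] [CommRing A] [Algebra k A]
  {𝒜 : ℕ → Submodule k A} [GradedAlgebra 𝒜] {ι : Type*} [Fintype ι] [DecidableEq ι]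

theorem det_mem_graded {M : Matrix ι ι A} {r : ι → ℕ} (hM : ∀ i j, M i j ∈ 𝒜 (r i)) :
    M.det ∈ 𝒜 (∑ i, r i) := by
  rw [← Matrix.det_transpose, Matrix.det_apply]
  refine sum_mem fun σ _ => ?_
  rw [Units.smul_def]
  exact zsmul_mem (SetLike.prod_mem_graded _ _ _ fun i _ => hM i (σ i)) _

theorem adjugate_mem_graded {M : Matrix ι ι A} {d : ℕ} (hM : ∀ i j, M i j ∈ 𝒜 d) (i j : ι) :
    M.adjugate i j ∈ 𝒜 ((Fintype.card ι - 1) * d) := by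
  rw [Matrix.adjugate_apply]
  have h := det_mem_graded (𝒜 := 𝒜) (M := M.updateRow j (Pi.single i 1))
    (r := fun l => if l = j then 0 else d) fun l l' => by
      rw [Matrix.updateRow_apply]
      split_ifs with hl
      · rw [Pi.single_apply]
        split_ifs
        · exact SetLike.GradedOne.one_mem
        · exact (𝒜 0).zero_mem
      · exact hM l l'
  convert h using 2
  rw [Finset.sum_ite, Finset.sum_const_zero, zero_add, Finset.sum_const, smul_eq_mul,
    Finset.filter_ne' Finset.univ j, Finset.card_erase_of_mem (Finset.mem_univ j), Finset.card_univ]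

end GradedDeterminant

section VectorBundle

open Matrix

variable {k A : Type u} [Field k] [CommRing A] [Algebra k A]
  {𝒜 : ℕ → Submodule k A} [GradedAlgebra 𝒜] {ι κ : Type} [Fintype ι] [DecidableEq ι] [Fintype κ]

/-- The kernel of `Θ` is a vector bundle if locally there is a projection onto it. The projection
is `g⁻² E`, and `r` is its rank at the given point. -/
theorem kernelSheaf.isVectorBundleOfRank (Θ : Matrix κ ι A) {d r : ℕ}
    (h : ∀ p : Proj 𝒜, ∃ (g : A) (E : Matrix ι ι A) (Y : Matrix ι κ A), g ∈ 𝒜 d ∧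
      g ∉ projPrime p ∧ (∀ i j, E i j ∈ 𝒜 (2 * d)) ∧ Θ * E = 0 ∧ g ^ 2 • 1 - E = Y * Θ ∧
      (E.map (algebraMap A (projPrime p).ResidueField)).rank = r) :
    IsVectorBundleOfRank (kernelSheaf 𝒜 Θ d) r := by
  intro p
  obtain ⟨g, E, Y, hg, hgp, hE, hΘE, hY, hr⟩ := h p
  subst hr
  let φ := algebraMap A (projPrime p).ResidueField
  have hEE : E * E = g ^ 2 • E := by
    have h1 : (g ^ 2 • 1 - E) * E = 0 := by rw [hY, Matrix.mul_assoc, hΘE, Matrix.mul_zero]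
    rw [Matrix.sub_mul, smul_one_mul, sub_eq_zero] at h1
    exact h1.symm
  obtain ⟨r', f, f', e, hdet⟩ := exists_basis_of_mul_self_eq_smul (E := E.map φ) (γ := φ (g ^ 2))
    (by
      rw [map_pow]
      exact pow_ne_zero 2 fun h0 => hgp (Ideal.algebraMap_residueField_eq_zero.mp h0))
    (by rw [← Matrix.map_mul, hEE, Matrix.map_smul' _ _ _ (map_mul φ)])
  -- columns of `E` and of `F` that form a basis at `p` do so in a neighbourhood `U`; those of `E`,
  -- divided by `g`, are the local frame
  let F : Matrix ι ι A := g ^ 2 • 1 - E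
  let T : Matrix ι ι A :=
    of fun i j => Sum.elim (fun a => E i (f a)) (fun b => F i (f' b)) (e j)
  have hT : T.det ∉ projPrime p := by
    rw [← Ideal.algebraMap_residueField_eq_zero, RingHom.map_det]
    refine fun h0 => hdet (Eq.trans (congrArg det (Matrix.ext fun i j => Eq.symm ?_)) h0)
    change φ (T i j) = Sum.elim _ _ (e j)
    simp only [T, of_apply]
    rcases e j with a | b
    · rfl
    · simp only [Sum.elim_inr, F, Matrix.sub_apply, Matrix.smul_apply, Matrix.map_apply, map_sub,
        Matrix.one_apply, smul_eq_mul, map_mul]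
      split_ifs <;> simp
  have hF : ∀ i j, F i j ∈ 𝒜 (2 * d) := fun i j => by
    refine sub_mem ?_ (hE i j)
    rw [Matrix.smul_apply, Matrix.one_apply]
    split_ifs
    · rw [smul_eq_mul, mul_one, two_mul, pow_two]
      exact SetLike.GradedMul.mul_mem hg hg
    · rw [smul_zero]
      exact Submodule.zero_mem _
  have hTmem : ∀ i j, T i j ∈ 𝒜 (2 * d) := fun i j => by
    change Sum.elim _ _ (e j) ∈ _
    rcases e j with a | b
    · exact hE _ _
    · exact hF _ _
  let U : (Proj 𝒜).Opens := Proj.basicOpen 𝒜 g ⊓ Proj.basicOpen 𝒜 T.det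
  let ψ (q : Proj 𝒜) : A →+* ProjLocalization q := algebraMap A (ProjLocalization q)
  have hgu : ∀ q : U, IsUnit (ψ q.1 g) := fun q => isUnit_algebraMap_projLocalization q.2.1
  have hTu : ∀ q : U, IsUnit (T.map (ψ q.1)) := fun q => by
    rw [isUnit_iff_isUnit_det]
    have := isUnit_algebraMap_projLocalization (s := T.det) q.2.2
    rwa [RingHom.map_det] at this
  choose s hs using fun a : Fin (E.map φ).rank =>
    kernelSheaf.exists_eval_eq (𝒜 := 𝒜) (Θ := Θ) (m := d) (U := U)
      (f := fun q i => ψ q.1 (E i (f a)) * ((hgu q).unit⁻¹ : (ProjLocalization q.1)ˣ))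
      (fun i => IsTwistedFraction.of_fraction (hE i (f a)) hg (by push_cast; ring) fun q =>
        ⟨q.2.1, by
          rw [mul_assoc]
          exact (congrArg _ ((hgu q).val_inv_mul)).trans (mul_one _)⟩)
      (fun q => by
        have h1 : (fun i => ψ q.1 (E i (f a)) * ((hgu q).unit⁻¹ : (ProjLocalization q.1)ˣ)) =
            (((hgu q).unit⁻¹ : (ProjLocalization q.1)ˣ) : ProjLocalization q.1) •
              (ψ q.1 ∘ fun i => E i (f a)) := funext fun i => mul_comm _ _
        rw [h1, mulVec_smul]
        have h2 : Θ.map (ψ q.1) *ᵥ (ψ q.1 ∘ fun i => E i (f a)) = 0 := funext fun i => by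
          rw [← RingHom.map_mulVec]
          exact (congrArg (ψ q.1) (congrFun (congrFun hΘE i) (f a))).trans (map_zero _)
        rw [h2, smul_zero])
  -- A combination of the local frame is `T` applied to the vector of coefficients.
  have hcomb : ∀ (q : U) (c : Fin (E.map φ).rank → ProjLocalization q.1),
      ψ q.1 g • ∑ a, c a • kernelSheaf.eval (s a) q =
        T.map (ψ q.1) *ᵥ (Sum.elim c 0 ∘ e) := by
    intro q c
    funext i
    rw [mulVec, dotProduct, ← e.symm.sum_comp, Fintype.sum_sum_type, Pi.smul_apply,
      Finset.sum_apply, smul_eq_mul, Finset.mul_sum]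
    simp only [Function.comp_apply, e.apply_symm_apply, Sum.elim_inl, Sum.elim_inr, Pi.zero_apply,
      mul_zero, Finset.sum_const_zero, add_zero]
    refine Finset.sum_congr rfl fun a _ => ?_
    have h1 : T.map (ψ q.1) i (e.symm (Sum.inl a)) = ψ q.1 (E i (f a)) := by
      simp [T]
    rw [h1, hs, Pi.smul_apply, smul_eq_mul]
    have h2 := (hgu q).mul_val_inv
    linear_combination ψ q.1 (E i (f a)) * c a * h2
  refine ⟨U, ⟨hgp, hT⟩, s, fun V hV t => ?_⟩
  have hexp : ∀ (c : Fin (E.map φ).rank → Γ(Proj 𝒜, V)) (q : V),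
      kernelSheaf.eval (∑ a, c a • (kernelSheaf 𝒜 Θ d).presheaf.map (homOfLE hV).op (s a)) q =
        ∑ a, projValue q (c a) • kernelSheaf.eval (s a) ⟨q.1, hV q.2⟩ := by
    intro c q
    rw [map_sum, Finset.sum_apply]
    rfl
  refine existsUnique_of_exists_of_unique ?_ ?_
  -- the coefficients of `t` are entries of `g T⁻¹ t`, which are fractions of degree zero
  · have hc : ∀ a, ∃ c : Γ(Proj 𝒜, V), ∀ q : V, projValue q c =
        ψ q.1 g * ((T.map (ψ q.1))⁻¹ *ᵥ kernelSheaf.eval t q) (e.symm (Sum.inl a)) := by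
      intro a
      refine IsTwistedFraction.exists_section ?_
      have hdeg : (d : ℤ) + (-(2 * d : ℕ) + d) = 0 := by
        push_cast
        ring
      rw [← hdeg]
      refine (IsTwistedFraction.of_mem hg).mul (IsTwistedFraction.sum Finset.univ fun j _ =>
        IsTwistedFraction.mul ?_ (kernelSheaf.isTwistedFraction_eval t j))
      refine IsTwistedFraction.of_fraction (adjugate_mem_graded hTmem (e.symm (Sum.inl a)) j)
        (det_mem_graded hTmem) ?_ fun q => ⟨(hV q.2).2, ?_⟩
      · have hpos : 1 ≤ Fintype.card ι := Fintype.card_pos_iff.mpr ⟨j⟩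
        rw [Finset.sum_const, Finset.card_univ, smul_eq_mul]
        push_cast [hpos]
        ring
      · have h1 : (T.map (ψ q.1))⁻¹ * ψ q.1 T.det • (1 : Matrix ι ι _) =
            T.adjugate.map (ψ q.1) := by
          have h2 := congrArg (Matrix.map · (ψ q.1)) (mul_adjugate T)
          simp only [Matrix.map_mul] at h2
          rw [Matrix.map_smul' _ _ _ (map_mul _), Matrix.map_one _ (map_zero _) (map_one _)] at h2
          rw [← h2, ← Matrix.mul_assoc, nonsing_inv_mul _
            ((isUnit_iff_isUnit_det _).mp (hTu ⟨q.1, hV q.2⟩)), Matrix.one_mul]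
        have h2 := congrFun (congrFun h1 (e.symm (Sum.inl a))) j
        rw [mul_smul_one, Matrix.smul_apply, smul_eq_mul, mul_comm] at h2
        exact h2
    choose c hc using hc
    refine ⟨c, kernelSheaf.eval_injective (funext fun q => ?_)⟩
    rw [hexp]
    have hq : q.1 ∈ U := hV q.2
    have h1 := hcomb ⟨q.1, hq⟩ fun a => projValue q (c a)
    refine (hgu ⟨q.1, hq⟩).smul_left_cancel.mp (Eq.trans ?_ h1.symm)
    obtain ⟨v, hv⟩ : ∃ v, v = kernelSheaf.eval t q := ⟨_, rfl⟩
    obtain ⟨w, hw⟩ : ∃ w, w = (T.map (ψ q.1))⁻¹ *ᵥ v := ⟨_, rfl⟩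
    have hvw : v = T.map (ψ q.1) *ᵥ w := by
      rw [hw, mulVec_mulVec, mul_nonsing_inv _ ((isUnit_iff_isUnit_det _).mp (hTu ⟨q.1, hq⟩)),
        one_mulVec]
    have hEv : E.map (ψ q.1) *ᵥ v = ψ q.1 (g ^ 2) • v := by
      have h2 : F.map (ψ q.1) *ᵥ v = 0 := by
        rw [show F = Y * Θ from hY, Matrix.map_mul, ← mulVec_mulVec, hv, kernelSheaf.mulVec_eval,
          mulVec_zero]
      have h3 : F.map (ψ q.1) = ψ q.1 (g ^ 2) • 1 - E.map (ψ q.1) := by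
        rw [Matrix.map_sub _ (map_sub _), Matrix.map_smul' _ _ _ (map_mul _),
          Matrix.map_one _ (map_zero _) (map_one _)]
      rw [h3, sub_mulVec, smul_mulVec, one_mulVec, sub_eq_zero] at h2
      exact h2.symm
    -- multiplication by `E` masks the columns of `T` that come from `F`, and `v` is in the image of
    -- `E`
    have hET : E * T = g ^ 2 • (T * diagonal fun j => Sum.elim 1 0 (e j)) := by
      ext i j
      rw [Matrix.smul_apply, mul_diagonal]
      rcases hj : e j with a | b
      · have h2 := congrFun (congrFun hEE i) (f a)
        have h3 : ∀ l, T l j = E l (f a) := fun l => by simp [T, hj]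
        simpa [Matrix.mul_apply, h3] using h2
      · have h2 : (E * F) i (f' b) = 0 := by
          have h4 : E * F = 0 := by
            simp only [F]
            rw [Matrix.mul_sub, mul_smul_one, hEE, sub_self]
          rw [h4, Matrix.zero_apply]
        have h3 : ∀ l, T l j = F l (f' b) := fun l => by simp [T, hj]
        simpa [Matrix.mul_apply, h3] using h2
    have hmask : v = T.map (ψ q.1) *ᵥ fun j =>
        Sum.elim (fun _ => (1 : ProjLocalization q.1)) (fun _ => 0) (e j) * w j := by
      refine ((hgu ⟨q.1, hq⟩).pow 2).smul_left_cancel.mp ?_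
      have h2 := congrArg (fun M => M.map (ψ q.1) *ᵥ w) hET
      simp only [Matrix.map_mul, ← mulVec_mulVec, ← hvw] at h2
      rw [← map_pow, ← hEv, h2, Matrix.map_smul' _ _ _ (map_mul _), smul_mulVec, Matrix.map_mul,
        ← mulVec_mulVec, diagonal_map (map_zero _)]
      congr 2
      funext j
      rw [mulVec_diagonal]
      rcases e j with a | b <;> simp
    have hvec : (Sum.elim (fun a => projValue q (c a)) 0 ∘ e) =
        ψ q.1 g • fun j =>
          Sum.elim (fun _ => (1 : ProjLocalization q.1)) (fun _ => 0) (e j) * w j := by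
      funext j
      rw [Function.comp_apply, Pi.smul_apply, smul_eq_mul]
      rcases hj : e j with a | b
      · rw [Sum.elim_inl, Sum.elim_inl, hc, ← hv, ← hw, ← hj, e.symm_apply_apply, one_mul]
      · simp
    rw [hvec, mulVec_smul, ← hmask, hv]
  · intro c c' hcc hcc'
    funext a
    refine projEval_ext fun q hq => ?_
    have hqU : q ∈ U := hV hq
    have h1 := hcomb ⟨q, hqU⟩ fun a => projValue ⟨q, hq⟩ (c a)
    have h2 := hcomb ⟨q, hqU⟩ fun a => projValue ⟨q, hq⟩ (c' a)
    rw [← hexp c ⟨q, hq⟩, ← hcc, hcc', hexp c' ⟨q, hq⟩] at h1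
    have h3 := mulVec_injective_of_isUnit (hTu ⟨q, hqU⟩) (h1.symm.trans h2)
    have h4 := congrFun h3 (e.symm (Sum.inl a))
    simp only [Function.comp_apply, e.apply_symm_apply, Sum.elim_inl] at h4
    exact h4

end VectorBundle

/-! ### Isotropic planes -/

section Isotropic

open Matrix

theorem _root_.Matrix.rank_add_le_rank_add_rank {K m n : Type*} [Field K] [Fintype n]
    [Fintype m] (A B : Matrix m n K) : (A + B).rank ≤ A.rank + B.rank := by
  refine le_trans (Submodule.finrank_mono ?_)
    (Submodule.finrank_add_le_finrank_add_finrank (LinearMap.range A.mulVecLin)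
      (LinearMap.range B.mulVecLin))
  rintro _ ⟨x, rfl⟩
  rw [mulVecLin_apply, add_mulVec]
  exact Submodule.add_mem_sup ⟨x, rfl⟩ ⟨x, rfl⟩

variable {R R' S : Type*} [CommRing R] [CommRing R'] [Fintype S] {a b a' b' : S → R} {g : R}

/-- The isotropic and orthogonal vectors `a, b` are linearly independent where `g` is invertible, as
they pair with `a', b'` to `g` times the identity matrix. -/
structure IsIsotropicPair (a b a' b' : S → R) (g : R) : Prop where
  aa : a ⬝ᵥ a = 0
  bb : b ⬝ᵥ b = 0
  ab : a ⬝ᵥ b = 0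
  aa' : a ⬝ᵥ a' = g
  bb' : b ⬝ᵥ b' = g
  ab' : a ⬝ᵥ b' = 0
  ba' : b ⬝ᵥ a' = 0

theorem IsIsotropicPair.of_minor [DecidableEq S] (haa : a ⬝ᵥ a = 0) (hbb : b ⬝ᵥ b = 0)
    (hab : a ⬝ᵥ b = 0) (i j : S) :
    IsIsotropicPair a b (Pi.single i (b j) - Pi.single j (b i))
      (Pi.single j (a i) - Pi.single i (a j)) (a i * b j - a j * b i) where
  aa := haa
  bb := hbb
  ab := hab
  aa' := by simp [dotProduct_sub]
  bb' := by simp [dotProduct_sub]; ring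
  ab' := by simp [dotProduct_sub]; ring
  ba' := by simp [dotProduct_sub]; ring

theorem IsIsotropicPair.map (h : IsIsotropicPair a b a' b' g) (φ : R →+* R') :
    IsIsotropicPair (φ ∘ a) (φ ∘ b) (φ ∘ a') (φ ∘ b') (φ g) where
  aa := by rw [← RingHom.map_dotProduct, h.aa, map_zero]
  bb := by rw [← RingHom.map_dotProduct, h.bb, map_zero]
  ab := by rw [← RingHom.map_dotProduct, h.ab, map_zero]
  aa' := by rw [← RingHom.map_dotProduct, h.aa']
  bb' := by rw [← RingHom.map_dotProduct, h.bb']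
  ab' := by rw [← RingHom.map_dotProduct, h.ab', map_zero]
  ba' := by rw [← RingHom.map_dotProduct, h.ba', map_zero]

/-- The orthogonal complement of an isotropic plane is not totally isotropic, if the dimension of
the quadratic space exceeds four: it has codimension two, and a totally isotropic subspace has at
most half the dimension. -/
theorem IsIsotropicPair.exists_dotProduct_ne_zero {K : Type*} [Field K] [DecidableEq S]
    (h2 : (2 : K) ≠ 0) {a b a' b' : S → K} {g : K} (h : IsIsotropicPair a b a' b' g) (hg : g ≠ 0)
    (hS : 4 < Fintype.card S) : ∃ v : S → K, v ⬝ᵥ a = 0 ∧ v ⬝ᵥ b = 0 ∧ v ⬝ᵥ v ≠ 0 := by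
  by_contra! hv
  -- `P` is `g` times a projection onto the orthogonal complement of `a` and `b`, and `U` has rank
  -- two
  let U : Matrix S S K := vecMulVec a' a + vecMulVec b' b
  let P : Matrix S S K := g • 1 - U
  have hUx : ∀ x, U *ᵥ x = (a ⬝ᵥ x) • a' + (b ⬝ᵥ x) • b' := fun x => by
    simp only [U, add_mulVec, vecMulVec_mulVec, op_smul_eq_smul]
  have hPx : ∀ x, P *ᵥ x = g • x - ((a ⬝ᵥ x) • a' + (b ⬝ᵥ x) • b') := fun x => by
    rw [sub_mulVec, smul_mulVec, one_mulVec, hUx]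
  have hPa : ∀ x, P *ᵥ x ⬝ᵥ a = 0 := fun x => by
    rw [dotProduct_comm, hPx, dotProduct_sub, dotProduct_add, dotProduct_smul, dotProduct_smul,
      dotProduct_smul, h.aa', h.ab', smul_zero, add_zero, smul_eq_mul, smul_eq_mul, mul_comm,
      sub_self]
  have hPb : ∀ x, P *ᵥ x ⬝ᵥ b = 0 := fun x => by
    rw [dotProduct_comm, hPx, dotProduct_sub, dotProduct_add, dotProduct_smul, dotProduct_smul,
      dotProduct_smul, h.ba', h.bb', smul_zero, zero_add, smul_eq_mul, smul_eq_mul, mul_comm,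
      sub_self]
  have hPP : ∀ x y, P *ᵥ x ⬝ᵥ P *ᵥ y = 0 := fun x y => by
    have h3 := hv _ (hPa (x + y)) (hPb (x + y))
    rw [mulVec_add, add_dotProduct, dotProduct_add, dotProduct_add, hv _ (hPa x) (hPb x),
      hv _ (hPa y) (hPb y), dotProduct_comm (P *ᵥ y), zero_add, add_zero, ← two_mul] at h3
    exact (mul_eq_zero.mp h3).resolve_left h2
  -- if the complement is totally isotropic, the identity is a sum of two matrices of rank two
  have hPT : Pᵀ * P = 0 := by
    ext s t
    have h3 := hPP (Pi.single s 1) (Pi.single t 1)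
    rw [mulVec_single_one, mulVec_single_one] at h3
    exact h3
  have hUrank : U.rank ≤ 2 := (rank_add_le_rank_add_rank _ _).trans
    (add_le_add (rank_vecMulVec_le _ _) (rank_vecMulVec_le _ _))
  have key : (g * g) • (1 : Matrix S S K) = Pᵀ * U + Uᵀ * (g • 1) := by
    have h3 : P + U = g • 1 := sub_add_cancel _ _
    have h4 : Pᵀ + Uᵀ = g • 1 := by rw [← transpose_add, h3, transpose_smul, transpose_one]
    calc (g * g) • (1 : Matrix S S K) = (Pᵀ + Uᵀ) * (g • 1) := by rw [h4]; simp [smul_smul]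
      _ = Pᵀ * (P + U) + Uᵀ * (g • 1) := by rw [h3, Matrix.add_mul]
      _ = Pᵀ * U + Uᵀ * (g • 1) := by rw [Matrix.mul_add, hPT, zero_add]
  have hrank := congrArg Matrix.rank key
  rw [rank_of_isUnit _ ((isUnit_iff_isUnit_det _).mpr (by
    rw [det_smul, det_one, mul_one]
    exact ((mul_ne_zero hg hg).isUnit).pow _))] at hrank
  have h5 : (Pᵀ * U + Uᵀ * (g • 1)).rank ≤ 2 + 2 := (rank_add_le_rank_add_rank _ _).trans
    (add_le_add ((rank_mul_le_right _ _).trans hUrank)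
      ((rank_mul_le_left _ _).trans ((rank_transpose U).trans_le hUrank)))
  omega

end Isotropic

/-! ### Spinors killed by an isotropic plane -/

section Projector

open Matrix

variable {k R S J : Type*} [Field k] [CommRing R] [Algebra k R] [Fintype S]
  [Fintype J] {c d : S → Matrix J J k} {a b a' b' : S → R} {g : R}

/-- Up to the factor `g²`, a projection onto the spinors killed by `a` and `b`. -/
def pureSpinorProjector (c d : S → Matrix J J k) (a b a' b' : S → R) : Matrix J J R :=
  (4⁻¹ : k) • (cliffordMatrix c a * cliffordMatrix d a' *
    (cliffordMatrix c b * cliffordMatrix d b'))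

theorem map_pureSpinorProjector {R' : Type*} [CommRing R'] [Algebra k R'] (φ : R →ₐ[k] R')
    (a b a' b' : S → R) : (pureSpinorProjector c d a b a' b').map φ =
      pureSpinorProjector c d (φ ∘ a) (φ ∘ b) (φ ∘ a') (φ ∘ b') := by
  have h1 : ∀ (r : k) (M : Matrix J J R), (r • M).map φ = r • M.map φ := fun r M => by
    ext i j
    simp
  simp only [pureSpinorProjector, h1, Matrix.map_mul, cliffordMatrix_map]

variable [DecidableEq S] [DecidableEq J]

theorem cliffordMatrix_mul_pureSpinorProjector_left (H : IsCliffordPair c d) (h2 : (2 : k) ≠ 0)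
    (h : IsIsotropicPair a b a' b' g) :
    cliffordMatrix d a * pureSpinorProjector c d a b a' b' = 0 := by
  rw [pureSpinorProjector, Matrix.mul_smul, Matrix.mul_assoc, ← Matrix.mul_assoc,
    H.symm.mul_self h2, h.aa, zero_smul, Matrix.zero_mul, smul_zero]

theorem cliffordMatrix_mul_pureSpinorProjector_right (H : IsCliffordPair c d) (h2 : (2 : k) ≠ 0)
    (h : IsIsotropicPair a b a' b' g) :
    cliffordMatrix d b * pureSpinorProjector c d a b a' b' = 0 := by
  have h1 := eq_neg_of_add_eq_zero_right (H.symm.mul_add_mul_eq_zero h.ab)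
  have h3 := eq_neg_of_add_eq_zero_right (H.mul_add_mul_eq_zero
    ((dotProduct_comm _ _).trans h.ba'))
  have h4 := H.symm.mul_self h2 b
  rw [h.bb, zero_smul] at h4
  have h5 : cliffordMatrix d b * (cliffordMatrix c a * cliffordMatrix d a' *
      (cliffordMatrix c b * cliffordMatrix d b')) = cliffordMatrix d b * cliffordMatrix c a *
        cliffordMatrix d a' * cliffordMatrix c b * cliffordMatrix d b' := by
    noncomm_ring
  have h6 : cliffordMatrix d a * cliffordMatrix c b * cliffordMatrix d a' * cliffordMatrix c b =
      cliffordMatrix d a * (cliffordMatrix c b * cliffordMatrix d a') * cliffordMatrix c b := by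
    noncomm_ring
  rw [pureSpinorProjector, Matrix.mul_smul, h5, h1, Matrix.neg_mul, Matrix.neg_mul, h6, h3]
  simp only [Matrix.mul_neg, Matrix.neg_mul, neg_neg, Matrix.mul_assoc]
  rw [← Matrix.mul_assoc (cliffordMatrix d b), h4]
  simp

/-- The complementary projection factors through `(d(a), d(b))`. -/
theorem sub_pureSpinorProjector_eq (H : IsCliffordPair c d) (h2 : (2 : k) ≠ 0)
    (h : IsIsotropicPair a b a' b' g) :
    g ^ 2 • 1 - pureSpinorProjector c d a b a' b' =
      (4⁻¹ : k) • (cliffordMatrix c a' * cliffordMatrix d b * cliffordMatrix c b' *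
        cliffordMatrix d a) + (2⁻¹ : k) • g • (cliffordMatrix c b' * cliffordMatrix d b) := by
  have h1 := H.mul_add_mul a a'
  have h3 := H.mul_add_mul b b'
  have h4 := eq_neg_of_add_eq_zero_left (H.symm.mul_add_mul_eq_zero h.ab)
  have h5 := eq_neg_of_add_eq_zero_left (H.mul_add_mul_eq_zero h.ab')
  rw [h.aa'] at h1
  rw [h.bb'] at h3
  have hk : ∀ x : Matrix J J R, (2⁻¹ : k) • (2 * g) • x = g • x := fun x => by
    rw [mul_smul, two_smul R, smul_add, ← two_smul k ((2⁻¹ : k) • g • x), smul_smul,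
      mul_inv_cancel₀ h2, one_smul]
  have h44 : (4⁻¹ : k) = 2⁻¹ * 2⁻¹ := by rw [← mul_inv]; norm_num
  have h6 : cliffordMatrix d a * (cliffordMatrix c b * cliffordMatrix d b') =
      cliffordMatrix d b * cliffordMatrix c b' * cliffordMatrix d a := by
    rw [← Matrix.mul_assoc, h4, Matrix.neg_mul, Matrix.mul_assoc, h5, Matrix.mul_neg, neg_neg,
      Matrix.mul_assoc]
  have h7 : cliffordMatrix c a * cliffordMatrix d a' *
      (cliffordMatrix c b * cliffordMatrix d b') =
      (2 * g) • (cliffordMatrix c b * cliffordMatrix d b') -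
        cliffordMatrix c a' * cliffordMatrix d b * cliffordMatrix c b' * cliffordMatrix d a := by
    rw [eq_sub_of_add_eq h1, Matrix.sub_mul, smul_one_mul, Matrix.mul_assoc (cliffordMatrix c a'),
      h6]
    simp only [Matrix.mul_assoc]
  have h8 : (4⁻¹ : k) • (2 * g) • (cliffordMatrix c b * cliffordMatrix d b') =
      g ^ 2 • 1 - (2⁻¹ : k) • g • (cliffordMatrix c b' * cliffordMatrix d b) := by
    rw [h44, mul_smul, hk, eq_sub_of_add_eq h3, smul_sub, smul_sub, smul_comm (2⁻¹ : k) g, hk,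
      smul_smul, pow_two]
  rw [pureSpinorProjector, h7, smul_sub, h8]
  abel

end Projector

section Rank

open Matrix

variable {k K S J : Type*} [Field k] [Field K] [Algebra k K] [Fintype S] [Fintype J]
  {c d : S → Matrix J J k} {a b a' b' : S → K} {g : K}

/-- The spinors killed by the vectors `a` and `b`. -/
def spinorKernel (d : S → Matrix J J k) (a b : S → K) : Submodule K (J → K) :=
  LinearMap.ker (cliffordMatrix d a).mulVecLin ⊓ LinearMap.ker (cliffordMatrix d b).mulVecLin

theorem mem_spinorKernel {w : J → K} : w ∈ spinorKernel d a b ↔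
    cliffordMatrix d a *ᵥ w = 0 ∧ cliffordMatrix d b *ᵥ w = 0 := Iff.rfl

variable [DecidableEq S] [DecidableEq J]

theorem IsCliffordPair.mulVec_mulVec_self (H : IsCliffordPair c d) (h2 : (2 : k) ≠ 0) (v : S → K)
    (w : J → K) : cliffordMatrix c v *ᵥ cliffordMatrix d v *ᵥ w = (v ⬝ᵥ v) • w := by
  rw [mulVec_mulVec, H.mul_self h2, smul_mulVec, one_mulVec]

theorem IsCliffordPair.mulVec_mulVec_anticomm (H : IsCliffordPair c d) {v v' : S → K}
    (h : v ⬝ᵥ v' = 0) (w : J → K) : cliffordMatrix c v *ᵥ cliffordMatrix d v' *ᵥ w =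
      -(cliffordMatrix c v' *ᵥ cliffordMatrix d v *ᵥ w) := by
  rw [mulVec_mulVec, mulVec_mulVec, ← neg_mulVec,
    eq_neg_of_add_eq_zero_left (H.mul_add_mul_eq_zero h)]

/-- Multiplication by an anisotropic vector orthogonal to `a` and `b` exchanges the two kinds of
half spinors. -/
theorem finrank_spinorKernel_le (H : IsCliffordPair c d) (h2 : (2 : k) ≠ 0) {v : S → K}
    (hva : v ⬝ᵥ a = 0) (hvb : v ⬝ᵥ b = 0) (hv : v ⬝ᵥ v ≠ 0) :
    Module.finrank K (spinorKernel d a b) ≤ Module.finrank K (spinorKernel c a b) := by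
  have hinj : Function.Injective (cliffordMatrix d v).mulVecLin := fun x y hxy => by
    have h1 := congrArg (cliffordMatrix c v *ᵥ ·) hxy
    simp only [mulVecLin_apply, H.mulVec_mulVec_self h2] at h1
    exact (smul_right_injective _ hv) h1
  rw [(Submodule.equivMapOfInjective _ hinj (spinorKernel d a b)).finrank_eq]
  refine Submodule.finrank_mono ?_
  rintro _ ⟨w, hw, rfl⟩
  rw [SetLike.mem_coe, mem_spinorKernel] at hw
  rw [mem_spinorKernel]
  constructor
  · rw [mulVecLin_apply, H.mulVec_mulVec_anticomm ((dotProduct_comm _ _).trans hva), hw.1,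
      mulVec_zero, neg_zero]
  · rw [mulVecLin_apply, H.mulVec_mulVec_anticomm ((dotProduct_comm _ _).trans hvb), hw.2,
      mulVec_zero, neg_zero]

theorem finrank_spinorKernel_comm (H : IsCliffordPair c d) (h2 : (2 : k) ≠ 0) {v : S → K}
    (hva : v ⬝ᵥ a = 0) (hvb : v ⬝ᵥ b = 0) (hv : v ⬝ᵥ v ≠ 0) :
    Module.finrank K (spinorKernel d a b) = Module.finrank K (spinorKernel c a b) :=
  (finrank_spinorKernel_le H h2 hva hvb hv).antisymm
    (finrank_spinorKernel_le H.symm h2 hva hvb hv)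

/-- Among the spinors killed by `a`, those killed by `b` form a subspace of half the dimension. Here
`a = 0` is allowed. -/
theorem two_mul_finrank_spinorKernel (H : IsCliffordPair c d) (h2 : (2 : k) ≠ 0) {v : S → K}
    (hva : v ⬝ᵥ a = 0) (hvb : v ⬝ᵥ b = 0) (hv : v ⬝ᵥ v ≠ 0) (hb : b ⬝ᵥ b = 0) (hab : a ⬝ᵥ b = 0)
    (hbb' : b ⬝ᵥ b' ≠ 0) (hab' : a ⬝ᵥ b' = 0) :
    2 * Module.finrank K (spinorKernel d a b) = Module.finrank K (spinorKernel d a a) := by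
  have h2K : (2 : K) ≠ 0 := by
    have := (map_ne_zero (algebraMap k K)).mpr h2
    rwa [map_ofNat] at this
  let f := (cliffordMatrix d b).mulVecLin.domRestrict (spinorKernel d a a)
  have hker : Module.finrank K (LinearMap.ker f) = Module.finrank K (spinorKernel d a b) := by
    have h1 : (LinearMap.ker f).map (spinorKernel d a a).subtype = spinorKernel d a b := by
      ext w
      constructor
      · rintro ⟨w, hw, rfl⟩
        exact ⟨w.2.1, hw⟩
      · exact fun hw => ⟨⟨w, hw.1, hw.1⟩, hw.2, rfl⟩
    rw [← h1, ← (Submodule.equivMapOfInjective _ (Submodule.subtype_injective _) _).finrank_eq]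
  -- multiplication by `b` maps the spinors killed by `a` onto the spinors of the other kind killed
  -- by `a` and `b`, since `b'` splits it
  have hrange : LinearMap.range f = spinorKernel c a b := by
    ext w
    constructor
    · rintro ⟨w, rfl⟩
      have hw := (mem_spinorKernel.mp w.2).1
      refine mem_spinorKernel.mpr ⟨?_, ?_⟩
      · change cliffordMatrix c a *ᵥ cliffordMatrix d b *ᵥ (w : J → K) = 0
        rw [H.mulVec_mulVec_anticomm hab, hw, mulVec_zero, neg_zero]
      · change cliffordMatrix c b *ᵥ cliffordMatrix d b *ᵥ (w : J → K) = 0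
        rw [H.mulVec_mulVec_self h2, hb, zero_smul]
    · intro hw
      rw [mem_spinorKernel] at hw
      have h3 : cliffordMatrix d a *ᵥ cliffordMatrix c b' *ᵥ w = 0 := by
        rw [H.symm.mulVec_mulVec_anticomm hab', hw.1, mulVec_zero, neg_zero]
      have h4 : cliffordMatrix d b *ᵥ cliffordMatrix c b' *ᵥ w = (2 * (b ⬝ᵥ b')) • w := by
        have h5 := congrArg (· *ᵥ w) (H.symm.mul_add_mul b b')
        simpa only [add_mulVec, ← mulVec_mulVec, hw.2, mulVec_zero, add_zero, smul_mulVec,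
          one_mulVec] using h5
      refine ⟨(2 * (b ⬝ᵥ b'))⁻¹ • ⟨cliffordMatrix c b' *ᵥ w, h3, h3⟩, ?_⟩
      rw [map_smul]
      change _ • cliffordMatrix d b *ᵥ cliffordMatrix c b' *ᵥ w = w
      rw [h4, inv_smul_smul₀ (mul_ne_zero h2K hbb')]
  have h6 := LinearMap.finrank_range_add_finrank_ker f
  rw [hker, hrange, ← finrank_spinorKernel_comm H h2 hva hvb hv] at h6
  omega

/-- The spinors killed by an isotropic plane form a subspace of a quarter of the dimension. -/
theorem rank_pureSpinorProjector (H : IsCliffordPair c d) (h2 : (2 : k) ≠ 0)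
    (h : IsIsotropicPair a b a' b' g) (hg : g ≠ 0) (hS : 4 < Fintype.card S) :
    4 * (pureSpinorProjector c d a b a' b').rank = Fintype.card J := by
  have h2K : (2 : K) ≠ 0 := by
    have := (map_ne_zero (algebraMap k K)).mpr h2
    rwa [map_ofNat] at this
  obtain ⟨v, hva, hvb, hv⟩ := h.exists_dotProduct_ne_zero h2K hg hS
  have hrange : LinearMap.range (pureSpinorProjector c d a b a' b').mulVecLin =
      spinorKernel d a b := by
    ext w
    constructor
    · rintro ⟨w, rfl⟩
      refine mem_spinorKernel.mpr ⟨?_, ?_⟩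
      · rw [mulVecLin_apply, mulVec_mulVec, cliffordMatrix_mul_pureSpinorProjector_left H h2 h,
          zero_mulVec]
      · rw [mulVecLin_apply, mulVec_mulVec, cliffordMatrix_mul_pureSpinorProjector_right H h2 h,
          zero_mulVec]
    · intro hw
      rw [mem_spinorKernel] at hw
      have h3 := congrArg (· *ᵥ w) (sub_pureSpinorProjector_eq H h2 h)
      simp only [sub_mulVec, add_mulVec, smul_mulVec, one_mulVec, ← mulVec_mulVec, hw.1, hw.2,
        mulVec_zero, smul_zero, add_zero, sub_eq_zero] at h3
      refine ⟨(g ^ 2)⁻¹ • w, ?_⟩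
      rw [mulVecLin_apply, mulVec_smul, ← h3, inv_smul_smul₀ (pow_ne_zero 2 hg)]
  -- halve the dimension twice
  have h4 := two_mul_finrank_spinorKernel H h2 hva hvb hv h.bb h.ab (h.bb'.trans_ne hg) h.ab'
  have h5 := two_mul_finrank_spinorKernel (a := 0) (b' := a') H h2 (dotProduct_zero v) hva hv h.aa
    (zero_dotProduct _) (h.aa'.trans_ne hg) (zero_dotProduct _)
  have h6 : spinorKernel d (0 : S → K) a = spinorKernel d a a := by
    ext w
    simp [mem_spinorKernel, cliffordMatrix_zero]
  have h7 : spinorKernel d (0 : S → K) 0 = ⊤ := by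
    ext w
    simp [mem_spinorKernel, cliffordMatrix_zero]
  rw [h6, h7, finrank_top, Module.finrank_fintype_fun_eq_card, ← h4] at h5
  rw [Matrix.rank, hrange, ← h5]
  ring

end Rank

/-! ### The spinor bundle -/

section SpinorSheaf

open Matrix

variable {k A : Type u} [Field k] [CommRing A] [Algebra k A]
  {𝒜 : ℕ → Submodule k A} {S J : Type} [Fintype S]
  {c d : S → Matrix J J k} {a b : S → A}

theorem cliffordMatrix_mem_graded {m : ℕ} {h : S → A} (hh : ∀ s, h s ∈ 𝒜 m) (i j : J) :
    cliffordMatrix c h i j ∈ 𝒜 m := by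
  rw [cliffordMatrix_apply]
  refine sum_mem fun s _ => ?_
  rw [mul_comm, ← Algebra.smul_def]
  exact Submodule.smul_mem _ _ (hh s)

variable [GradedAlgebra 𝒜] [Fintype J]

theorem mul_apply_mem_graded {M M' : Matrix J J A} {m m' : ℕ} (hM : ∀ i j, M i j ∈ 𝒜 m)
    (hM' : ∀ i j, M' i j ∈ 𝒜 m') (i j : J) : (M * M') i j ∈ 𝒜 (m + m') :=
  sum_mem fun l _ => SetLike.GradedMul.mul_mem (hM i l) (hM' l j)

/-- The spinors killed by two isotropic and orthogonal vectors of linear forms are the sections of a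
vector bundle where these vectors are linearly independent. -/
theorem isVectorBundleOfRank_spinorSheaf [DecidableEq S] [DecidableEq J] (H : IsCliffordPair c d)
    (h2 : (2 : k) ≠ 0) (haa : a ⬝ᵥ a = 0) (hbb : b ⬝ᵥ b = 0) (hab : a ⬝ᵥ b = 0)
    (ha : ∀ s, a s ∈ 𝒜 1) (hb : ∀ s, b s ∈ 𝒜 1)
    (hind : ∀ p : Proj 𝒜, ∃ i j, a i * b j - a j * b i ∉ projPrime p) (hS : 4 < Fintype.card S)
    {r : ℕ} (hr : Fintype.card J = 4 * r) :
    IsVectorBundleOfRank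
      (kernelSheaf 𝒜 (fromRows (cliffordMatrix d a) (cliffordMatrix d b)) (2 : ℕ)) r := by
  refine kernelSheaf.isVectorBundleOfRank _ fun p => ?_
  obtain ⟨i, j, hij⟩ := hind p
  have h := IsIsotropicPair.of_minor haa hbb hab i j
  let a' : S → A := Pi.single i (b j) - Pi.single j (b i)
  let b' : S → A := Pi.single j (a i) - Pi.single i (a j)
  have hsingle : ∀ (i : S) {x : A}, x ∈ 𝒜 1 → ∀ s, (Pi.single i x : S → A) s ∈ 𝒜 1 := by
    intro i x hx s
    rw [Pi.single_apply]
    split_ifs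
    · exact hx
    · exact Submodule.zero_mem _
  have ha' : ∀ s, a' s ∈ 𝒜 1 := fun s => sub_mem (hsingle i (hb j) s) (hsingle j (hb i) s)
  have hb' : ∀ s, b' s ∈ 𝒜 1 := fun s => sub_mem (hsingle j (ha i) s) (hsingle i (ha j) s)
  refine ⟨a i * b j - a j * b i, pureSpinorProjector c d a b a' b',
    fromCols ((4⁻¹ : k) • (cliffordMatrix c a' * cliffordMatrix d b * cliffordMatrix c b'))
      ((2⁻¹ : k) • (a i * b j - a j * b i) • cliffordMatrix c b'),
    sub_mem (SetLike.GradedMul.mul_mem (ha i) (hb j)) (SetLike.GradedMul.mul_mem (ha j) (hb i)),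
    hij, fun l l' => ?_, ?_, ?_, ?_⟩
  · exact Submodule.smul_mem _ _ (mul_apply_mem_graded (mul_apply_mem_graded
      (cliffordMatrix_mem_graded ha) (cliffordMatrix_mem_graded ha')) (mul_apply_mem_graded
      (cliffordMatrix_mem_graded hb) (cliffordMatrix_mem_graded hb')) l l')
  · rw [fromRows_mul, cliffordMatrix_mul_pureSpinorProjector_left H h2 h,
      cliffordMatrix_mul_pureSpinorProjector_right H h2 h, fromRows_zero]
  · rw [sub_pureSpinorProjector_eq H h2 h, fromCols_mul_fromRows, Matrix.smul_mul,
      Matrix.smul_mul, Matrix.smul_mul]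
  · let φ := IsScalarTower.toAlgHom k A (projPrime p).ResidueField
    have hg : φ (a i * b j - a j * b i) ≠ 0 := fun h0 =>
      hij (Ideal.algebraMap_residueField_eq_zero.mp h0)
    have h4 := rank_pureSpinorProjector (K := (projPrime p).ResidueField) H h2
      (h.map φ.toRingHom) hg hS
    have h5 := map_pureSpinorProjector (c := c) (d := d) φ a b a' b'
    have h6 : (pureSpinorProjector c d a b a' b').map (algebraMap A (projPrime p).ResidueField) =
      pureSpinorProjector c d (φ ∘ a) (φ ∘ b) (φ ∘ a') (φ ∘ b') := h5
    rw [h6]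
    refine Nat.eq_of_mul_eq_mul_left four_pos (Eq.trans ?_ hr)
    exact h4

end SpinorSheaf

/-! ### The module of twisted sections as a cokernel -/

section CokernelMap

open Matrix

variable {R A J X : Type*} [CommRing R] [CommRing A] [Fintype J] [DecidableEq J] [AddCommGroup X]
  [Module A X] [Module R X]

/-- Modulo `(f, g)`, the kernel of `(C, D)` is isomorphic to the cokernel of `(A, B)`, via the
matrix `B C`. -/
theorem IsAnticommutingFactorization.exists_cokernel_map {f g : R} {M₁ M₂ M₃ M₄ : Matrix J J R}
    (H : IsAnticommutingFactorization f g M₁ M₂ M₃ M₄) (hfg : IsRegularPair f g) (φ : R →+* A)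
    (hφ : Function.Surjective φ) (hker : ∀ r, φ r = 0 ↔ r ∈ Ideal.span {f, g})
    (hsmul : ∀ (r : R) (x : X), r • x = φ r • x)
    (e : X ≃ₗ[A] LinearMap.ker (fromRows (M₃.map φ) (M₄.map φ)).mulVecLin) :
    ∃ π : (J → R) →ₗ[R] X, Function.Surjective π ∧
      (∀ w, π w = 0 ↔ ∃ u v, w = M₁ *ᵥ u + M₂ *ᵥ v) ∧
      ∀ w, (e (π w) : J → A) = φ ∘ (M₂ *ᵥ M₃ *ᵥ w) := by
  have hmul : ∀ (M : Matrix J J R) (w : J → R), M.map φ *ᵥ (φ ∘ w) = φ ∘ (M *ᵥ w) := fun M w =>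
    funext fun i => (RingHom.map_mulVec φ M w i).symm
  have hmem : ∀ w : J → R, φ ∘ w ∈ LinearMap.ker (fromRows (M₃.map φ) (M₄.map φ)).mulVecLin ↔
      φ ∘ (M₃ *ᵥ w) = 0 ∧ φ ∘ (M₄ *ᵥ w) = 0 := fun w => by
    rw [LinearMap.mem_ker, mulVecLin_apply, fromRows_mulVec, hmul, hmul,
      ← Sum.elim_zero_zero, Sum.elim_eq_iff]
  have hzero : ∀ w : J → R, φ ∘ w = 0 ↔ ∃ p q, w = f • p + g • q := by
    intro w
    constructor
    · intro h
      have h1 : ∀ j, ∃ p q, f * p + g * q = w j := fun j => by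
        obtain ⟨p, q, hpq⟩ := Ideal.mem_span_pair.mp ((hker _).mp (congrFun h j))
        exact ⟨p, q, by rw [← hpq]; ring⟩
      choose p q hpq using h1
      exact ⟨p, q, funext fun j => (hpq j).symm⟩
    · rintro ⟨p, q, rfl⟩
      exact funext fun j => (hker _).mpr (Ideal.mem_span_pair.mpr
        ⟨p j, q j, by simp [mul_comm]⟩)
  have hBC : ∀ w, φ ∘ (M₂ *ᵥ M₃ *ᵥ w) ∈
      LinearMap.ker (fromRows (M₃.map φ) (M₄.map φ)).mulVecLin := fun w => by
    rw [hmem, hzero, hzero]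
    refine ⟨⟨-(M₄ *ᵥ w), 0, ?_⟩, ⟨0, M₃ *ᵥ w, ?_⟩⟩
    · rw [H.symm.AD_mulVec, H.AC_mulVec, mulVec_smul, smul_neg, smul_zero, add_zero]
    · rw [H.symm.swap.AC_mulVec, smul_zero, zero_add]
  let π : (J → R) →ₗ[R] X :=
    { toFun := fun w => e.symm ⟨φ ∘ (M₂ *ᵥ M₃ *ᵥ w), hBC w⟩
      map_add' := fun w w' => by
        rw [← map_add]
        congr 1
        refine Subtype.ext (funext fun j => ?_)
        simp [mulVec_add]
      map_smul' := fun r w => by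
        rw [RingHom.id_apply, hsmul, ← map_smul]
        congr 1
        refine Subtype.ext (funext fun j => ?_)
        simp [mulVec_smul] }
  have hπ : ∀ w, (e (π w) : J → A) = φ ∘ (M₂ *ᵥ M₃ *ᵥ w) := fun w =>
    congrArg Subtype.val (e.apply_symm_apply _)
  refine ⟨π, fun x => ?_, fun w => ?_, hπ⟩
  · obtain ⟨y, hy⟩ : ∃ y : J → R, φ ∘ y = e x :=
      ⟨fun j => (hφ ((e x : J → A) j)).choose, funext fun j => (hφ ((e x : J → A) j)).choose_spec⟩
    have h1 := (e x).2
    rw [← hy, hmem, hzero, hzero] at h1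
    obtain ⟨⟨p, q, hC⟩, r, s, hD⟩ := h1
    obtain ⟨w, y', z', hw⟩ := H.exists_eq_BC_mulVec hfg hC hD
    refine ⟨w, e.injective (Subtype.ext ?_)⟩
    rw [hπ, ← hy, ← sub_eq_zero]
    have h2 : φ ∘ (M₂ *ᵥ M₃ *ᵥ w - y) = 0 := (hzero _).mpr ⟨-y', -z', by
      rw [hw, smul_neg, smul_neg]
      abel⟩
    rw [← h2]
    exact funext fun j => (map_sub φ _ _).symm
  · have h1 : π w = 0 ↔ φ ∘ (M₂ *ᵥ M₃ *ᵥ w) = 0 := by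
      rw [← hπ, ← e.map_eq_zero_iff]
      exact Submodule.coe_eq_zero.symm
    rw [h1, hzero]
    constructor
    · rintro ⟨p, q, hpq⟩
      exact H.exists_eq_of_BC_mulVec hfg hpq
    · rintro ⟨u, v, rfl⟩
      refine ⟨M₂ *ᵥ u, -(M₁ *ᵥ v), ?_⟩
      have h3 : M₃ *ᵥ M₂ *ᵥ v = -(M₄ *ᵥ M₁ *ᵥ v) := H.symm.AD_mulVec
      rw [mulVec_add, mulVec_add, H.symm.AC_mulVec, mulVec_smul, h3, mulVec_neg,
        H.swap.AC_mulVec, smul_neg]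

end CokernelMap

/-! ### Diagonal equations -/

section LinearChange

open Matrix MvPolynomial

variable {k ι : Type*} [Field k] [Fintype ι]

theorem quadraticPolynomial_add_smul (S T : Matrix ι ι k) (c : k) :
    quadraticPolynomial (S + c • T) = quadraticPolynomial S + C c * quadraticPolynomial T := by
  rw [quadraticPolynomial, quadraticPolynomial, quadraticPolynomial, Matrix.map_add _ (map_add C),
    Matrix.map_smul' _ _ _ (map_mul C), add_mulVec, smul_mulVec, dotProduct_add, dotProduct_smul,
    smul_eq_mul]

theorem PencilIsSmooth.add_smul {S T : Matrix ι ι k} (h : PencilIsSmooth S T) (c : k) :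
    PencilIsSmooth (S + c • T) T := by
  intro x hx hST hT α β hαβ
  rw [add_mulVec, smul_mulVec, dotProduct_add, dotProduct_smul, hT, smul_zero, add_zero] at hST
  obtain ⟨h1, h2⟩ := h x hx hST hT α (α * c + β) (by
    rw [← hαβ, add_mulVec, smul_mulVec, smul_add, _root_.add_smul, mul_smul]
    abel)
  rw [h1, zero_mul, zero_add] at h2
  exact ⟨h1, h2⟩

/-- The linear substitution `X ↦ G X`. -/
def linearSubstitution (G : Matrix ι ι k) : MvPolynomial ι k →ₐ[k] MvPolynomial ι k :=
  aeval (G.map C *ᵥ X)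

theorem linearSubstitution_linearSubstitution_X (G G' : Matrix ι ι k) (i : ι) :
    linearSubstitution G (linearSubstitution G' (X i)) = ((G' * G).map C *ᵥ X) i := by
  rw [linearSubstitution, linearSubstitution, aeval_X, Matrix.map_mul, ← mulVec_mulVec, mulVec,
    mulVec, dotProduct, dotProduct, map_sum]
  refine Finset.sum_congr rfl fun j _ => ?_
  rw [map_mul, map_apply, aeval_X, ← algebraMap_eq, AlgHom.commutes]

variable [DecidableEq ι]

/-- The automorphism `X ↦ G X` for an invertible matrix `G`. -/
def linearChange (G : Matrix ι ι k) (hG : IsUnit G.det) : MvPolynomial ι k ≃ₐ[k] MvPolynomial ι k :=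
  AlgEquiv.ofAlgHom (linearSubstitution G) (linearSubstitution G⁻¹)
    (algHom_ext fun i => by
      rw [AlgHom.comp_apply, linearSubstitution_linearSubstitution_X, nonsing_inv_mul _ hG,
        Matrix.map_one _ (map_zero C) (map_one C), one_mulVec]
      rfl)
    (algHom_ext fun i => by
      rw [AlgHom.comp_apply, linearSubstitution_linearSubstitution_X, mul_nonsing_inv _ hG,
        Matrix.map_one _ (map_zero C) (map_one C), one_mulVec]
      rfl)

theorem linearChange_X {G : Matrix ι ι k} (hG : IsUnit G.det) (i : ι) :
    linearChange G hG (X i) = (G.map C *ᵥ X) i := by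
  change linearSubstitution G (X i) = _
  rw [linearSubstitution, aeval_X]

theorem linearChange_diagonalForm {G : Matrix ι ι k} (hG : IsUnit G.det) (a : ι → k) :
    linearChange G hG (diagonalForm Finset.univ a) =
      quadraticPolynomial (Gᵀ * diagonal a * G) := by
  rw [diagonalForm, map_sum, quadraticPolynomial, Matrix.map_mul, Matrix.map_mul,
    ← mulVec_mulVec, ← mulVec_mulVec, dotProduct_mulVec, transpose_map, vecMul_transpose,
    diagonal_map (map_zero C), dotProduct]
  refine Finset.sum_congr rfl fun i _ => ?_
  rw [map_mul, map_pow, linearChange_X, mulVec_diagonal, ← algebraMap_eq, AlgEquiv.commutes]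
  ring

end LinearChange

section NormalForm

open Matrix MvPolynomial

variable {k : Type u} [Field k]

/-- The equations of a smooth complete intersection of two quadrics can be diagonalized
simultaneously, with distinct eigenvalues. -/
theorem IsSmoothCompleteIntersection.exists_diagonalForm [IsAlgClosed k] (hk : ringChar k ≠ 2)
    {N : ℕ} (hN : 2 ≤ N) {q₁ q₂ : MvPolynomial (Fin (N + 1)) k} {h₁ : q₁.IsHomogeneous 2}
    {h₂ : q₂.IsHomogeneous 2} (hX : IsSmoothCompleteIntersection q₁ q₂ h₁ h₂) :
    ∃ (G : Matrix (Fin (N + 1)) (Fin (N + 1)) k) (hG : IsUnit G.det) (a : Fin (N + 1) → k),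
      Function.Injective a ∧ Ideal.span {q₁, q₂} =
        Ideal.span {linearChange G hG (diagonalForm Finset.univ 1),
          linearChange G hG (diagonalForm Finset.univ a)} := by
  have h2 : (2 : k) ≠ 0 := Ring.two_ne_zero hk
  obtain ⟨S, hS, rfl⟩ := exists_isSymm_eq_quadraticPolynomial h2 h₁
  obtain ⟨T, hT, rfl⟩ := exists_isSymm_eq_quadraticPolynomial h2 h₂
  have h := hX.pencilIsSmooth hN hS hT
  obtain ⟨c, hc⟩ := h.exists_det_ne_zero hS hT
  obtain ⟨G, a, hG, ha, hSG, hTG⟩ := (h.add_smul c).exists_diagonal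
    (hS.add (hT.smul c)) hT hc
  refine ⟨G, hG, a, ha, ?_⟩
  have hone : (diagonal 1 : Matrix (Fin (N + 1)) (Fin (N + 1)) k) = 1 := diagonal_one
  rw [linearChange_diagonalForm, linearChange_diagonalForm, hone, Matrix.mul_one, ← hSG, ← hTG,
    quadraticPolynomial_add_smul]
  exact (Ideal.span_pair_add_mul_right _ _ _).symm

end NormalForm

section Cover

attribute [local instance] MvPolynomial.gradedAlgebra

variable {k : Type u} [Field k] {N : ℕ}
  {I : HomogeneousIdeal (MvPolynomial.homogeneousSubmodule (Fin (N + 1)) k)}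

/-- The homogeneous coordinates have no common zero. -/
theorem ProjectiveSubscheme.exists_coord_notMem (p : ProjectiveSubscheme I) :
    ∃ i, (ProjectiveSubscheme.coord I i : _ ⧸ I.toIdeal) ∉ projPrime p := by
  by_contra! h
  refine ProjectiveSpectrum.not_irrelevant_le p fun x hx => ?_
  change x ∈ projPrime p
  obtain ⟨f, rfl⟩ := Ideal.Quotient.mk_surjective x
  rw [HomogeneousIdeal.mem_irrelevant_iff, GradedRing.proj_apply,
    decompose_quotientGrading_mk] at hx
  have h1 : (DirectSum.decompose (MvPolynomial.homogeneousSubmodule (Fin (N + 1)) k) f 0 :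
      MvPolynomial (Fin (N + 1)) k) = MvPolynomial.C (MvPolynomial.coeff 0 f) := by
    rw [← MvPolynomial.homogeneousComponent_zero]
    exact MvPolynomial.decomposition.decompose'_apply f 0
  rw [h1] at hx
  have h2 : f - MvPolynomial.C (MvPolynomial.coeff 0 f) ∈
      (projPrime p).comap (Ideal.Quotient.mk I.toIdeal) := by
    have h3 := sub_killVariables_mem Finset.univ f
    have h4 : killVariables k Finset.univ f = MvPolynomial.C (MvPolynomial.coeff 0 f) := by
      simp only [killVariables, Finset.mem_univ, if_true]
      exact MvPolynomial.aeval_zero' f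
    rw [h4] at h3
    refine Ideal.span_le.mpr ?_ h3
    rintro _ ⟨i, -, rfl⟩
    exact h i
  have h3 := Ideal.mem_comap.mp h2
  rwa [map_sub, hx, sub_zero] at h3

end Cover

/-! ### Linear coordinates as regular sequences -/

section RegularSequence

open MvPolynomial

variable {k ι : Type*} [Field k]

theorem mem_span_X_image_of_mul_mem (σ : MvPolynomial ι k ≃ₐ[k] MvPolynomial ι k) {s : Finset ι}
    {i : ι} (hi : i ∉ s) {u : MvPolynomial ι k}
    (hu : σ (X i) * u ∈ Ideal.span ((fun j => σ (X j)) '' (s : Set ι))) :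
    u ∈ Ideal.span ((fun j => σ (X j)) '' (s : Set ι)) := by
  classical
  have hmap : Ideal.span ((fun j => σ (X j)) '' (s : Set ι)) =
      (Ideal.span (X '' (s : Set ι) : Set (MvPolynomial ι k))).map
        (σ : _ →+* MvPolynomial ι k) := by
    rw [Ideal.map_span, Set.image_image]
    rfl
  have hmem : ∀ v, σ v ∈ Ideal.span ((fun j => σ (X j)) '' (s : Set ι)) ↔
      v ∈ Ideal.span (X '' (s : Set ι) : Set (MvPolynomial ι k)) := fun v => by
    rw [hmap]
    exact Ideal.apply_mem_of_equiv_iff (f := σ.toRingEquiv)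
  rw [← σ.apply_symm_apply u] at hu ⊢
  rw [← map_mul, hmem] at hu
  rw [hmem]
  refine ((isPrime_span_X_image s).mem_or_mem hu).resolve_left fun h => ?_
  rw [← killVariables_eq_zero_iff, killVariables, aeval_X, if_neg hi] at h
  exact X_ne_zero i h

variable [Fintype ι] [DecidableEq ι]

/-- After a change of coordinates, the two forms stay a regular pair modulo linear coordinates as
long as two coordinates remain. -/
theorem isRegularPair_mod_span_sup (σ : MvPolynomial ι k ≃ₐ[k] MvPolynomial ι k) {a : ι → k}
    (ha : Function.Injective a) {s : Finset ι} {i : ι}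
    (hs : (insert i s).card + 2 ≤ Fintype.card ι) :
    IsRegularPair
      (Ideal.Quotient.mk (Ideal.span ((fun j => σ (X j)) '' (s : Set ι)) ⊔ Ideal.span {σ (X i)})
        (σ (diagonalForm Finset.univ 1)))
      (Ideal.Quotient.mk (Ideal.span ((fun j => σ (X j)) '' (s : Set ι)) ⊔ Ideal.span {σ (X i)})
        (σ (diagonalForm Finset.univ a))) := by
  have hmap : Ideal.span ((fun j => σ (X j)) '' (s : Set ι)) ⊔ Ideal.span {σ (X i)} =
      (Ideal.span (X '' ((insert i s : Finset ι) : Set ι) : Set (MvPolynomial ι k))).map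
        (σ.toRingEquiv : _ →+* MvPolynomial ι k) := by
    rw [Ideal.map_span, Set.image_image, Finset.coe_insert, Set.image_insert_eq, Ideal.span_insert,
      sup_comm]
    rfl
  exact (isRegularPair_diagonalForm_mod ha hs).map_ringEquiv
    (Ideal.quotientEquiv _ _ σ.toRingEquiv hmap)

theorem isRegularPair_diagonalForm (σ : MvPolynomial ι k ≃ₐ[k] MvPolynomial ι k) {a : ι → k}
    (ha : Function.Injective a) (hι : 2 ≤ Fintype.card ι) :
    IsRegularPair (σ (diagonalForm Finset.univ 1)) (σ (diagonalForm Finset.univ a)) := by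
  have h := isRegularPair_diagonalForm_mod ha (s := ∅) (by simpa using hι)
  have h0 : Ideal.span (X '' ((∅ : Finset ι) : Set ι) : Set (MvPolynomial ι k)) = ⊥ := by simp
  rw [h0] at h
  exact (h.map_ringEquiv (RingEquiv.quotientBot _)).map_ringEquiv σ.toRingEquiv

end RegularSequence

section KernelSections

open MvPolynomial

attribute [local instance] MvPolynomial.gradedAlgebra

variable {k : Type u} [Field k] {N : ℕ}
  {I : HomogeneousIdeal (MvPolynomial.homogeneousSubmodule (Fin (N + 1)) k)}
  {σ : MvPolynomial (Fin (N + 1)) k ≃ₐ[k] MvPolynomial (Fin (N + 1)) k} {a : Fin (N + 1) → k}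

theorem mk_mem_quotientGrading {p : MvPolynomial (Fin (N + 1)) k} {d : ℕ} (hp : p.IsHomogeneous d) :
    Ideal.Quotient.mk I.toIdeal p ∈ quotientGrading I d := ⟨p, hp, rfl⟩

/-- Two linear coordinates form a regular sequence on the coordinate ring, in either order. -/
theorem kernelSectionsHypothesis_of_diagonal (hN : 4 ≤ N + 1) (ha : Function.Injective a)
    (hσ : ∀ i, (σ (X i)).IsHomogeneous 1)
    (hI : I.toIdeal = Ideal.span {σ (diagonalForm Finset.univ 1), σ (diagonalForm Finset.univ a)})
    {ι κ : Type} [Fintype ι] {Θ : Matrix κ ι (MvPolynomial (Fin (N + 1)) k)}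
    (hΘ : ∀ i j, (Θ i j).IsHomogeneous 1) {i j : Fin (N + 1)} (hij : i ≠ j) :
    KernelSectionsHypothesis (𝒜 := quotientGrading I) (Θ.map (Ideal.Quotient.mk I.toIdeal))
      (ProjectiveSubscheme.coord I) (Ideal.Quotient.mk I.toIdeal (σ (X i)))
      (Ideal.Quotient.mk I.toIdeal (σ (X j))) := by
  have hmem : ∀ w, Ideal.Quotient.mk I.toIdeal w = 0 ↔ ∃ u v,
      σ (diagonalForm Finset.univ 1) * u + σ (diagonalForm Finset.univ a) * v = w := fun w => by
    rw [Ideal.Quotient.eq_zero_iff_mem, hI, Ideal.mem_span_pair]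
    simp only [mul_comm]
  have hreg : ∀ l w, Ideal.Quotient.mk I.toIdeal (σ (X l)) * w = 0 → w = 0 := by
    intro l w hw
    obtain ⟨w, rfl⟩ := Ideal.Quotient.mk_surjective w
    rw [← map_mul, hmem] at hw
    obtain ⟨u, v, huv⟩ := hw
    have hpair := isRegularPair_mod_span_sup σ ha (s := ∅) (i := l) (by
      rw [Fintype.card_fin]
      simp
      omega)
    obtain ⟨u', v', h⟩ := hpair.exists_sub_mem _
      (fun a ha => mem_span_X_image_of_mul_mem σ (Finset.notMem_empty l) ha)
      (w := w) (u := u) (v := v) (by rw [huv, sub_self]; exact Submodule.zero_mem _)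
    rw [Finset.coe_empty, Set.image_empty, Ideal.span_empty, Ideal.mem_bot, sub_eq_zero] at h
    exact (hmem w).mpr ⟨u', v', h.symm⟩
  refine ⟨fun _ _ => mk_mem_quotientGrading (hΘ _ _), ProjectiveSubscheme.exists_coord_notMem,
    mk_mem_quotientGrading (hσ i), mk_mem_quotientGrading (hσ j), hreg i, hreg j, fun b c h => ?_⟩
  obtain ⟨b, rfl⟩ := Ideal.Quotient.mk_surjective b
  obtain ⟨c, rfl⟩ := Ideal.Quotient.mk_surjective c
  rw [← sub_eq_zero, ← map_mul, ← map_mul, ← map_sub, hmem] at h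
  obtain ⟨u, v, huv⟩ := h
  have hpair := isRegularPair_mod_span_sup σ ha (s := {i}) (i := j) (by
    rw [Fintype.card_fin, Finset.card_insert_of_notMem (by simpa using hij.symm),
      Finset.card_singleton]
    omega)
  obtain ⟨u', v', h⟩ := hpair.exists_sub_mem _
    (fun a ha => mem_span_X_image_of_mul_mem σ (by simpa using hij.symm) ha)
    (w := b) (u := u) (v := v) (by
      rw [huv, sub_sub_cancel]
      exact Ideal.mul_mem_right _ _ (Ideal.subset_span ⟨i, by simp, rfl⟩))
  rw [Finset.coe_singleton, Set.image_singleton] at h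
  obtain ⟨x, hx⟩ := Ideal.mem_span_singleton.mp h
  refine ⟨Ideal.Quotient.mk _ x, ?_⟩
  rw [← map_mul, ← hx, ← sub_eq_zero, ← map_sub, hmem]
  exact ⟨u', v', by ring⟩

end KernelSections

/-! ### The Cohen-Macaulay property -/

section CohenMacaulay

open MvPolynomial Matrix

attribute [local instance] MvPolynomial.gradedAlgebra

theorem constantCoeff_eq_zero_of_isHomogeneous_one {k ι : Type*} [Field k] {p : MvPolynomial ι k}
    (hp : p.IsHomogeneous 1) : constantCoeff p = 0 :=
  hp.coeff_eq_zero (by simp)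

variable {k : Type u} [Field k] {N : ℕ}
  {I : HomogeneousIdeal (MvPolynomial.homogeneousSubmodule (Fin (N + 1)) k)}
  {σ : MvPolynomial (Fin (N + 1)) k ≃ₐ[k] MvPolynomial (Fin (N + 1)) k} {a : Fin (N + 1) → k}

/-- The cokernel of `(A, B)` is maximal Cohen-Macaulay: all but two of the linear coordinates form a
regular sequence on it, since its resolution stays exact modulo these coordinates. -/
theorem isMaximalCohenMacaulay_of_diagonal (hN : 1 ≤ N) (ha : Function.Injective a)
    (hσ : ∀ i, (σ (X i)).IsHomogeneous 1)
    (hI : I.toIdeal = Ideal.span {σ (diagonalForm Finset.univ 1), σ (diagonalForm Finset.univ a)})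
    {J : Type} [Fintype J] [DecidableEq J] [Nonempty J] {X : Type u} [AddCommGroup X]
    [Module (MvPolynomial (Fin (N + 1)) k ⧸ I.toIdeal) X] [Module (MvPolynomial (Fin (N + 1)) k) X]
    [Module.Finite (MvPolynomial (Fin (N + 1)) k ⧸ I.toIdeal) X]
    (hsmul : ∀ (r : MvPolynomial (Fin (N + 1)) k) (x : X),
      r • x = Ideal.Quotient.mk I.toIdeal r • x)
    {A B C D : Matrix J J (MvPolynomial (Fin (N + 1)) k)}
    (H : IsAnticommutingFactorization (σ (diagonalForm Finset.univ 1))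
      (σ (diagonalForm Finset.univ a)) A B C D)
    (hA : ∀ i j, (A i j).IsHomogeneous 1) (hB : ∀ i j, (B i j).IsHomogeneous 1)
    (π : (J → MvPolynomial (Fin (N + 1)) k) →ₗ[MvPolynomial (Fin (N + 1)) k] X)
    (hπ : Function.Surjective π) (hker : ∀ w, π w = 0 ↔ ∃ u v, w = A *ᵥ u + B *ᵥ v) :
    IsMaximalCohenMacaulay (quotientGrading I) X := by
  obtain ⟨l, hl, hlen⟩ : ∃ l : List (Fin (N + 1)), l.Nodup ∧ l.length + 2 = N + 1 :=
    ⟨(List.finRange (N + 1)).take (N - 1), (List.nodup_finRange _).sublist (List.take_sublist _ _),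
      by simp; omega⟩
  let rs := l.map fun i => σ (MvPolynomial.X i)
  have hspan : ∀ i, Ideal.ofList (rs.take i) =
      Ideal.span
        ((fun j => σ (MvPolynomial.X j)) '' ((l.take i).toFinset : Set (Fin (N + 1)))) := by
    intro i
    rw [Ideal.ofList]
    congr 1
    ext x
    simp [rs, ← List.map_take]
  have hnotMem : ∀ i (h : i < l.length), l[i] ∉ (l.take i).toFinset := by
    intro i h hmem
    rw [List.mem_toFinset, List.mem_take_iff_getElem] at hmem
    obtain ⟨j, hj, hji⟩ := hmem
    have := (hl.getElem_inj_iff).mp hji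
    omega
  -- regularity on the module `X`: the coordinates are a regular sequence on the polynomial ring,
  -- and the two forms remain a regular pair modulo each initial part, where at least two
  -- coordinates are left
  have hreg : RingTheory.Sequence.IsRegular X rs := by
    refine H.isRegular π hπ hker (fun i h b hb => ?_) (fun i h => ?_)
      (RingHom.ker_ne_top (constantCoeff : MvPolynomial (Fin (N + 1)) k →+* k)) ?_
      (fun i j => constantCoeff_eq_zero_of_isHomogeneous_one (hA i j))
      (fun i j => constantCoeff_eq_zero_of_isHomogeneous_one (hB i j))
    · have hi : i < l.length := by simpa [rs] using h
      have h1 : rs[i] = σ (MvPolynomial.X l[i]) := List.getElem_map _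
      rw [hspan] at hb ⊢
      rw [h1] at hb
      exact mem_span_X_image_of_mul_mem σ (hnotMem i hi) hb
    · have hi : i < l.length := by simpa [rs] using h
      have h1 : rs[i] = σ (MvPolynomial.X l[i]) := List.getElem_map _
      rw [hspan, h1]
      refine isRegularPair_mod_span_sup σ ha ?_
      rw [Finset.card_insert_of_notMem (hnotMem i hi),
        List.toFinset_card_of_nodup (hl.sublist (List.take_sublist _ _)), List.length_take,
        Fintype.card_fin]
      omega
    · intro r hr
      obtain ⟨i, -, rfl⟩ := List.mem_map.mp hr
      exact constantCoeff_eq_zero_of_isHomogeneous_one (hσ i)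
  have hreg' : RingTheory.Sequence.IsRegular X (rs.map (Ideal.Quotient.mk I.toIdeal)) :=
    (AddEquiv.isRegular_congr (e := AddEquiv.refl X) (List.forall₂_map_right_iff.mpr
      (List.forall₂_same.mpr fun r _ x => hsmul r x))).mp hreg
  refine ⟨inferInstance, rs.map (Ideal.Quotient.mk I.toIdeal), fun r hr => ?_, hreg', ?_⟩
  · obtain ⟨y, hy, rfl⟩ := List.mem_map.mp hr
    obtain ⟨i, -, rfl⟩ := List.mem_map.mp hy
    exact mem_irrelevant_of_mem (mk_mem_quotientGrading (hσ i)) one_pos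
  -- the dimension is at least the length of a regular sequence, and at most `N - 1`
  · have h1 := length_le_ringKrullDim_of_isRegular hreg'
    have h2 := (isRegularPair_diagonalForm σ ha (by rw [Fintype.card_fin]; omega)
      ).ringKrullDim_quotient_add_two_le (I := I.toIdeal)
      (hI ▸ Ideal.subset_span (Set.mem_insert _ _))
      (hI ▸ Ideal.subset_span (Set.mem_insert_of_mem _ rfl))
    have h3 : ringKrullDim (MvPolynomial (Fin (N + 1)) k) = ((N + 1 : ℕ) : WithBot ℕ∞) := by
      rw [MvPolynomial.ringKrullDim_of_isNoetherianRing, ringKrullDim_eq_zero_of_field, zero_add,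
        Nat.card_fin]
    have h4 : (rs.map (Ideal.Quotient.mk I.toIdeal)).length = l.length := by simp [rs]
    rw [h3] at h2
    rw [h4] at h1 ⊢
    refine le_antisymm h1 ?_
    generalize ringKrullDim (MvPolynomial (Fin (N + 1)) k ⧸ I.toIdeal) = δ at h1 h2 ⊢
    induction δ using WithBot.recBotCoe with
    | bot => exact bot_le
    | coe δ =>
      induction δ using ENat.recTopCoe with
      | top => exact absurd (WithBot.coe_le_coe.mp h2) (not_le.mpr (ENat.natCast_lt_top (N + 1)))
      | coe δ =>
        norm_cast at h2 ⊢
        omega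

end CohenMacaulay

/-! ### The spinor sheaf is Ulrich -/

section Ulrich

open MvPolynomial Matrix

attribute [local instance] MvPolynomial.gradedAlgebra

theorem isHomogeneous_cliffordMatrix {k : Type u} [Field k] {N : ℕ} {S J : Type} [Fintype S]
    {c : S → Matrix J J k} {Φ : S → MvPolynomial (Fin (N + 1)) k}
    (hΦ : ∀ s, (Φ s).IsHomogeneous 1) (i j : J) : (cliffordMatrix c Φ i j).IsHomogeneous 1 :=
  cliffordMatrix_mem_graded (𝒜 := MvPolynomial.homogeneousSubmodule (Fin (N + 1)) k) hΦ i j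

variable {k : Type u} [Field k] {N : ℕ}
  {I : HomogeneousIdeal (MvPolynomial.homogeneousSubmodule (Fin (N + 1)) k)}
  {σ : MvPolynomial (Fin (N + 1)) k ≃ₐ[k] MvPolynomial (Fin (N + 1)) k} {a : Fin (N + 1) → k}
  {S J : Type} [Fintype S] [DecidableEq S] [Fintype J] [DecidableEq J] {c d : S → Matrix J J k}
  {Φ Ψ : S → MvPolynomial (Fin (N + 1)) k}

/-- The Clifford matrices of two orthogonal vectors anticommute, and their squares are the values of
the quadratic form. -/
theorem IsCliffordPair.isAnticommutingFactorization {R : Type*} [CommRing R] [Algebra k R]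
    (H : IsCliffordPair c d) (h2 : (2 : k) ≠ 0) {Φ Ψ : S → R} {f g : R} (hΦ : Φ ⬝ᵥ Φ = f)
    (hΨ : Ψ ⬝ᵥ Ψ = g) (hΦΨ : Φ ⬝ᵥ Ψ = 0) :
    IsAnticommutingFactorization f g (cliffordMatrix c Φ) (cliffordMatrix c Ψ)
      (cliffordMatrix d Φ) (cliffordMatrix d Ψ) where
  mul_AC := by rw [H.mul_self h2, hΦ]
  mul_CA := by rw [H.symm.mul_self h2, hΦ]
  mul_BD := by rw [H.mul_self h2, hΨ]
  mul_DB := by rw [H.symm.mul_self h2, hΨ]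
  mul_AD := H.mul_add_mul_eq_zero hΦΨ
  mul_CB := H.symm.mul_add_mul_eq_zero hΦΨ

/-- The spinors killed by two orthogonal vectors of linear forms whose squares are the equations of
`X` form an Ulrich sheaf. On `𝒪(2) ^ J` the kernel of `(d(Φ), d(Ψ))` has as twisted sections the
image of `c(Ψ) d(Φ)`, whose entries are quadratic, so that the generators lie in degree zero. -/
theorem isUlrich_spinorSheaf (hN : 4 ≤ N + 1) (ha : Function.Injective a)
    (hσ : ∀ i, (σ (X i)).IsHomogeneous 1)
    (hI : I.toIdeal = Ideal.span {σ (diagonalForm Finset.univ 1), σ (diagonalForm Finset.univ a)})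
    [Nonempty J] (H : IsCliffordPair c d) (h2 : (2 : k) ≠ 0)
    (hΦ : Φ ⬝ᵥ Φ = σ (diagonalForm Finset.univ 1)) (hΨ : Ψ ⬝ᵥ Ψ = σ (diagonalForm Finset.univ a))
    (hΦΨ : Φ ⬝ᵥ Ψ = 0) (hΦ1 : ∀ s, (Φ s).IsHomogeneous 1) (hΨ1 : ∀ s, (Ψ s).IsHomogeneous 1) :
    IsUlrich (I := I) (kernelSheaf (quotientGrading I)
      (fromRows ((cliffordMatrix d Φ).map (Ideal.Quotient.mk I.toIdeal))
        ((cliffordMatrix d Ψ).map (Ideal.Quotient.mk I.toIdeal))) (2 : ℕ)) := by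
  have HF := H.isAnticommutingFactorization h2 hΦ hΨ hΦΨ
  have hfg := isRegularPair_diagonalForm σ ha (by rw [Fintype.card_fin]; omega)
  have hΘ : fromRows ((cliffordMatrix d Φ).map (Ideal.Quotient.mk I.toIdeal))
      ((cliffordMatrix d Ψ).map (Ideal.Quotient.mk I.toIdeal)) =
      (fromRows (cliffordMatrix d Φ) (cliffordMatrix d Ψ)).map (Ideal.Quotient.mk I.toIdeal) := by
    ext (i | i) j <;> rfl
  have h01 : (⟨0, by omega⟩ : Fin (N + 1)) ≠ ⟨1, by omega⟩ := by simp
  have HK := kernelSectionsHypothesis_of_diagonal hN ha hσ hI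
    (Θ := fromRows (cliffordMatrix d Φ) (cliffordMatrix d Ψ)) (by
      rintro (i | i) j
      · exact isHomogeneous_cliffordMatrix hΦ1 i j
      · exact isHomogeneous_cliffordMatrix hΨ1 i j) h01
  rw [← hΘ] at HK
  let e := HK.linearEquiv (t := (2 : ℕ))
  obtain ⟨π, hπ, hker, hval⟩ := HF.exists_cokernel_map hfg (Ideal.Quotient.mk I.toIdeal)
    Ideal.Quotient.mk_surjective (fun r => by rw [Ideal.Quotient.eq_zero_iff_mem, hI])
    (fun r x => rfl) e
  have hfin := Module.Finite.equiv e.symm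
  refine ⟨isMaximalCohenMacaulay_of_diagonal (by omega) ha hσ hI (fun r x => rfl) HF
    (isHomogeneous_cliffordMatrix hΦ1) (isHomogeneous_cliffordMatrix hΨ1) π hπ hker,
    HF.hasLinearFreeResolution hfg (isHomogeneous_cliffordMatrix hΦ1)
      (isHomogeneous_cliffordMatrix hΨ1) (isHomogeneous_cliffordMatrix hΦ1)
      (isHomogeneous_cliffordMatrix hΨ1) π hπ hker fun j => ?_⟩
  refine HK.mem_range_ofDegree_zero (d := 2) rfl fun i => ?_
  have h3 := congrFun (hval (Pi.single j 1)) i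
  rw [mulVec_mulVec, mulVec_single_one] at h3
  have h4 : (((cliffordMatrix c Ψ * cliffordMatrix d Φ) i j :
      MvPolynomial (Fin (N + 1)) k)).IsHomogeneous 2 :=
    mul_apply_mem_graded (𝒜 := MvPolynomial.homogeneousSubmodule (Fin (N + 1)) k)
      (isHomogeneous_cliffordMatrix hΨ1) (isHomogeneous_cliffordMatrix hΦ1) i j
  exact h3.symm ▸ mk_mem_quotientGrading h4

end Ulrich

/-! ### The spinor bundle of a smooth complete intersection -/

section Existence

open MvPolynomial Matrix

attribute [local instance] MvPolynomial.gradedAlgebra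

variable {k : Type u} [Field k]

theorem isHomogeneous_linearChange_X {ι : Type*} [Fintype ι] [DecidableEq ι] {G : Matrix ι ι k}
    (hG : IsUnit G.det) (i : ι) : (linearChange G hG (X i)).IsHomogeneous 1 := by
  rw [linearChange_X]
  exact IsHomogeneous.sum _ _ _ fun j _ => by
    simpa using (isHomogeneous_C ι (G i j)).mul (isHomogeneous_X k j)

theorem X_eq_sum_linearChange {ι : Type*} [Fintype ι] [DecidableEq ι] {G : Matrix ι ι k}
    (hG : IsUnit G.det) (i : ι) :
    (X i : MvPolynomial ι k) = ∑ j, C (G⁻¹ i j) * linearChange G hG (X j) := by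
  have h : (fun j => linearChange G hG (X j)) = G.map C *ᵥ X := funext (linearChange_X hG)
  change _ = (G⁻¹.map C *ᵥ fun j => linearChange G hG (X j)) i
  rw [h, mulVec_mulVec, ← Matrix.map_mul, nonsing_inv_mul _ hG,
    Matrix.map_one _ (map_zero C) (map_one C), one_mulVec]

variable {n : ℕ} {I : HomogeneousIdeal (MvPolynomial.homogeneousSubmodule (Fin (2 * n + 1)) k)}
  {G : Matrix (Fin (2 * n + 1)) (Fin (2 * n + 1)) k} {hG : IsUnit G.det} {a : Fin (2 * n + 1) → k}

/-- For diagonal equations the two vectors `Φ` and `Ψ` are the spinor vectors of the coordinates. -/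
theorem exists_ulrich_of_diagonal [IsAlgClosed k] (h2 : (2 : k) ≠ 0) (hn : 2 ≤ n)
    (ha : Function.Injective a)
    (hI : I.toIdeal = Ideal.span {linearChange G hG (diagonalForm Finset.univ 1),
      linearChange G hG (diagonalForm Finset.univ a)}) :
    ∃ E : (ProjectiveSubscheme I).Modules, IsVectorBundleOfRank E (2 ^ (n - 2)) ∧ IsUlrich E := by
  -- split the coordinates into blocks of `n + 1` and `n`
  let e : Fin (n + 1) ⊕ Fin n ≃ Fin (2 * n + 1) :=
    Fintype.equivOfCardEq (by simp only [Fintype.card_sum, Fintype.card_fin]; omega)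
  have hνμ : Sum.elim (a ∘ e ∘ Sum.inl) (a ∘ e ∘ Sum.inr) = a ∘ e := by
    ext (i | i) <;> rfl
  have hinj : Function.Injective (Sum.elim (a ∘ e ∘ Sum.inl) (a ∘ e ∘ Sum.inr)) :=
    hνμ ▸ ha.comp e.injective
  obtain ⟨L, hL, hL'⟩ := exists_gram_eq_diagonal (ν := a ∘ e ∘ Sum.inl) (μ := a ∘ e ∘ Sum.inr)
    (ha.comp (e.injective.comp Sum.inl_injective)) (ha.comp (e.injective.comp Sum.inr_injective))
    (fun i j h => by simpa using e.injective (ha h))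
  obtain ⟨J, _, _, c, d, hJ, H⟩ := exists_isCliffordPair (n := n) k
    (S := Fin (n + 1) ⊕ Fin (n + 1)) (by simp only [Fintype.card_sum, Fintype.card_fin]; omega)
  have : Nonempty J := Fintype.card_pos_iff.mp (hJ ▸ Nat.two_pow_pos n)
  let z : Fin (n + 1) ⊕ Fin n → MvPolynomial (Fin (2 * n + 1)) k :=
    fun i => linearChange G hG (X (e i))
  have hz : ∀ i, z i ∈ MvPolynomial.homogeneousSubmodule (Fin (2 * n + 1)) k 1 :=
    fun i => isHomogeneous_linearChange_X hG (e i)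
  have hΦ1 : ∀ s, (spinorVector z s).IsHomogeneous 1 := spinorVector_mem hz
  have hΨ1 : ∀ s, (twistedSpinorVector L z s).IsHomogeneous 1 := twistedSpinorVector_mem hz
  have hΦ : spinorVector z ⬝ᵥ spinorVector z = linearChange G hG (diagonalForm Finset.univ 1) := by
    rw [dotProduct_spinorVector, diagonalForm, map_sum, ← e.sum_comp]
    simp [z]
  have hΨ : twistedSpinorVector L z ⬝ᵥ twistedSpinorVector L z =
      linearChange G hG (diagonalForm Finset.univ a) := by
    rw [dotProduct_twistedSpinorVector hL hL', hνμ, diagonalForm, map_sum, ← e.sum_comp]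
    refine Finset.sum_congr rfl fun i _ => ?_
    rw [map_mul, map_pow, ← algebraMap_eq, AlgEquiv.commutes]
    rfl
  have hΦΨ := spinorVector_dotProduct_twistedSpinorVector L z
  have hdot : ∀ u v : Fin (n + 1) ⊕ Fin (n + 1) → MvPolynomial (Fin (2 * n + 1)) k,
      u ⬝ᵥ v ∈ I.toIdeal →
      (Ideal.Quotient.mkₐ k I.toIdeal ∘ u) ⬝ᵥ (Ideal.Quotient.mkₐ k I.toIdeal ∘ v) = 0 :=
    fun u v h => ((Ideal.Quotient.mkₐ k I.toIdeal).toRingHom.map_dotProduct u v).symm.trans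
      (Ideal.Quotient.eq_zero_iff_mem.mpr h)
  have hΦI : spinorVector z ⬝ᵥ spinorVector z ∈ I.toIdeal := by
    rw [hΦ, hI]
    exact Ideal.subset_span (Set.mem_insert _ _)
  have hΨI : twistedSpinorVector L z ⬝ᵥ twistedSpinorVector L z ∈ I.toIdeal := by
    rw [hΨ, hI]
    exact Ideal.subset_span (Set.mem_insert_of_mem _ rfl)
  refine ⟨_, ?_, isUlrich_spinorSheaf (by omega) ha (isHomogeneous_linearChange_X hG) hI H h2
    hΦ hΨ hΦΨ hΦ1 hΨ1⟩
  have hmap : ∀ u : Fin (n + 1) ⊕ Fin (n + 1) → MvPolynomial (Fin (2 * n + 1)) k,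
      (cliffordMatrix d u).map (Ideal.Quotient.mk I.toIdeal) =
        cliffordMatrix d (Ideal.Quotient.mkₐ k I.toIdeal ∘ u) :=
    cliffordMatrix_map d (Ideal.Quotient.mkₐ k I.toIdeal)
  rw [hmap, hmap]
  refine isVectorBundleOfRank_spinorSheaf H h2 (hdot _ _ hΦI) (hdot _ _ hΨI)
    (hdot _ _ (hΦΨ ▸ I.toIdeal.zero_mem)) (fun s => mk_mem_quotientGrading (hΦ1 s))
    (fun s => mk_mem_quotientGrading (hΨ1 s)) (fun p => ?_)
    (by simp only [Fintype.card_sum, Fintype.card_fin]; omega)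
    (by rw [hJ, ← Nat.add_sub_cancel' hn, pow_add, Nat.add_sub_cancel_left]; norm_num)
  by_contra! hp
  -- in the domain `(P / I) / p` the two vectors are dependent, so all coordinates lie in `p`
  let χ : MvPolynomial (Fin (2 * n + 1)) k →ₐ[k] (_ ⧸ I.toIdeal) ⧸ projPrime p :=
    (Ideal.Quotient.mkₐ k (projPrime p)).comp (Ideal.Quotient.mkₐ k I.toIdeal)
  have hχ : χ ∘ z = 0 := by
    refine eq_zero_of_spinorVector_minors hL hL' hinj ?_ fun s t => ?_
    · rw [← dotProduct_spinorVector, ← comp_spinorVector]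
      refine (χ.toRingHom.map_dotProduct _ _).symm.trans ?_
      change Ideal.Quotient.mk (projPrime p) (Ideal.Quotient.mk I.toIdeal _) = 0
      rw [Ideal.Quotient.eq_zero_iff_mem.mpr hΦI, map_zero]
    · rw [← comp_spinorVector, ← comp_twistedSpinorVector, ← sub_eq_zero]
      refine Eq.trans ?_ (Ideal.Quotient.eq_zero_iff_mem.mpr (hp s t))
      rw [map_sub, map_mul, map_mul]
      rfl
  obtain ⟨i, hi⟩ := ProjectiveSubscheme.exists_coord_notMem p
  refine hi (Ideal.Quotient.eq_zero_iff_mem.mp ?_)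
  change χ (X i) = 0
  rw [X_eq_sum_linearChange hG i, map_sum]
  refine Finset.sum_eq_zero fun j _ => ?_
  have h := congrFun hχ (e.symm j)
  simp only [z, Function.comp_apply, Equiv.apply_symm_apply, Pi.zero_apply] at h
  rw [map_mul, h, mul_zero]

end Existence
end

theorem mainTheorem3 {k : Type u} [Field k] [IsAlgClosed k] (hk : ringChar k ≠ 2)
    (n : ℕ) (hn : 2 ≤ n) (q₁ q₂ : MvPolynomial (Fin (2 * n + 1)) k)
    (h₁ : q₁.IsHomogeneous 2) (h₂ : q₂.IsHomogeneous 2)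
    (hX : IsSmoothCompleteIntersection q₁ q₂ h₁ h₂) :
    ∃ E : (ProjectiveSubscheme (twoQuadricsIdeal q₁ q₂ h₁ h₂)).Modules,
      IsVectorBundleOfRank E (2 ^ (n - 2)) ∧ IsUlrich E := by
  obtain ⟨G, hG, a, ha, hI⟩ := hX.exists_diagonalForm hk (by omega)
  exact exists_ulrich_of_diagonal (Ring.two_ne_zero hk) hn ha hI
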